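/- **Setting.** Let $M$ be a complex manifold with a Hermitian form $\omega$. A *lamination with isolated singularities* $(X,\mathcal L,E)$ in $M$ consists of a closed set $X\subset M$, a locally finite subset $E\subset X$, and an atlas $\mathcal L$ making $X\setminus E$ a Riemann surface lamination: $X\setminus E$ is covered by flow boxes, i.e. homeomorphisms $\Phi_i:U_i\to B_i\times T_i$ with $U_i$ open in $X\setminus E$, $B_i$ a domain in $\mathbb C$ and $T_i$ a locally compact metrizable space, whose changes of coordinates are locally of the form $(z,t)\mapsto(\Psi(z,t),\Lambda(t))$ with $\Psi,\Lambda$ continuous and $\Psi$ holomorphic in $z$; moreover the plaques $\Phi_i^{-1}(B_i\times\{t\})$ are holomorphically immersed in $M$ by $z\mapsto\Phi_i^{-1}(z,t)$. A *flow box* is any chart of this kind compatible with the atlas. A *leaf* is a minimal nonempty connected subset of $X\setminus E$ that contains every plaque it meets. A leaf $L$ is *wandering* if it is not closed in $X\setminus E$ and there are a point $p\in L$ and a flow box $U\ni p$ such that $L\cap U$ is just one plaque of $U$. Let $\mathcal D^{0}$ (resp. $\mathcal D^{1,1}$) be the space of compactly supported functions (resp. leafwise $(1,1)$-forms) on $X\setminus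 E$ that are smooth along the leaves, with all leafwise derivatives (of the coefficients) continuous in flow boxes. A *positive harmonic current* $T$ on $X$ is a continuous linear form on $\mathcal D^{1,1}$ which is nonnegative on nonnegative forms and satisfies $\langle T,\partial\overline\partial f\rangle=0$ for all $f\in\mathcal D^{0}$. The measure $T\wedge\omega$ is the Radon measure on $X\setminus E$ determined by $\int f\,d(T\wedge\omega)=\langle T,f\,\omega\rangle$ for all $f\in\mathcal D^{0}$, where $\omega$ on the right is restricted to the leaves. **Theorem.** Let $(X,\mathcal L,E)$ be a lamination with isolated singularities in a Hermitian complex manifold $(M,\omega)$ with $X$ compact, and let $T$ be a positive harmonic current on $X$. Then the measure $T\wedge\omega$ exists, and the union of the wandering leaves of $X$ has zero measure with respect to $T\wedge\omega$. -/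

import Mathlib

open Set Filter MeasureTheory
open scoped Topology Manifold ContDiff ComplexOrder

universe u

noncomputable section

/-! ## Smooth families of functions on a plane domain -/

section Families

variable {T : Type u} [TopologicalSpace T]

/-- A family `G t`, `t ∈ T`, of functions which are smooth (in the real sense) on `B` and all of
whose derivatives are continuous in `(z, t)`. -/
def SmoothFamily (B : Set ℂ) (G : T → ℂ → ℂ) : Prop :=
  (∀ t, ContDiffOn ℝ ∞ (G t) B) ∧
    ∀ n : ℕ, ContinuousOn (fun q : ℂ × T => iteratedFDeriv ℝ n (G q.2) q.1) (B ×ˢ (univ : Set T))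

variable {B : Set ℂ} {G H : T → ℂ → ℂ}

theorem SmoothFamily.contDiffAt (hB : IsOpen B) (hG : SmoothFamily B G) {z : ℂ} (hz : z ∈ B)
    (t : T) : ContDiffAt ℝ ∞ (G t) z :=
  (hG.1 t).contDiffAt (hB.mem_nhds hz)

theorem SmoothFamily.add (hB : IsOpen B) (hG : SmoothFamily B G) (hH : SmoothFamily B H) :
    SmoothFamily B (fun t z => G t z + H t z) := by
  refine ⟨fun t => (hG.1 t).add (hH.1 t), fun n => ?_⟩
  refine ((hG.2 n).add (hH.2 n)).congr ?_
  rintro ⟨z, t⟩ ⟨hz, -⟩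
  exact iteratedFDeriv_add_apply ((hG.contDiffAt hB hz t).of_le (by exact_mod_cast le_top))
    ((hH.contDiffAt hB hz t).of_le (by exact_mod_cast le_top))

theorem SmoothFamily.const_mul (hB : IsOpen B) (hG : SmoothFamily B G) (c : ℂ) :
    SmoothFamily B (fun t z => c * G t z) := by
  refine ⟨fun t => contDiffOn_const.mul (hG.1 t), fun n => ?_⟩
  refine ((hG.2 n).const_smul c).congr ?_
  rintro ⟨z, t⟩ ⟨hz, -⟩
  exact iteratedFDeriv_const_smul_apply (a := c)
    ((hG.contDiffAt hB hz t).of_le (by exact_mod_cast le_top))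

theorem SmoothFamily.zero : SmoothFamily B (fun (_ : T) (_ : ℂ) => (0 : ℂ)) := by
  refine ⟨fun t => contDiffOn_const, fun n => ?_⟩
  have : (fun q : ℂ × T => iteratedFDeriv ℝ n (fun _ : ℂ => (0 : ℂ)) q.1) = fun _ => 0 := by
    funext q
    exact congrFun iteratedFDeriv_fun_zero q.1
  rw [this]
  exact continuousOn_const

theorem SmoothFamily.congr (hB : IsOpen B) (hG : SmoothFamily B G)
    (h : ∀ t, ∀ z ∈ B, H t z = G t z) : SmoothFamily B H := by
  refine ⟨fun t => (hG.1 t).congr (h t), fun n => (hG.2 n).congr ?_⟩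
  rintro ⟨z, t⟩ ⟨hz, -⟩
  have : H t =ᶠ[𝓝 z] G t := by
    filter_upwards [hB.mem_nhds hz] with w hw using h t w hw
  exact (this.iteratedFDeriv ℝ n).eq_of_nhds

theorem SmoothFamily.fderiv_apply (hB : IsOpen B) (hG : SmoothFamily B G) (v : ℂ) :
    SmoothFamily B (fun t z => fderiv ℝ (G t) z v) := by
  have hd : ∀ t, ∀ z ∈ B, ContDiffAt ℝ ∞ (fderiv ℝ (G t)) z := fun t z hz =>
    (hG.contDiffAt hB hz t).fderiv_right (m := ∞) (by simp)
  refine ⟨fun t z hz => ((hd t z hz).clm_apply contDiffAt_const).contDiffWithinAt, fun n => ?_⟩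
  have key : ∀ q ∈ B ×ˢ (univ : Set T),
      iteratedFDeriv ℝ n (fun z => fderiv ℝ (G q.2) z v) q.1 =
      (ContinuousLinearMap.apply ℝ ℂ v).compContinuousMultilinearMap
        (continuousMultilinearCurryRightEquiv' ℝ n ℂ ℂ
          (iteratedFDeriv ℝ (n + 1) (G q.2) q.1)) := by
    rintro ⟨z, t⟩ ⟨hz, -⟩
    have h1 := (ContinuousLinearMap.apply ℝ ℂ v).iteratedFDeriv_comp_left (hd t z hz)
      (i := n) (by exact_mod_cast le_top)
    rw [iteratedFDeriv_succ_eq_comp_right]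
    simp only [Function.comp_apply, LinearIsometryEquiv.apply_symm_apply]
    exact h1
  refine ContinuousOn.congr ?_ key
  exact ((ContinuousLinearMap.compContinuousMultilinearMapL ℝ (fun _ : Fin n => ℂ) (ℂ →L[ℝ] ℂ) ℂ
    (ContinuousLinearMap.apply ℝ ℂ v)).continuous.comp
    (continuousMultilinearCurryRightEquiv' ℝ n ℂ ℂ).continuous).comp_continuousOn (hG.2 (n + 1))

theorem two_le_infty : (2 : WithTop ℕ∞) ≤ ∞ :=
  WithTop.coe_le_coe.2 (le_top : (2 : ℕ∞) ≤ ⊤)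

theorem laplacian_eq_fderiv {g : ℂ → ℂ} {z : ℂ} (hg : ContDiffAt ℝ 2 g z) :
    Laplacian.laplacian g z =
      fderiv ℝ (fun w => fderiv ℝ g w 1) z 1 +
        fderiv ℝ (fun w => fderiv ℝ g w Complex.I) z Complex.I := by
  have hd : DifferentiableAt ℝ (fderiv ℝ g) z :=
    (hg.fderiv_right (m := 1) (by norm_num)).differentiableAt (by norm_num)
  rw [InnerProductSpace.laplacian_eq_iteratedFDeriv_complexPlane]
  simp only [iteratedFDeriv_two_apply]
  rw [fderiv_clm_apply hd (differentiableAt_const _), fderiv_clm_apply hd (differentiableAt_const _)]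
  simp

theorem SmoothFamily.laplacian (hB : IsOpen B) (hG : SmoothFamily B G) :
    SmoothFamily B (fun t z => Laplacian.laplacian (G t) z) := by
  refine (((hG.fderiv_apply hB 1).fderiv_apply hB 1).add hB
    ((hG.fderiv_apply hB Complex.I).fderiv_apply hB Complex.I)).congr hB ?_
  intro t z hz
  exact laplacian_eq_fderiv ((hG.contDiffAt hB hz t).of_le two_le_infty)

/-- The Laplacian of the composition with a holomorphic function. -/
theorem laplacian_comp_holomorphic {g τ : ℂ → ℂ} {z : ℂ} (hg : ContDiffAt ℝ 2 g (τ z))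
    (hτ : ∀ᶠ w in 𝓝 z, DifferentiableAt ℂ τ w) :
    Laplacian.laplacian (fun w => g (τ w)) z =
      ((‖deriv τ z‖ ^ 2 : ℝ) : ℂ) * Laplacian.laplacian g (τ z) := by
  have hτa : AnalyticAt ℂ τ z := Complex.analyticAt_iff_eventually_differentiableAt.2 hτ
  have hτc : ContinuousAt τ z := hτa.continuousAt
  have hgd : ∀ᶠ y in 𝓝 (τ z), DifferentiableAt ℝ g y := by
    filter_upwards [hg.eventually (by simp)] with y hy using hy.differentiableAt (by norm_num)
  have hfd : DifferentiableAt ℝ (fderiv ℝ g) (τ z) :=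
    (hg.fderiv_right (m := 1) (by norm_num)).differentiableAt (by norm_num)
  have hdτ : DifferentiableAt ℂ (deriv τ) z := hτa.deriv.differentiableAt
  have hcomp : ContDiffAt ℝ 2 (fun w => g (τ w)) z :=
    hg.comp z ((hτa.contDiffAt (n := 2)).restrict_scalars ℝ)
  have hτr : ∀ w, DifferentiableAt ℂ τ w → ∀ v, fderiv ℝ τ w v = deriv τ w * v := by
    intro w hw v
    rw [hw.fderiv_restrictScalars ℝ]
    simp [mul_comm]
  have h1 : ∀ v : ℂ, (fun w => fderiv ℝ (fun w => g (τ w)) w v) =ᶠ[𝓝 z]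
      fun w => fderiv ℝ g (τ w) (deriv τ w * v) := by
    intro v
    filter_upwards [hτ, hτc.eventually hgd] with w hw hgw
    rw [show (fun w => g (τ w)) = g ∘ τ from rfl,
      fderiv_comp w hgw (hw.restrictScalars ℝ)]
    simp [hτr w hw]
  have h2 : ∀ v : ℂ, fderiv ℝ (fun w => fderiv ℝ (fun w => g (τ w)) w v) z v =
      fderiv ℝ (fderiv ℝ g) (τ z) (deriv τ z * v) (deriv τ z * v) +
        fderiv ℝ g (τ z) (deriv (deriv τ) z * v * v) := by
    intro v
    have hc : DifferentiableAt ℝ (fun w => fderiv ℝ g (τ w)) z :=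
      hfd.comp z (hτ.self_of_nhds.restrictScalars ℝ)
    have hu : DifferentiableAt ℂ (fun w => deriv τ w * v) z := hdτ.mul_const v
    rw [(h1 v).fderiv_eq, fderiv_clm_apply hc (hu.restrictScalars ℝ)]
    have e1 : fderiv ℝ (fun w => fderiv ℝ g (τ w)) z v =
        fderiv ℝ (fderiv ℝ g) (τ z) (deriv τ z * v) := by
      rw [show (fun w => fderiv ℝ g (τ w)) = fderiv ℝ g ∘ τ from rfl,
        fderiv_comp z hfd (hτ.self_of_nhds.restrictScalars ℝ)]
      simp [hτr z hτ.self_of_nhds]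
    have e2 : fderiv ℝ (fun w => deriv τ w * v) z v = deriv (deriv τ) z * v * v := by
      rw [hu.fderiv_restrictScalars ℝ, ContinuousLinearMap.coe_restrictScalars',
        fderiv_eq_smul_deriv, deriv_mul_const hdτ, smul_eq_mul]
      ring
    simp [e1, e2, add_comm]
  rw [laplacian_eq_fderiv hcomp, h2, h2,
    InnerProductSpace.laplacian_eq_iteratedFDeriv_complexPlane]
  have hsym : IsSymmSndFDerivAt ℝ g (τ z) := hg.isSymmSndFDerivAt (by simp)
  set D := fderiv ℝ (fderiv ℝ g) (τ z) with hD
  set a := deriv τ z with ha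
  have hs : D Complex.I 1 = D 1 Complex.I := hsym.eq Complex.I 1
  have hI : fderiv ℝ g (τ z) (deriv (deriv τ) z * Complex.I * Complex.I) =
      - fderiv ℝ g (τ z) (deriv (deriv τ) z * 1 * 1) := by
    rw [mul_assoc, Complex.I_mul_I, ← map_neg]
    congr 1
    ring
  have ha1 : a * 1 = a.re • (1 : ℂ) + a.im • Complex.I := by
    simp [Complex.re_add_im]
  have haI : a * Complex.I = (-a.im) • (1 : ℂ) + a.re • Complex.I := by
    apply Complex.ext <;> simp
  have hn : ((‖a‖ ^ 2 : ℝ) : ℂ) = (a.re : ℂ) ^ 2 + (a.im : ℂ) ^ 2 := by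
    rw [← Complex.normSq_eq_norm_sq, Complex.normSq_apply]
    push_cast
    ring
  have hexp : ∀ x y : ℝ, D (x • (1 : ℂ) + y • Complex.I) (x • (1 : ℂ) + y • Complex.I) =
      (x : ℂ) ^ 2 * D 1 1 + 2 * (x : ℂ) * y * D 1 Complex.I +
        (y : ℂ) ^ 2 * D Complex.I Complex.I := by
    intro x y
    rw [map_add, map_smul, map_smul, map_add, map_smul, map_smul, add_apply, smul_apply,
      smul_apply, add_apply, smul_apply, smul_apply, hs]
    simp only [smul_add, Complex.real_smul]
    ring
  rw [hI, hn, ha1, haI, hexp, hexp]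
  simp only [iteratedFDeriv_two_apply, Matrix.cons_val_zero, Matrix.cons_val_one, ← hD]
  push_cast
  ring

end Families

/-! ## Riemann surface laminations -/

/-- A flow box: a homeomorphism of an open subset of `Y` onto `base × T`, where `base` is a domain
in `ℂ` and `T` is a locally compact metrizable space. -/
structure FlowBox (Y : Type u) [TopologicalSpace Y] where
  T : Type u
  [topT : TopologicalSpace T]
  [metrizableT : TopologicalSpace.MetrizableSpace T]
  [locallyCompactT : LocallyCompactSpace T]
  base : Set ℂ
  isOpen_base : IsOpen base
  isConnected_base : IsConnected base
  chart : OpenPartialHomeomorph Y (ℂ × T)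
  target_eq : chart.target = base ×ˢ (univ : Set T)

attribute [instance] FlowBox.topT FlowBox.metrizableT FlowBox.locallyCompactT

namespace FlowBox

variable {Y : Type u} [TopologicalSpace Y]

/-- The plaque of the flow box with transversal coordinate `t`. -/
def plaque (φ : FlowBox Y) (t : φ.T) : Set Y :=
  {p | p ∈ φ.chart.source ∧ (φ.chart p).2 = t}

/-- The change of coordinates from `φ` to `ψ` is locally of the form
`(z, t) ↦ (Ψ (z, t), Λ t)` with `Ψ` holomorphic in `z`: on each slice `t = const` its second
component is locally constant and its first component is holomorphic.  (Joint continuity is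
automatic, `φ.chart` and `ψ.chart` being homeomorphisms.) -/
def Compatible (φ ψ : FlowBox Y) : Prop :=
  ∀ p ∈ φ.chart.source ∩ ψ.chart.source,
    (∀ᶠ z in 𝓝 (φ.chart p).1,
      (ψ.chart (φ.chart.symm (z, (φ.chart p).2))).2 = (ψ.chart p).2) ∧
    DifferentiableAt ℂ (fun z => (ψ.chart (φ.chart.symm (z, (φ.chart p).2))).1) (φ.chart p).1

/-- The derivative along the leaf, at `p`, of the change of coordinates from `φ` to `ψ`. -/
def transDeriv (φ ψ : FlowBox Y) (p : Y) : ℂ :=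
  deriv (fun z => (ψ.chart (φ.chart.symm (z, (φ.chart p).2))).1) (φ.chart p).1

/-- The function `f` on the plaque of parameter `t`, read in the coordinate `z`. -/
def slice (φ : FlowBox Y) (f : Y → ℂ) (t : φ.T) : ℂ → ℂ :=
  fun z => f (φ.chart.symm (z, t))

/-- In the flow box, `f` is smooth (in the real sense) on the plaques and all its derivatives
along the plaques are continuous on the flow box. -/
def LeafSmooth (φ : FlowBox Y) (f : Y → ℂ) : Prop :=
  SmoothFamily φ.base (φ.slice f)

end FlowBox

/-- A Riemann surface lamination on `Y`, given by an atlas of flow boxes. -/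
structure RiemannSurfaceLamination (Y : Type u) [TopologicalSpace Y] where
  atlas : Set (FlowBox Y)
  cover : ∀ p : Y, ∃ φ ∈ atlas, p ∈ φ.chart.source
  compatible : ∀ φ ∈ atlas, ∀ ψ ∈ atlas, φ.Compatible ψ

namespace RiemannSurfaceLamination

variable {Y : Type u} [TopologicalSpace Y]

/-- `φ` is a flow box of the lamination: it is compatible with all the charts of the atlas. -/
def IsFlowBox (lam : RiemannSurfaceLamination Y) (φ : FlowBox Y) : Prop :=
  ∀ ψ ∈ lam.atlas, φ.Compatible ψ ∧ ψ.Compatible φ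

/-- A leaf: a minimal (nonempty) connected subset which contains every plaque that it meets. -/
def IsLeaf (lam : RiemannSurfaceLamination Y) (L : Set Y) : Prop :=
  Minimal (fun S : Set Y => IsConnected S ∧
    ∀ φ ∈ lam.atlas, ∀ t : φ.T, (S ∩ φ.plaque t).Nonempty → φ.plaque t ⊆ S) L

/-- A wandering leaf: a leaf `L`, not closed in `Y`, such that for some `p ∈ L` and some flow
box `U` containing `p`, the set `L ∩ U` is just one plaque of `U`. -/
def IsWanderingLeaf (lam : RiemannSurfaceLamination Y) (L : Set Y) : Prop :=
  lam.IsLeaf L ∧ ¬ IsClosed L ∧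
    ∃ p ∈ L, ∃ φ : FlowBox Y, lam.IsFlowBox φ ∧ p ∈ φ.chart.source ∧
      ∃ t : φ.T, L ∩ φ.chart.source = φ.plaque t

/-- The union of the wandering leaves. -/
def wanderingSet (lam : RiemannSurfaceLamination Y) : Set Y :=
  {p | ∃ L, lam.IsWanderingLeaf L ∧ p ∈ L}

/-! ### Test functions and test forms -/

/-- The space `𝒟⁰` of test functions: compactly supported, smooth along the leaves, with all
leafwise derivatives continuous in flow boxes. -/
def IsTestFunction (lam : RiemannSurfaceLamination Y) (f : Y → ℂ) : Prop :=
  HasCompactSupport f ∧ ∀ φ ∈ lam.atlas, φ.LeafSmooth f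

/-- A family `α φ` of functions is a test form of bidegree `(1,1)`, written
`α φ · (i/2) dz ∧ dz̄` in each flow box `φ` of the atlas: the coefficients obey the transformation
rule of `(1,1)`-forms, are smooth along the leaves with all leafwise derivatives continuous, and
vanish outside a compact set.  (By convention `α φ` is `0` outside of the flow box `φ`.) -/
structure IsTestForm (lam : RiemannSurfaceLamination Y) (α : lam.atlas → Y → ℂ) : Prop where
  off_source : ∀ φ : lam.atlas, ∀ p ∉ φ.1.chart.source, α φ p = 0
  transform : ∀ φ ψ : lam.atlas, ∀ p ∈ φ.1.chart.source ∩ ψ.1.chart.source,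
    α φ p = ((‖φ.1.transDeriv ψ.1 p‖ ^ 2 : ℝ) : ℂ) * α ψ p
  smooth : ∀ φ : lam.atlas, φ.1.LeafSmooth (α φ)
  compact_support : ∃ K : Set Y, IsCompact K ∧ ∀ φ : lam.atlas, ∀ p ∉ K, α φ p = 0

variable (lam : RiemannSurfaceLamination Y)

theorem base_mem {φ : FlowBox Y} {p : Y} (hp : p ∈ φ.chart.source) : (φ.chart p).1 ∈ φ.base := by
  have h := φ.chart.map_source hp
  rw [φ.target_eq] at h
  exact h.1

theorem symm_mem {φ : FlowBox Y} {z : ℂ} (hz : z ∈ φ.base) (t : φ.T) :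
    (z, t) ∈ φ.chart.target := by
  rw [φ.target_eq]
  exact ⟨hz, mem_univ t⟩

/-- The space `𝒟^{1,1}` of test forms of bidegree `(1,1)`. -/
def testForms : Submodule ℂ (lam.atlas → Y → ℂ) where
  carrier := {α | lam.IsTestForm α}
  zero_mem' :=
    { off_source := fun _ _ _ => rfl
      transform := fun _ _ _ _ => by simp
      smooth := fun _ => SmoothFamily.zero
      compact_support := ⟨∅, isCompact_empty, fun _ _ _ => rfl⟩ }
  add_mem' := by
    intro α β hα hβ
    refine ⟨fun φ p hp => ?_, fun φ ψ p hp => ?_, fun φ => ?_, ?_⟩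
    · simp [hα.off_source φ p hp, hβ.off_source φ p hp]
    · simp only [Pi.add_apply, hα.transform φ ψ p hp, hβ.transform φ ψ p hp, mul_add]
    · exact (hα.smooth φ).add φ.1.isOpen_base (hβ.smooth φ)
    · obtain ⟨K, hK, h1⟩ := hα.compact_support
      obtain ⟨K', hK', h2⟩ := hβ.compact_support
      refine ⟨K ∪ K', hK.union hK', fun φ p hp => ?_⟩
      simp [h1 φ p (fun h => hp (Or.inl h)), h2 φ p (fun h => hp (Or.inr h))]
  smul_mem' := by
    intro c α hα
    refine ⟨fun φ p hp => ?_, fun φ ψ p hp => ?_, fun φ => ?_, ?_⟩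
    · simp [hα.off_source φ p hp]
    · simp only [Pi.smul_apply, hα.transform φ ψ p hp, smul_eq_mul]
      ring
    · exact (hα.smooth φ).const_mul φ.1.isOpen_base c
    · obtain ⟨K, hK, h1⟩ := hα.compact_support
      exact ⟨K, hK, fun φ p hp => by simp [h1 φ p hp]⟩

/-- The coefficients of `i ∂∂̄ f` along the leaves: `i ∂∂̄ f = (1/2) Δf · (i/2) dz ∧ dz̄`. -/
def ddbarCoeff (f : Y → ℂ) : lam.atlas → Y → ℂ :=
  fun φ => φ.1.chart.source.indicator fun p =>
    (1 / 2 : ℂ) * Laplacian.laplacian (φ.1.slice f (φ.1.chart p).2) (φ.1.chart p).1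

theorem isTestForm_ddbarCoeff {f : Y → ℂ} (hf : lam.IsTestFunction f) :
    lam.IsTestForm (lam.ddbarCoeff f) := by
  refine ⟨fun φ p hp => ?_, fun φ ψ p hp => ?_, fun φ => ?_, ?_⟩
  · exact indicator_of_notMem hp _
  · obtain ⟨hpφ, hpψ⟩ := hp
    have hz := base_mem hpφ
    have hsym : φ.1.chart.symm ((φ.1.chart p).1, (φ.1.chart p).2) = p := φ.1.chart.left_inv hpφ
    have hcont : ContinuousAt (fun z => φ.1.chart.symm (z, (φ.1.chart p).2)) (φ.1.chart p).1 :=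
      ContinuousAt.comp (f := fun z => (z, (φ.1.chart p).2)) (x := (φ.1.chart p).1)
        (φ.1.chart.continuousAt_symm (symm_mem hz _))
        (continuousAt_id.prodMk continuousAt_const)
    have hψ : ∀ᶠ z in 𝓝 (φ.1.chart p).1,
        φ.1.chart.symm (z, (φ.1.chart p).2) ∈ ψ.1.chart.source :=
      hcont.eventually (by
        simp only [hsym]
        exact ψ.1.chart.open_source.mem_nhds hpψ)
    have hB : ∀ᶠ z in 𝓝 (φ.1.chart p).1, z ∈ φ.1.base := φ.1.isOpen_base.mem_nhds hz
    have hcomp := lam.compatible φ.1 φ.2 ψ.1 ψ.2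
    set τ : ℂ → ℂ := fun z => (ψ.1.chart (φ.1.chart.symm (z, (φ.1.chart p).2))).1 with hτ
    have hτz : τ (φ.1.chart p).1 = (ψ.1.chart p).1 := by
      simp only [hτ, hsym]
    have hτd : ∀ᶠ z in 𝓝 (φ.1.chart p).1, DifferentiableAt ℂ τ z := by
      filter_upwards [hψ, hB] with z hzψ hzB
      have ht := symm_mem (φ := φ.1) hzB (φ.1.chart p).2
      have h := (hcomp _ ⟨φ.1.chart.map_target ht, hzψ⟩).2
      rw [φ.1.chart.right_inv ht] at h
      exact h
    have heq : φ.1.slice f (φ.1.chart p).2 =ᶠ[𝓝 (φ.1.chart p).1]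
        fun z => ψ.1.slice f (ψ.1.chart p).2 (τ z) := by
      filter_upwards [hψ, (hcomp p ⟨hpφ, hpψ⟩).1] with z hzψ hz2
      have : ((τ z, (ψ.1.chart p).2) : ℂ × ψ.1.T) =
          ψ.1.chart (φ.1.chart.symm (z, (φ.1.chart p).2)) := Prod.ext rfl hz2.symm
      simp only [FlowBox.slice, this, ψ.1.chart.left_inv hzψ]
    have hg : ContDiffAt ℝ 2 (ψ.1.slice f (ψ.1.chart p).2) (τ (φ.1.chart p).1) := by
      rw [hτz]
      exact ((hf.2 ψ.1 ψ.2).contDiffAt ψ.1.isOpen_base (base_mem hpψ) _).of_le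
        two_le_infty
    simp only [ddbarCoeff, indicator_of_mem hpφ, indicator_of_mem hpψ]
    rw [(InnerProductSpace.laplacian_congr_nhds heq).eq_of_nhds,
      laplacian_comp_holomorphic hg hτd, hτz]
    simp only [FlowBox.transDeriv, hτ]
    ring
  · refine (((hf.2 φ.1 φ.2).laplacian φ.1.isOpen_base).const_mul φ.1.isOpen_base (1 / 2)).congr
      φ.1.isOpen_base ?_
    intro t z hz
    have ht := symm_mem (φ := φ.1) hz t
    simp only [FlowBox.slice, ddbarCoeff, indicator_of_mem (φ.1.chart.map_target ht),
      φ.1.chart.right_inv ht]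
  · refine ⟨tsupport f, hf.1, fun φ p hp => ?_⟩
    by_cases hpφ : p ∈ φ.1.chart.source
    · have hz := base_mem hpφ
      have hsym : φ.1.chart.symm ((φ.1.chart p).1, (φ.1.chart p).2) = p := φ.1.chart.left_inv hpφ
      have hcont : ContinuousAt (fun z => φ.1.chart.symm (z, (φ.1.chart p).2)) (φ.1.chart p).1 :=
        ContinuousAt.comp (f := fun z => (z, (φ.1.chart p).2)) (x := (φ.1.chart p).1)
          (φ.1.chart.continuousAt_symm (symm_mem hz _))
          (continuousAt_id.prodMk continuousAt_const)
      have heq : φ.1.slice f (φ.1.chart p).2 =ᶠ[𝓝 (φ.1.chart p).1] fun _ => (0 : ℂ) := by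
        have h0 : f =ᶠ[𝓝 (φ.1.chart.symm ((φ.1.chart p).1, (φ.1.chart p).2))] 0 := by
          rw [hsym]
          exact notMem_tsupport_iff_eventuallyEq.1 hp
        exact hcont.eventually h0
      simp only [ddbarCoeff, indicator_of_mem hpφ]
      rw [(InnerProductSpace.laplacian_congr_nhds heq).eq_of_nhds]
      simp
    · exact indicator_of_notMem hpφ _

/-- The test form `i ∂∂̄ f` of a test function `f`. -/
def ddbar (f : Y → ℂ) (hf : lam.IsTestFunction f) : lam.testForms :=
  ⟨lam.ddbarCoeff f, lam.isTestForm_ddbarCoeff hf⟩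

/-- Convergence to `0` in `𝒟^{1,1}`: the supports lie in a fixed compact set, and the
coefficients converge to `0` together with all their leafwise derivatives, uniformly on compact
subsets of the flow boxes. -/
def FormsTendstoZero (α : ℕ → lam.testForms) : Prop :=
  (∃ K : Set Y, IsCompact K ∧ ∀ n, ∀ φ : lam.atlas, ∀ p ∉ K, (α n).1 φ p = 0) ∧
    ∀ φ : lam.atlas, ∀ K ⊆ φ.1.chart.source, IsCompact K → ∀ l : ℕ,
      TendstoUniformlyOn
        (fun n p => iteratedFDeriv ℝ l (φ.1.slice ((α n).1 φ) (φ.1.chart p).2) (φ.1.chart p).1)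
        (fun _ => 0) atTop K

/-- A current of bidegree `(0,0)` (and bidimension `(1,1)`): a continuous linear form on
`𝒟^{1,1}`. -/
structure Current where
  toLinearMap : lam.testForms →ₗ[ℂ] ℂ
  continuous : ∀ α : ℕ → lam.testForms, lam.FormsTendstoZero α →
    Tendsto (fun n => toLinearMap (α n)) atTop (𝓝 0)

variable {lam}

/-- A current is positive if it is nonnegative on the test forms with nonnegative coefficients. -/
def Current.IsPositive (S : lam.Current) : Prop :=
  ∀ α : lam.testForms, (∀ φ p, 0 ≤ α.1 φ p) → 0 ≤ S.toLinearMap α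

/-- A current is harmonic if it is `∂∂̄`-closed. -/
def Current.IsHarmonic (S : lam.Current) : Prop :=
  ∀ (f : Y → ℂ) (hf : lam.IsTestFunction f), S.toLinearMap (lam.ddbar f hf) = 0

end RiemannSurfaceLamination

/-! ## Laminations with isolated singularities in a Hermitian complex manifold -/

/-- The model space of complex manifolds of dimension `k`. -/
abbrev Cn (k : ℕ) := EuclideanSpace ℂ (Fin k)

/-- A (smooth) Hermitian metric on a complex manifold. -/
structure HermitianMetric (k : ℕ) (M : Type u) [TopologicalSpace M] [ChartedSpace (Cn k) M] where
  inner : ∀ x : M, TangentSpace 𝓘(ℂ, Cn k) x →ₗ⋆[ℂ] TangentSpace 𝓘(ℂ, Cn k) x →ₗ[ℂ] ℂ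
  conj_symm : ∀ x v w, (starRingEnd ℂ) (inner x v w) = inner x w v
  pos : ∀ x v, v ≠ 0 → 0 < inner x v v
  smooth : ∀ e ∈ atlas (Cn k) M, ∀ v w : Cn k,
    ContDiffOn ℝ ∞ (fun y : Cn k => inner (e.symm y)
      (mfderiv 𝓘(ℂ, Cn k) 𝓘(ℂ, Cn k) e.symm y v)
      (mfderiv 𝓘(ℂ, Cn k) 𝓘(ℂ, Cn k) e.symm y w)) e.target

/-- A lamination `(X, ℒ, E)` with isolated singularities in a complex manifold `M`: `X` is closed
in `M`, `E` is a locally finite subset of `X`, and `X ∖ E` is a Riemann surface lamination whose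
leaves are holomorphically immersed in `M`. -/
structure SingularLamination (k : ℕ) (M : Type u) [TopologicalSpace M]
    [ChartedSpace (Cn k) M] where
  X : Set M
  E : Set M
  isClosed_X : IsClosed X
  E_subset : E ⊆ X
  locallyFinite_E : ∀ x ∈ X, ∃ V ∈ 𝓝 x, (E ∩ V).Finite
  lam : RiemannSurfaceLamination ↥(X \ E)
  holomorphic : ∀ φ ∈ lam.atlas, ∀ p ∈ φ.chart.source,
    MDifferentiableAt 𝓘(ℂ) 𝓘(ℂ, Cn k)
      (fun z : ℂ => (φ.chart.symm (z, (φ.chart p).2) : M)) (φ.chart p).1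
  immersed : ∀ φ ∈ lam.atlas, ∀ p ∈ φ.chart.source,
    mfderiv 𝓘(ℂ) 𝓘(ℂ, Cn k)
      (fun z : ℂ => (φ.chart.symm (z, (φ.chart p).2) : M)) (φ.chart p).1 ≠ 0

namespace SingularLamination

variable {k : ℕ} {M : Type u} [TopologicalSpace M] [ChartedSpace (Cn k) M]

/-- The tangent vector at `p` of the leaf through `p`, in the coordinate `z` of the flow box `φ`:
the derivative at `p` of the parametrization `z ↦ φ⁻¹ (z, t)` of the plaque of `p`. -/
def leafTangent (L : SingularLamination k M) (φ : FlowBox ↥(L.X \ L.E)) (p : ↥(L.X \ L.E)) :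
    TangentSpace 𝓘(ℂ, Cn k) ((φ.chart.symm ((φ.chart p).1, (φ.chart p).2) : ↥(L.X \ L.E)) : M) :=
  mfderiv 𝓘(ℂ) 𝓘(ℂ, Cn k)
    (fun z : ℂ => (φ.chart.symm (z, (φ.chart p).2) : M)) (φ.chart p).1 (1 : ℂ)

/-- The restriction of the Hermitian form `ω` to the leaves, written
`areaCoeff · (i/2) dz ∧ dz̄` in the flow box `φ`. -/
def areaCoeff (L : SingularLamination k M) (ω₀ : HermitianMetric k M)
    (φ : FlowBox ↥(L.X \ L.E)) (p : ↥(L.X \ L.E)) : ℝ :=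
  (ω₀.inner _ (L.leafTangent φ p) (L.leafTangent φ p)).re

/-- The function `α / ω` on `X ∖ E`, for a test form `α` (computed at each point in some flow box
of the atlas; the result does not depend on its choice). -/
def density (L : SingularLamination k M) (ω₀ : HermitianMetric k M) (α : L.lam.testForms)
    (p : ↥(L.X \ L.E)) : ℂ :=
  α.1 ⟨(L.lam.cover p).choose, (L.lam.cover p).choose_spec.1⟩ p /
    (L.areaCoeff ω₀ (L.lam.cover p).choose p : ℂ)

/-- `m` is the measure `S ∧ ω` on `X ∖ E`: the Radon measure such that
`∫ (α / ω) d(S ∧ ω) = S (α)` for all test forms `α`, that is, `∫ f d(S ∧ ω) = S (f ω)`. -/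
structure IsWedgeMeasure (L : SingularLamination k M) (ω₀ : HermitianMetric k M)
    (S : L.lam.Current) [MeasurableSpace M] (m : Measure ↥(L.X \ L.E)) : Prop where
  finite_on_compacts : IsFiniteMeasureOnCompacts m
  integral_eq : ∀ α : L.lam.testForms, ∫ p, L.density ω₀ α p ∂m = S.toLinearMap α

end SingularLamination

end

/-!
The measure exists because the Hermitian form restricts to a positive area form on the leaves
(`isAreaForm_areaCoeff`). Dividing by it turns the real test forms into a subspace of the continuous
functions of compact support on `X ∖ E` (`realDens`), on which the current is a positive linear
form; it extends by the theorem of M. Riesz, and the extension is a measure by the theorem of Riesz,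
Markov and Kakutani (`exists_measure`).

For the wandering leaves, cover `X ∖ E` by countably many boxes. A leaf is a class of points linked
by chains of plaques (`IsLeaf.eq_leafOf`), and a wandering leaf meets one of countably many compact
transversals in exactly one point (`IsWanderingLeaf.exists_transversal`). The leaves meeting a given
compact set in exactly one point fill a Borel set, which is projected measurably onto the compact
set along the leaves (`measurable_sliceProj`). Disintegrate the measure along this projection
(`exists_disintegration`). Almost every conditional measure lives on one leaf, is finite on compact
sets, and is harmonic on the plaques (`setIntegral_plaquesThrough`, `harmonicOnPlaque_of_forall`),
because the harmonicity of the current may be localised to measurable families of plaques. By Weyl's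
lemma (`exists_harmonic_density`) it has a nonnegative density `H` with respect to the area form,
harmonic on the leaf.

The density `H` is constant. The function `1 - exp (-H)` is bounded and superharmonic, so that its
integral against the form `i∂∂̄f`, the energy of `f`, is nonpositive for every test function `f ≥ 0`
(`leafEnergy_nonpos`). If constants were test functions, the energy would vanish; this is so when
there are no singularities. Near an isolated singularity with local coordinates `Z`, the function
`log ‖Z‖²` is subharmonic on the leaves (`laplacian_comp_log_norm_nonneg`) and tends to `-∞`; small
multiples of truncations of it provide test functions that tend to `1` and whose form `i∂∂̄` has
negative part tending to zero (`hasCutoffs`). So the energy vanishes (`leafEnergy_eq_zero`), and the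
equality case forces `H` to be constant on the plaques, hence on the leaf (`eq_of_mem_leafOf`).

If the leaf is not closed, infinitely many of its plaques accumulate in a compact box. Their area is
bounded below, while the conditional measure of the box is finite, so that `H = 0`
(`measure_eq_zero_of_not_isClosed`). As the conditional measures are not zero, almost every leaf
that meets the compact set in exactly one point is closed (`measure_not_isClosed_sliceSet`). A wandering
leaf is not closed, by definition, so the wandering leaves are negligible (`measure_wanderingSet`).
-/

/-! ### Families of smooth functions -/

/-- The family `G t` of functions on `E` is smooth near `q = (z, t)`, and all its derivatives in
the variable of `E` are continuous at `q`. -/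
def FamilyAt {T E F : Type*} [TopologicalSpace T] [NormedAddCommGroup E] [NormedSpace ℝ E]
    [NormedAddCommGroup F] [NormedSpace ℝ F] (G : T → E → F) (q : E × T) : Prop :=
  (∀ᶠ q' in 𝓝 q, ContDiffAt ℝ ∞ (G q'.2) q'.1) ∧
    ∀ n : ℕ, ContinuousAt (fun q' : E × T => iteratedFDeriv ℝ n (G q'.2) q'.1) q

namespace FamilyAt

variable {T T' E F F' : Type*} [TopologicalSpace T] [TopologicalSpace T']
  [NormedAddCommGroup E] [NormedSpace ℝ E] [NormedAddCommGroup F] [NormedSpace ℝ F]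
  [NormedAddCommGroup F'] [NormedSpace ℝ F'] {G : T → E → F} {q : E × T}

theorem contDiffAt (h : FamilyAt G q) : ContDiffAt ℝ ∞ (G q.2) q.1 := h.1.self_of_nhds

theorem continuousAt (h : FamilyAt G q) : ContinuousAt (fun q' : E × T => G q'.2 q'.1) q := by
  have := (continuousMultilinearCurryFin0 ℝ E F).continuous.continuousAt.comp (h.2 0)
  refine this.congr (Eventually.of_forall fun q' => ?_)
  simp

theorem congr {H : T → E → F} (h : FamilyAt G q)
    (e : ∀ᶠ q' in 𝓝 q, H q'.2 q'.1 = G q'.2 q'.1) : FamilyAt H q := by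
  have e' : ∀ᶠ q' in 𝓝 q, H q'.2 =ᶠ[𝓝 q'.1] G q'.2 := by
    filter_upwards [e.eventually_nhds] with q' hq'
    have hc : Continuous fun z : E => (z, q'.2) := by fun_prop
    exact (hc.tendsto q'.1).eventually hq'
  refine ⟨?_, fun n => (h.2 n).congr ?_⟩
  · filter_upwards [h.1, e'] with q' h1 h2 using h1.congr_of_eventuallyEq h2
  · filter_upwards [e'] with q' h2 using (h2.symm.iteratedFDeriv ℝ n).eq_of_nhds

/-- A family composed with a family: the parameter `l` of the outer one may depend on the point,
but is locally constant on the slices. -/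
theorem comp {H : T' → F → F'} {l : E × T → T'} (hG : FamilyAt G q)
    (hH : FamilyAt H (G q.2 q.1, l q)) (hl : ContinuousAt l q)
    (hconst : ∀ᶠ q' in 𝓝 q, ∀ᶠ z in 𝓝 q'.1, l (z, q'.2) = l q') :
    FamilyAt (fun t z => H (l (z, t)) (G t z)) q := by
  have hp : ContinuousAt (fun q' : E × T => (G q'.2 q'.1, l q')) q := hG.continuousAt.prodMk hl
  have ev : ∀ᶠ q' in 𝓝 q, (fun z => H (l (z, q'.2)) (G q'.2 z)) =ᶠ[𝓝 q'.1]
      (H (l q')) ∘ (G q'.2) := by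
    filter_upwards [hconst] with q' hq'
    filter_upwards [hq'] with z hz
    simp [hz]
  have hs : ∀ᶠ q' in 𝓝 q, ContDiffAt ℝ ∞ (H (l q')) (G q'.2 q'.1) := hp.eventually hH.1
  refine ⟨?_, fun n => ?_⟩
  · filter_upwards [hG.1, ev, hs] with q' h1 h2 h3
    exact (h3.comp q'.1 h1).congr_of_eventuallyEq h2
  -- the formula of Faà di Bruno
  · have key : ∀ᶠ q' in 𝓝 q, ∑ c : OrderedFinpartition n,
        c.compAlongOrderedFinpartitionL ℝ E F F' (iteratedFDeriv ℝ c.length (H (l q'))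
          (G q'.2 q'.1)) (fun m => iteratedFDeriv ℝ (c.partSize m) (G q'.2) q'.1) =
        iteratedFDeriv ℝ n (fun z => H (l (z, q'.2)) (G q'.2 z)) q'.1 := by
      filter_upwards [hG.1, ev, hs] with q' h1 h2 h3
      rw [(h2.iteratedFDeriv ℝ n).eq_of_nhds, iteratedFDeriv_comp h3 h1
        (i := n) (by exact_mod_cast le_top)]
      rfl
    refine ContinuousAt.congr ?_ key
    refine tendsto_finsetSum _ fun c _ => ?_
    have a1 : ContinuousAt (fun q' : E × T => iteratedFDeriv ℝ c.length (H (l q'))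
        (G q'.2 q'.1)) q := ContinuousAt.comp (f := fun q' : E × T => (G q'.2 q'.1, l q'))
          (hH.2 c.length) hp
    have a2 : ContinuousAt (fun q' : E × T => fun m =>
        iteratedFDeriv ℝ (c.partSize m) (G q'.2) q'.1) q :=
      continuousAt_pi.2 fun m => hG.2 (c.partSize m)
    have hc : Continuous fun x : (ContinuousMultilinearMap ℝ (fun _ : Fin c.length => F) F') ×
        (∀ m, ContinuousMultilinearMap ℝ (fun _ : Fin (c.partSize m) => E) F) =>
        c.compAlongOrderedFinpartitionL ℝ E F F' x.1 x.2 := by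
      rw [continuous_iff_continuousAt]
      intro x
      exact ContinuousLinearMap.continuous_uncurry_of_multilinear
        (c.compAlongOrderedFinpartitionL ℝ E F F') |>.continuousAt
    exact hc.continuousAt.comp (f := fun q' : E × T => (iteratedFDeriv ℝ c.length (H (l q'))
        (G q'.2 q'.1), fun m => iteratedFDeriv ℝ (c.partSize m) (G q'.2) q'.1)) (a1.prodMk a2)

/-- A fixed smooth function, as a family. -/
theorem of_contDiffAt {f : E → F} (hf : ContDiffAt ℝ ∞ f q.1) (hf' : ∀ᶠ z in 𝓝 q.1,
    ContDiffAt ℝ ∞ f z) : FamilyAt (fun _ : T => f) q := by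
  refine ⟨?_, fun n => ?_⟩
  · exact (continuous_fst.tendsto q).eventually hf'
  · refine ContinuousAt.comp (f := Prod.fst) (g := iteratedFDeriv ℝ n f) ?_ continuousAt_fst
    exact hf.continuousAt_iteratedFDeriv (by exact_mod_cast le_top)

theorem const (c : F) : FamilyAt (fun (_ : T) (_ : E) => c) q :=
  of_contDiffAt contDiffAt_const (Eventually.of_forall fun _ => contDiffAt_const)

theorem of_contDiff {f : E → F} (hf : ContDiff ℝ ∞ f) : FamilyAt (fun _ : T => f) q :=
  of_contDiffAt hf.contDiffAt (Eventually.of_forall fun _ => hf.contDiffAt)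

/-- Continuous functions of the parameter are families. -/
theorem of_param {g : T → F} (hg : ContinuousAt g q.2) : FamilyAt (fun t (_ : E) => g t) q := by
  refine ⟨Eventually.of_forall fun _ => contDiffAt_const, fun n => ?_⟩
  rcases n with _ | n
  · have h0 : (fun q' : E × T => iteratedFDeriv ℝ 0 (fun _ : E => g q'.2) q'.1) =
        (continuousMultilinearCurryFin0 ℝ E F).symm ∘ g ∘ Prod.snd := by
      funext q'
      simp [iteratedFDeriv_zero_eq_comp]
    rw [h0]
    exact (continuousMultilinearCurryFin0 ℝ E F).symm.continuous.continuousAt.comp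
      (ContinuousAt.comp hg continuousAt_snd)
  · have h0 : (fun q' : E × T => iteratedFDeriv ℝ (n + 1) (fun _ : E => g q'.2) q'.1) =
        fun _ => 0 := by
      funext q'
      rw [iteratedFDeriv_succ_const]
      rfl
    rw [h0]
    exact continuousAt_const

theorem comp_contDiffAt {f : F → F'} (hG : FamilyAt G q)
    (hf' : ∀ᶠ z in 𝓝 (G q.2 q.1), ContDiffAt ℝ ∞ f z) : FamilyAt (fun t z => f (G t z)) q :=
  hG.comp (T' := Unit) (H := fun _ => f) (l := fun _ => ())
    (of_contDiffAt hf'.self_of_nhds hf') continuousAt_const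
    (Eventually.of_forall fun _ => Eventually.of_forall fun _ => rfl)

theorem comp_contDiff {f : F → F'} (hG : FamilyAt G q) (hf : ContDiff ℝ ∞ f) :
    FamilyAt (fun t z => f (G t z)) q :=
  hG.comp_contDiffAt (Eventually.of_forall fun _ => hf.contDiffAt)

theorem prodMk {H : T → E → F'} (hG : FamilyAt G q) (hH : FamilyAt H q) :
    FamilyAt (fun t z => (G t z, H t z)) q := by
  refine ⟨?_, fun n => ?_⟩
  · filter_upwards [hG.1, hH.1] with q' h1 h2 using h1.prodMk h2
  · have key : ∀ᶠ q' in 𝓝 q, (iteratedFDeriv ℝ n (G q'.2) q'.1).prod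
        (iteratedFDeriv ℝ n (H q'.2) q'.1) =
        iteratedFDeriv ℝ n (fun z => (G q'.2 z, H q'.2 z)) q'.1 := by
      filter_upwards [hG.1, hH.1] with q' h1 h2
      rw [iteratedFDeriv_prodMk h1 h2 (by exact_mod_cast le_top)]
    refine ContinuousAt.congr ?_ key
    exact (ContinuousMultilinearMap.prodL ℝ (fun _ : Fin n => E) F F').continuous.continuousAt.comp
      (f := fun q' : E × T => (iteratedFDeriv ℝ n (G q'.2) q'.1,
        iteratedFDeriv ℝ n (H q'.2) q'.1)) ((hG.2 n).prodMk (hH.2 n))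

theorem mul {G H : T → E → ℂ} (hG : FamilyAt G q) (hH : FamilyAt H q) :
    FamilyAt (fun t z => G t z * H t z) q :=
  (hG.prodMk hH).comp_contDiff (f := fun x : ℂ × ℂ => x.1 * x.2) (by fun_prop)

theorem add {H : T → E → F} (hG : FamilyAt G q) (hH : FamilyAt H q) :
    FamilyAt (fun t z => G t z + H t z) q :=
  (hG.prodMk hH).comp_contDiff (f := fun x : F × F => x.1 + x.2) (by fun_prop)

theorem sum {ι : Type*} {s : Finset ι} {G : ι → T → E → F} (hG : ∀ i ∈ s, FamilyAt (G i) q) :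
    FamilyAt (fun t z => ∑ i ∈ s, G i t z) q := by
  classical
  induction s using Finset.induction_on with
  | empty => simpa using const (T := T) (q := q) (0 : F)
  | insert a s ha ih =>
    simp only [Finset.sum_insert ha]
    exact (hG a (by simp)).add (ih fun i hi => hG i (by simp [hi]))

end FamilyAt

theorem smoothFamily_iff {T : Type u} [TopologicalSpace T] {B : Set ℂ} (hB : IsOpen B)
    {G : T → ℂ → ℂ} : SmoothFamily B G ↔ ∀ q ∈ B ×ˢ (univ : Set T), FamilyAt G q := by
  have hO : IsOpen (B ×ˢ (univ : Set T)) := hB.prod isOpen_univ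
  refine ⟨fun h q hq => ⟨?_, fun n => (h.2 n).continuousAt (hO.mem_nhds hq)⟩, fun h => ⟨?_, ?_⟩⟩
  · filter_upwards [hO.mem_nhds hq] with q' hq' using h.contDiffAt hB hq'.1 q'.2
  · exact fun t z hz => (h (z, t) ⟨hz, mem_univ _⟩).contDiffAt.contDiffWithinAt
  · exact fun n q hq => ((h q hq).2 n).continuousWithinAt

/-! ### Holomorphic families -/

section Holomorphic

variable {T : Type*} [TopologicalSpace T] {F : Type*} [NormedAddCommGroup F] [NormedSpace ℂ F]
  {G : T → ℂ → F} {q : ℂ × T}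

/-- Near `q` the family `G t` is jointly continuous, and holomorphic in the complex variable. -/
def HolFamilyAt (G : T → ℂ → F) (q : ℂ × T) : Prop :=
  ∀ᶠ q' in 𝓝 q, ContinuousAt (fun p : ℂ × T => G p.2 p.1) q' ∧ DifferentiableAt ℂ (G q'.2) q'.1

theorem HolFamilyAt.exists_box (h : HolFamilyAt G q) : ∃ r > 0, ∃ N ∈ 𝓝 q.2,
    ∀ z ∈ Metric.ball q.1 r, ∀ t ∈ N,
      ContinuousAt (fun p : ℂ × T => G p.2 p.1) (z, t) ∧ DifferentiableAt ℂ (G t) z := by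
  rw [HolFamilyAt, nhds_prod_eq] at h
  obtain ⟨U, hU, N, hN, hUN⟩ := eventually_prod_iff.1 h
  obtain ⟨r, hr, hrU⟩ := Metric.mem_nhds_iff.1 hU
  exact ⟨r, hr, {t | N t}, hN, fun z hz t ht => hUN (hrU hz) ht⟩

/-- By Cauchy's formula, the derivative of a holomorphic family is a holomorphic family. -/
theorem HolFamilyAt.deriv [CompleteSpace F] (h : HolFamilyAt G q) :
    HolFamilyAt (fun t => deriv (G t)) q := by
  obtain ⟨r, hr, N, hN, H⟩ := h.exists_box
  have hN' : interior N ∈ 𝓝 q.2 := interior_mem_nhds.2 hN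
  have hmem : Metric.ball q.1 r ×ˢ interior N ∈ 𝓝 q :=
    prod_mem_nhds (Metric.ball_mem_nhds _ hr) hN'
  filter_upwards [hmem] with q' hq'
  obtain ⟨z0, t0⟩ := q'
  have hz0 : z0 ∈ Metric.ball q.1 r := hq'.1
  have ht0 : t0 ∈ interior N := hq'.2
  have hd : ∀ t ∈ interior N, DifferentiableOn ℂ (G t) (Metric.ball q.1 r) := fun t ht z hz =>
    (H z hz t (interior_subset ht)).2.differentiableWithinAt
  refine ⟨?_, ((hd t0 ht0).deriv Metric.isOpen_ball).differentiableAt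
    (Metric.isOpen_ball.mem_nhds hz0)⟩
  -- the slices converge locally uniformly as the parameter varies, hence so do the derivatives
  have hU : TendstoLocallyUniformlyOn G (G t0) (𝓝 t0) (Metric.ball q.1 r) := by
    rw [Metric.tendstoLocallyUniformlyOn_iff]
    intro ε hε z hz
    have hc := Metric.continuousAt_iff'.1 (H z hz t0 (interior_subset ht0)).1 (ε / 2) (half_pos hε)
    rw [nhds_prod_eq] at hc
    obtain ⟨U, hU, V, hV, hUV⟩ := eventually_prod_iff.1 hc
    refine ⟨{y | U y}, mem_nhdsWithin_of_mem_nhds hU, ?_⟩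
    filter_upwards [hV] with t ht y hy
    have h1 := hUV hy ht
    have h2 := hUV hy hV.self_of_nhds
    calc dist (G t0 y) (G t y) ≤ dist (G t0 y) (G t0 z) + dist (G t y) (G t0 z) :=
          dist_triangle_right _ _ _
      _ < ε := by linarith
  have hD := hU.deriv (by filter_upwards [isOpen_interior.mem_nhds ht0] with t ht using hd t ht)
    Metric.isOpen_ball
  rw [Metric.continuousAt_iff']
  intro ε hε
  obtain ⟨A, hA, hA'⟩ := Metric.tendstoLocallyUniformlyOn_iff.1 hD (ε / 2) (half_pos hε) z0 hz0
  rw [Metric.isOpen_ball.nhdsWithin_eq hz0] at hA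
  have hc : ContinuousAt (_root_.deriv (G t0)) z0 :=
    (((hd t0 ht0).deriv Metric.isOpen_ball).differentiableAt
      (Metric.isOpen_ball.mem_nhds hz0)).continuousAt
  have hc' := Metric.continuousAt_iff'.1 hc (ε / 2) (half_pos hε)
  rw [nhds_prod_eq]
  filter_upwards [(hc'.and hA).prod_mk hA'] with p hp
  calc dist (_root_.deriv (G p.2) p.1) (_root_.deriv (G t0) z0)
      ≤ dist (_root_.deriv (G t0) p.1) (_root_.deriv (G p.2) p.1) +
          dist (_root_.deriv (G t0) p.1) (_root_.deriv (G t0) z0) :=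
        dist_triangle_left _ _ _
    _ < ε := by
      have h1 : dist (_root_.deriv (G t0) p.1) (_root_.deriv (G p.2) p.1) < ε / 2 :=
        hp.2 p.1 hp.1.2
      linarith [hp.1.1]

theorem HolFamilyAt.iteratedDeriv [CompleteSpace F] (h : HolFamilyAt G q) (n : ℕ) :
    HolFamilyAt (fun t => iteratedDeriv n (G t)) q := by
  induction n with
  | zero => simpa [iteratedDeriv_zero] using h
  | succ n ih =>
    have := ih.deriv
    simpa only [← iteratedDeriv_succ] using this

theorem HolFamilyAt.analyticAt [CompleteSpace F] (h : HolFamilyAt G q) :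
    ∀ᶠ q' in 𝓝 q, AnalyticAt ℂ (G q'.2) q'.1 := by
  obtain ⟨r, hr, N, hN, H⟩ := h.exists_box
  filter_upwards [prod_mem_nhds (Metric.ball_mem_nhds _ hr) hN] with q' hq'
  exact DifferentiableOn.analyticAt (s := Metric.ball q.1 r)
    (fun z hz => (H z hz q'.2 hq'.2).2.differentiableWithinAt) (Metric.isOpen_ball.mem_nhds hq'.1)

theorem HolFamilyAt.familyAt [CompleteSpace F] (h : HolFamilyAt G q) : FamilyAt G q := by
  refine ⟨?_, fun n => ?_⟩
  · filter_upwards [h.analyticAt] with q' hq'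
    exact (hq'.contDiffAt (n := ∞)).restrict_scalars ℝ
  · have hc : ContinuousAt (fun p : ℂ × T => _root_.iteratedDeriv n (G p.2) p.1) q :=
      (h.iteratedDeriv n).self_of_nhds.1
    have key : ∀ᶠ q' in 𝓝 q, (ContinuousMultilinearMap.restrictScalarsLinear ℝ
        ((ContinuousMultilinearMap.piFieldEquiv ℂ (Fin n) F)
          (_root_.iteratedDeriv n (G q'.2) q'.1))) = iteratedFDeriv ℝ n (G q'.2) q'.1 := by
      filter_upwards [h.analyticAt] with q' hq'
      rw [← ContDiffAt.restrictScalars_iteratedFDeriv (𝕜 := ℝ) (hq'.contDiffAt (n := n))]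
      simp only [Function.comp_apply]
      rw [iteratedFDeriv_eq_equiv_comp]
      rfl
    refine ContinuousAt.congr ?_ key
    exact ((ContinuousMultilinearMap.restrictScalarsLinear ℝ).continuous.comp
      (ContinuousMultilinearMap.piFieldEquiv ℂ (Fin n) F).continuous).continuousAt.comp
        (f := fun p : ℂ × T => _root_.iteratedDeriv n (G p.2) p.1) hc

end Holomorphic

/-! ### A radial bump function on the plane -/

/-- A radial smooth function, positive on the disc of radius `δ` and zero outside. -/
noncomputable def discBump (δ : ℝ) (z : ℂ) : ℝ := Real.smoothTransition (1 - ‖z‖ ^ 2 / δ ^ 2)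

section DiscBump

variable {δ : ℝ} {z : ℂ}

theorem contDiff_discBump (δ : ℝ) : ContDiff ℝ ∞ (discBump δ) := by
  have h : ContDiff ℝ ∞ fun z : ℂ => 1 - ‖z‖ ^ 2 / δ ^ 2 :=
    contDiff_const.sub ((contDiff_norm_sq ℝ).div_const _)
  exact (Real.smoothTransition.contDiff (n := (⊤ : ℕ∞))).comp h

theorem contDiff_ofReal_discBump (δ : ℝ) : ContDiff ℝ ∞ fun z : ℂ => (discBump δ z : ℂ) :=
  Complex.ofRealCLM.contDiff.comp (contDiff_discBump δ)

theorem discBump_nonneg : 0 ≤ discBump δ z := Real.smoothTransition.nonneg _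

theorem discBump_le_one : discBump δ z ≤ 1 := Real.smoothTransition.le_one _

theorem discBump_pos (hδ : 0 < δ) (hz : ‖z‖ < δ) : 0 < discBump δ z := by
  refine Real.smoothTransition.pos_of_pos ?_
  rw [sub_pos, div_lt_one (by positivity)]
  gcongr

theorem discBump_eq_zero (hδ : 0 < δ) (hz : δ ≤ ‖z‖) : discBump δ z = 0 := by
  refine Real.smoothTransition.zero_of_nonpos ?_
  rw [sub_nonpos, le_div_iff₀ (by positivity)]
  simpa using pow_le_pow_left₀ hδ.le hz 2

theorem norm_lt_of_discBump_ne_zero (hδ : 0 < δ) (h : discBump δ z ≠ 0) : ‖z‖ < δ :=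
  lt_of_not_ge fun h' => h (discBump_eq_zero hδ h')

theorem discBump_congr {w : ℂ} (h : ‖z‖ = ‖w‖) : discBump δ z = discBump δ w := by
  simp [discBump, h]

theorem hasCompactSupport_discBump (hδ : 0 < δ) : HasCompactSupport (discBump δ) :=
  HasCompactSupport.intro (isCompact_closedBall 0 δ) fun z hz =>
    discBump_eq_zero hδ (by simpa using (not_le.1 fun h => hz (by simpa using h)).le)

theorem hasCompactSupport_ofReal_discBump (hδ : 0 < δ) :
    HasCompactSupport fun z : ℂ => (discBump δ z : ℂ) :=
  (hasCompactSupport_discBump hδ).comp_left (g := ((↑) : ℝ → ℂ)) (by simp)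

theorem integral_discBump_pos (hδ : 0 < δ) : 0 < ∫ z, discBump δ z := by
  refine (contDiff_discBump δ).continuous.integral_pos_of_hasCompactSupport_nonneg_nonzero
    (hasCompactSupport_discBump hδ) (fun z => discBump_nonneg) (x := 0) ?_
  exact (discBump_pos hδ (by simpa using hδ)).ne'

end DiscBump

/-! ### Regularization of measures on the plane -/

section Regularization

variable {μ : Measure ℂ} [IsFiniteMeasure μ] {g : ℂ → ℂ}

theorem integrable_comp_sub (hg : Continuous g) (hc : HasCompactSupport g) (z : ℂ) :
    Integrable (fun w => g (z - w)) μ := by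
  obtain ⟨C, hC⟩ := hc.exists_bound_of_continuous hg
  exact Integrable.of_bound (by fun_prop) C (Eventually.of_forall fun w => hC _)

theorem continuous_integral_comp_sub (hg : Continuous g) (hc : HasCompactSupport g) :
    Continuous fun z => ∫ w, g (z - w) ∂μ := by
  obtain ⟨C, hC⟩ := hc.exists_bound_of_continuous hg
  refine continuous_of_dominated (bound := fun _ => C) (fun z => ?_) (fun z => ?_)
    (integrable_const _) ?_
  · exact (hg.comp (by fun_prop)).aestronglyMeasurable
  · exact Eventually.of_forall fun w => hC _
  · exact Eventually.of_forall fun w => hg.comp (by fun_prop)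

theorem hasFDerivAt_integral_comp_sub (hg : ContDiff ℝ 1 g) (hc : HasCompactSupport g) (z : ℂ) :
    HasFDerivAt (fun z => ∫ w, g (z - w) ∂μ) (∫ w, fderiv ℝ g (z - w) ∂μ) z := by
  have hg' : Continuous (fderiv ℝ g) := hg.continuous_fderiv (by norm_num)
  obtain ⟨C, hC⟩ := (hc.fderiv ℝ).exists_bound_of_continuous hg'
  refine hasFDerivAt_integral_of_dominated_of_fderiv_le (bound := fun _ => C) (s := univ)
    (F' := fun z w => fderiv ℝ g (z - w)) Filter.univ_mem
    (Eventually.of_forall fun z => ?_) (integrable_comp_sub hg.continuous hc z) ?_ ?_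
    (integrable_const _) ?_
  · exact (hg.continuous.comp (by fun_prop)).aestronglyMeasurable
  · exact (hg'.comp (by fun_prop)).aestronglyMeasurable
  · exact Eventually.of_forall fun w z _ => hC _
  · refine Eventually.of_forall fun w z _ => ?_
    have h1 := ((hg.differentiable (by norm_num)) (z - w)).hasFDerivAt
    have h2 := h1.comp z ((hasFDerivAt_id z).sub_const w)
    rwa [ContinuousLinearMap.comp_id] at h2

theorem fderiv_integral_comp_sub (hg : ContDiff ℝ 1 g) (hc : HasCompactSupport g) (z v : ℂ) :
    fderiv ℝ (fun z => ∫ w, g (z - w) ∂μ) z v = ∫ w, fderiv ℝ g (z - w) v ∂μ := by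
  rw [(hasFDerivAt_integral_comp_sub hg hc z).fderiv, ContinuousLinearMap.integral_apply]
  have hg' : Continuous (fderiv ℝ g) := hg.continuous_fderiv (by norm_num)
  obtain ⟨C, hC⟩ := (hc.fderiv ℝ).exists_bound_of_continuous hg'
  exact Integrable.of_bound (hg'.comp (by fun_prop)).aestronglyMeasurable C
    (Eventually.of_forall fun w => hC _)

theorem contDiff_integral_comp_sub (hg : ContDiff ℝ ∞ g) (hc : HasCompactSupport g) :
    ContDiff ℝ ∞ fun z => ∫ w, g (z - w) ∂μ := by
  have h := hc.contDiff_convolution_right (f := fun _ : ℂ => (1 : ℝ)) (μ := μ)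
    (ContinuousLinearMap.lsmul ℝ ℝ) (n := ⊤) (locallyIntegrable_const _) hg
  convert h using 1
  funext z
  simp [convolution]

theorem laplacian_integral_comp_sub (hg : ContDiff ℝ ∞ g) (hc : HasCompactSupport g) (z : ℂ) :
    Laplacian.laplacian (fun z => ∫ w, g (z - w) ∂μ) z =
      ∫ w, Laplacian.laplacian g (z - w) ∂μ := by
  have h1 : ContDiff ℝ 1 g := hg.of_le (by exact_mod_cast le_top)
  have hd : ∀ v, ContDiff ℝ ∞ fun z => fderiv ℝ g z v := fun v =>
    (hg.fderiv_right (m := ∞) (by simp)).clm_apply contDiff_const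
  have hcd : ∀ v, HasCompactSupport fun z => fderiv ℝ g z v := fun v => hc.fderiv_apply ℝ v
  have h2 : ∀ v, fderiv ℝ (fun z => fderiv ℝ (fun z => ∫ w, g (z - w) ∂μ) z v) z v =
      ∫ w, fderiv ℝ (fun z => fderiv ℝ g z v) (z - w) v ∂μ := by
    intro v
    simp only [fderiv_integral_comp_sub h1 hc]
    exact fderiv_integral_comp_sub ((hd v).of_le (by exact_mod_cast le_top)) (hcd v) z v
  rw [laplacian_eq_fderiv ((contDiff_integral_comp_sub hg hc).contDiffAt.of_le two_le_infty),
    h2, h2, ← integral_add]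
  · refine integral_congr_ae (Eventually.of_forall fun w => ?_)
    exact (laplacian_eq_fderiv (hg.contDiffAt.of_le two_le_infty)).symm
  all_goals
    refine integrable_comp_sub (g := fun z => fderiv ℝ (fun z => fderiv ℝ g z _) z _) ?_ ?_ z
    · exact (((hd _).fderiv_right (m := ∞) (by simp)).clm_apply contDiff_const).continuous
    · exact (hcd _).fderiv_apply ℝ _

theorem continuous_laplacian (hg : ContDiff ℝ ∞ g) : Continuous (Laplacian.laplacian g) := by
  have : Laplacian.laplacian g = fun z => fderiv ℝ (fun w => fderiv ℝ g w 1) z 1 +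
        fderiv ℝ (fun w => fderiv ℝ g w Complex.I) z Complex.I := by
    funext z
    exact laplacian_eq_fderiv (hg.contDiffAt.of_le two_le_infty)
  rw [this]
  have hd : ∀ v, ContDiff ℝ ∞ fun z => fderiv ℝ g z v := fun v =>
    (hg.fderiv_right (m := ∞) (by simp)).clm_apply contDiff_const
  have hd2 : ∀ v, Continuous fun z => fderiv ℝ (fun w => fderiv ℝ g w v) z v := fun v =>
    (((hd v).fderiv_right (m := ∞) (by simp)).clm_apply contDiff_const).continuous
  exact (hd2 1).add (hd2 Complex.I)

/-- The Laplacian of a reflected translate. -/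
theorem laplacian_comp_const_sub (hg : ContDiff ℝ ∞ g) (z w : ℂ) :
    Laplacian.laplacian (fun w => g (z - w)) w = Laplacian.laplacian g (z - w) := by
  have h := laplacian_comp_holomorphic (g := g) (τ := fun w => z - w) (z := w)
    (hg.contDiffAt.of_le two_le_infty) (Eventually.of_forall fun w => by fun_prop)
  rw [h, deriv_const_sub]
  simp

end Regularization

/-! ### Weyl's lemma -/

section Weyl

open InnerProductSpace

/-- The average of a harmonic function against a radial bump function is its central value. -/
theorem integral_discBump_mul_harmonic {h : ℂ → ℝ} {c : ℂ} {δ : ℝ} (hδ : 0 < δ)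
    (hh : HarmonicOnNhd h (Metric.closedBall c δ)) :
    ∫ w, discBump δ w * h (c + w) = (∫ w, discBump δ w) * h c := by
  set u : ℂ → ℝ := fun w => discBump δ w * h (c + w) with hu
  have hη : Continuous (discBump δ) := (contDiff_discBump δ).continuous
  have hu0 : ∀ w, δ ≤ ‖w‖ → u w = 0 := fun w hw => by simp [hu, discBump_eq_zero hδ hw]
  have huc : Continuous u := by
    rw [continuous_iff_continuousAt]
    intro w
    rcases le_or_gt ‖w‖ δ with hw | hw
    · have h1 : ContinuousAt h (c + w) := (hh (c + w) (by simpa using hw)).1.continuousAt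
      exact hη.continuousAt.mul (h1.comp (f := fun w => c + w) (by fun_prop))
    · have : u =ᶠ[𝓝 w] fun _ => 0 := by
        filter_upwards [(isOpen_lt continuous_const continuous_norm).mem_nhds hw] with y hy
        exact hu0 y (le_of_lt hy)
      exact continuousAt_const.congr this.symm
  -- the integrand is invariant under rotations, up to the factor `h`, whose average over a
  -- circle is its central value; integrate over all rotations
  have hrot : ∀ θ : ℝ, ∫ w in Metric.closedBall 0 δ, u (Circle.exp θ * w) = ∫ w, u w := by
    intro θ
    rw [setIntegral_eq_integral_of_forall_compl_eq_zero]
    · exact ((rotation (Circle.exp θ)).measurePreserving).integral_comp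
        (rotation (Circle.exp θ)).toHomeomorph.measurableEmbedding u
    · intro w hw
      refine hu0 _ ?_
      simpa using (not_le.1 fun h => hw (by simpa using h)).le
  -- the mean value property on the circle of radius `‖w‖`
  have hcirc : ∀ w ∈ Metric.closedBall (0 : ℂ) δ, ∫ θ in (0 : ℝ)..2 * Real.pi,
      u (Circle.exp θ * w) = 2 * Real.pi * (discBump δ w * h c) := by
    intro w hw
    have hw' : ‖w‖ ≤ δ := by simpa using hw
    have e1 : ∀ θ : ℝ, u (Circle.exp θ * w) =
        discBump δ w * h (circleMap c ‖w‖ (θ + Complex.arg w)) := by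
      intro θ
      have e2 : (Circle.exp θ : ℂ) * w = ‖w‖ * Complex.exp (((θ + Complex.arg w : ℝ) : ℂ) *
          Complex.I) := by
        conv_lhs => rw [← Complex.norm_mul_exp_arg_mul_I w]
        push_cast
        rw [add_mul, Complex.exp_add]
        ring
      have e3 : discBump δ (Circle.exp θ * w) = discBump δ w := discBump_congr (by simp)
      simp only [hu, e3]
      rw [e2]
      rfl
    have hm : Real.circleAverage h c ‖w‖ = h c := by
      refine InnerProductSpace.HarmonicOnNhd.circleAverage_eq fun z hz => hh z ?_
      rw [abs_of_nonneg (norm_nonneg w)] at hz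
      exact Metric.closedBall_subset_closedBall hw' hz
    simp only [e1]
    rw [intervalIntegral.integral_const_mul]
    have hper : Function.Periodic (fun θ => h (circleMap c ‖w‖ θ)) (2 * Real.pi) := fun θ => by
      simp only [periodic_circleMap c ‖w‖ θ]
    rw [intervalIntegral.integral_comp_add_right (fun θ => h (circleMap c ‖w‖ θ)), zero_add,
      add_comm (2 * Real.pi), hper.intervalIntegral_add_eq _ 0, zero_add]
    rw [Real.circleAverage, inv_smul_eq_iff₀ (by positivity), smul_eq_mul] at hm
    rw [hm]
    ring
  have hswap : ∫ θ in Ioc 0 (2 * Real.pi), ∫ w in Metric.closedBall 0 δ, u (Circle.exp θ * w) =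
      ∫ w in Metric.closedBall 0 δ, ∫ θ in Ioc 0 (2 * Real.pi), u (Circle.exp θ * w) := by
    refine integral_integral_swap (f := fun θ w => u (Circle.exp θ * w)) ?_
    rw [Measure.prod_restrict]
    have hc : Continuous (Function.uncurry fun (θ : ℝ) (w : ℂ) => u (Circle.exp θ * w)) := by
      refine huc.comp ?_
      fun_prop
    exact (hc.continuousOn.integrableOn_compact
      (isCompact_Icc.prod (isCompact_closedBall 0 δ))).mono_set
        (prod_mono Ioc_subset_Icc_self Subset.rfl)
  have h2π : 0 ≤ 2 * Real.pi := by positivity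
  simp only [hrot, ← intervalIntegral.integral_of_le h2π] at hswap
  rw [setIntegral_congr_fun measurableSet_closedBall hcirc, intervalIntegral.integral_const,
    integral_const_mul, integral_mul_const, setIntegral_eq_integral_of_forall_compl_eq_zero,
    sub_zero, smul_eq_mul] at hswap
  · exact mul_left_cancel₀ (by positivity) hswap
  · intro w hw
    exact discBump_eq_zero hδ (not_le.1 fun h => hw (by simpa using h)).le

/-- The regularization of a measure on the plane by a radial bump function. -/
noncomputable def regularize (μ : Measure ℂ) (δ : ℝ) (z : ℂ) : ℝ := ∫ w, discBump δ (z - w) ∂μ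

variable {μ : Measure ℂ} [IsFiniteMeasure μ] {c : ℂ} {R δ ε : ℝ}

omit [IsFiniteMeasure μ] in
theorem ofReal_regularize (δ : ℝ) (z : ℂ) :
    (regularize μ δ z : ℂ) = ∫ w, (discBump δ (z - w) : ℂ) ∂μ := integral_ofReal.symm

theorem continuous_regularize (hδ : 0 < δ) : Continuous (regularize μ δ) := by
  have h : Continuous fun z => Complex.re (regularize μ δ z) := by
    simp only [ofReal_regularize]
    exact Complex.continuous_re.comp (continuous_integral_comp_sub
      (contDiff_ofReal_discBump δ).continuous (hasCompactSupport_ofReal_discBump hδ))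
  simpa using h

/-- A measure which is harmonic against the translates of the bump function has harmonic
regularizations. -/
theorem harmonicOnNhd_regularize (hδ : 0 < δ) {D : Set ℂ} (hD : Dense D)
    (hμ : ∀ ζ ∈ D, Metric.closedBall ζ δ ⊆ Metric.ball c R →
      ∫ w, Laplacian.laplacian (fun w => (discBump δ (ζ - w) : ℂ)) w ∂μ = 0) :
    HarmonicOnNhd (regularize μ δ) (Metric.ball c (R - δ)) := by
  have hg := contDiff_ofReal_discBump δ
  have hc := hasCompactSupport_ofReal_discBump hδ
  have e : (fun z => (regularize μ δ z : ℂ)) = fun z => ∫ w, (discBump δ (z - w) : ℂ) ∂μ :=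
    funext (ofReal_regularize δ)
  have hsm : ContDiff ℝ ∞ fun z => (regularize μ δ z : ℂ) := by
    rw [e]
    exact contDiff_integral_comp_sub hg hc
  have hsm' : ContDiff ℝ ∞ (regularize μ δ) := by
    have := Complex.reCLM.contDiff.comp hsm
    simpa [Function.comp_def] using this
  have hlap : ∀ z, Laplacian.laplacian (fun z => (regularize μ δ z : ℂ)) z =
      ∫ w, Laplacian.laplacian (fun z : ℂ => (discBump δ z : ℂ)) (z - w) ∂μ := by
    intro z
    rw [e]
    exact laplacian_integral_comp_sub hg hc z
  -- the Laplacian vanishes on a dense subset, and it is continuous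
  have hzero : ∀ z ∈ Metric.ball c (R - δ),
      Laplacian.laplacian (fun z => (regularize μ δ z : ℂ)) z = 0 := by
    have hcont : Continuous (Laplacian.laplacian fun z => (regularize μ δ z : ℂ)) :=
      continuous_laplacian hsm
    have hden : Metric.ball c (R - δ) ⊆ closure (Metric.ball c (R - δ) ∩ D) :=
      hD.open_subset_closure_inter Metric.isOpen_ball
    intro z hz
    have hcl : IsClosed {z | Laplacian.laplacian (fun z => (regularize μ δ z : ℂ)) z = 0} :=
      isClosed_singleton.preimage hcont
    refine closure_minimal ?_ hcl (hden hz)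
    rintro ζ ⟨hζ, hζD⟩
    have h0 := hμ ζ hζD (Metric.closedBall_subset_ball' (by
      have := Metric.mem_ball.1 hζ
      linarith))
    simp only [laplacian_comp_const_sub (g := fun z : ℂ => (discBump δ z : ℂ)) hg] at h0
    simp only [mem_ofPred_eq, hlap, h0]
  intro z hz
  refine ⟨hsm'.contDiffAt.of_le two_le_infty, ?_⟩
  filter_upwards [Metric.isOpen_ball.mem_nhds hz] with y hy
  have h1 := ContDiffAt.laplacian_CLM_comp_left (l := Complex.ofRealCLM)
    (hsm'.contDiffAt.of_le two_le_infty : ContDiffAt ℝ 2 (regularize μ δ) y)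
  have h2 := hzero y hy
  have h3 : (Complex.ofRealCLM ∘ regularize μ δ) = fun z => (regularize μ δ z : ℂ) := rfl
  rw [h3, h2] at h1
  simpa using h1.symm

theorem integral_mul_regularize {k : ℂ → ℝ} (hk : Continuous k) (hkc : HasCompactSupport k)
    (δ : ℝ) : ∫ z, k z * regularize μ δ z = ∫ t, (∫ z, k z * discBump δ (z - t)) ∂μ := by
  simp only [regularize, ← integral_const_mul]
  refine integral_integral_swap (f := fun z t => k z * discBump δ (z - t)) ?_
  have hη : Continuous (discBump δ) := (contDiff_discBump δ).continuous
  refine Integrable.mono' (((hk.integrable_of_hasCompactSupport hkc).norm).mul_prod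
    (integrable_const (1 : ℝ) (μ := μ))) ?_ ?_
  · exact (Continuous.aestronglyMeasurable (by fun_prop))
  · refine Eventually.of_forall fun p => ?_
    simp only [Function.uncurry, norm_mul]
    gcongr
    rw [Real.norm_of_nonneg discBump_nonneg]
    exact discBump_le_one

/-- Two regularizations commute, since both bump functions are even. -/
theorem integral_discBump_mul_regularize_comm (hδ : 0 < δ) (hε : 0 < ε) (z : ℂ) :
    ∫ w, discBump ε w * regularize μ δ (z + w) = ∫ w, discBump δ w * regularize μ ε (z + w) := by
  have key : ∀ a b : ℝ, 0 < a → 0 < b → ∫ w, discBump a w * regularize μ b (z + w) =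
      ∫ t, (∫ w, discBump a w * discBump b (z + w - t)) ∂μ := by
    intro a b ha hb
    have hη : Continuous (discBump a) := (contDiff_discBump a).continuous
    have h := integral_mul_regularize (μ := μ) (k := fun y => discBump a (y - z))
      (hη.comp (by fun_prop))
      ((hasCompactSupport_discBump ha).comp_homeomorph (Homeomorph.subRight z)) b
    rw [← integral_add_left_eq_self _ z] at h
    simp only [add_sub_cancel_left] at h
    rw [h]
    refine integral_congr_ae (Eventually.of_forall fun t => ?_)
    simp only
    rw [← integral_add_left_eq_self _ z]
    simp only [add_sub_cancel_left]
  rw [key ε δ hε hδ, key δ ε hδ hε]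
  refine integral_congr_ae (Eventually.of_forall fun t => ?_)
  simp only
  rw [← integral_sub_left_eq_self _ volume (t - z)]
  refine integral_congr_ae (Eventually.of_forall fun w => ?_)
  have e1 : discBump ε (t - z - w) = discBump ε (z + w - t) :=
    discBump_congr (by rw [← norm_neg]; congr 1; ring)
  have e2 : discBump δ (z + (t - z - w) - t) = discBump δ w :=
    discBump_congr (by rw [← norm_neg]; congr 1; ring)
  simp only [e1, e2]
  ring

/-- Averages against bump functions of radius tending to zero tend to the central value. -/
theorem tendsto_integral_mul_discBump {k : ℂ → ℝ} (hk : Continuous k) (t : ℂ) {r : ℝ}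
    (hr : 0 < r) :
    Tendsto (fun n : ℕ => (∫ z, discBump (r / (n + 1)) z)⁻¹ *
      ∫ z, k z * discBump (r / (n + 1)) (z - t)) atTop (𝓝 (k t)) := by
  rw [Metric.tendsto_atTop]
  intro e he
  obtain ⟨η, hη, hη'⟩ := Metric.continuousAt_iff.1 (hk.tendsto t) (e / 2) (half_pos he)
  obtain ⟨N, hN⟩ := exists_nat_gt (r / η)
  refine ⟨N, fun n hn => ?_⟩
  have hδ : 0 < r / ((n : ℝ) + 1) := by positivity
  set d := r / ((n : ℝ) + 1) with hd
  have hdη : d < η := by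
    rw [hd, div_lt_iff₀ (by positivity)]
    rw [div_lt_iff₀ hη] at hN
    have : (N : ℝ) ≤ n := by exact_mod_cast hn
    nlinarith
  have hC := integral_discBump_pos hδ
  have hb : Continuous (discBump d) := (contDiff_discBump d).continuous
  have hbc : HasCompactSupport fun z => discBump d (z - t) :=
    (hasCompactSupport_discBump hδ).comp_homeomorph (Homeomorph.subRight t)
  have i1 : Integrable fun z => discBump d (z - t) :=
    Continuous.integrable_of_hasCompactSupport (by fun_prop) hbc
  have i2 : Integrable fun z => k z * discBump d (z - t) :=
    Continuous.integrable_of_hasCompactSupport (by fun_prop) hbc.mul_left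
  have eC : ∫ z, discBump d z = ∫ z, discBump d (z - t) := (integral_sub_right_eq_self _ t).symm
  have e1 : (∫ z, discBump d z)⁻¹ * (∫ z, k z * discBump d (z - t)) - k t =
      (∫ z, discBump d z)⁻¹ * ∫ z, (k z - k t) * discBump d (z - t) := by
    have : ∫ z, (k z - k t) * discBump d (z - t) =
        (∫ z, k z * discBump d (z - t)) - k t * ∫ z, discBump d z := by
      simp only [sub_mul]
      rw [integral_sub i2 (i1.const_mul _), integral_const_mul, eC]
    rw [this]
    field_simp
  rw [Real.dist_eq, e1, abs_mul, abs_of_pos (inv_pos.2 hC), inv_mul_lt_iff₀ hC]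
  have hle : ‖∫ z, (k z - k t) * discBump d (z - t)‖ ≤ ∫ z, e / 2 * discBump d (z - t) := by
    refine norm_integral_le_of_norm_le (i1.const_mul _) (Eventually.of_forall fun z => ?_)
    rw [norm_mul, Real.norm_of_nonneg (discBump_nonneg (z := z - t))]
    by_cases hz : discBump d (z - t) = 0
    · simp [hz]
    · have := norm_lt_of_discBump_ne_zero hδ hz
      have h3 := hη' (show dist z t < η by rw [dist_eq_norm]; linarith)
      rw [dist_eq_norm] at h3
      exact mul_le_mul_of_nonneg_right h3.le discBump_nonneg
  rw [integral_const_mul, ← eC] at hle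
  rw [Real.norm_eq_abs] at hle
  nlinarith

/-- Weyl's lemma: a finite measure which is harmonic on a disc, in the sense that the Laplacians
of the translates of radial bump functions have integral zero, has a harmonic density. -/
theorem exists_harmonic_density {r : ℝ} (hr : 0 < r) {D : Set ℂ} (hD : Dense D)
    (hμ : ∀ n : ℕ, ∀ ζ ∈ D, Metric.closedBall ζ (r / (n + 1)) ⊆ Metric.ball c (4 * r) →
      ∫ w, Laplacian.laplacian (fun w => (discBump (r / (n + 1)) (ζ - w) : ℂ)) w ∂μ = 0) :
    ∃ h : ℂ → ℝ, Continuous h ∧ (∀ z, 0 ≤ h z) ∧ HarmonicOnNhd h (Metric.ball c (2 * r)) ∧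
      μ.restrict (Metric.ball c (2 * r)) =
        (volume.restrict (Metric.ball c (2 * r))).withDensity fun z => ENNReal.ofReal (h z) := by
  have hδ : ∀ n : ℕ, 0 < r / ((n : ℝ) + 1) := fun n => by positivity
  have hδr : ∀ n : ℕ, r / ((n : ℝ) + 1) ≤ r := fun n =>
    div_le_self hr.le (by linarith [(Nat.cast_nonneg n : (0 : ℝ) ≤ n)])
  have hC : ∀ n : ℕ, 0 < ∫ z, discBump (r / ((n : ℝ) + 1)) z := fun n =>
    integral_discBump_pos (hδ n)
  have hharm : ∀ n : ℕ, HarmonicOnNhd (regularize μ (r / (n + 1))) (Metric.ball c (3 * r)) :=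
    fun n => (harmonicOnNhd_regularize (hδ n) hD (hμ n)).mono
      (Metric.ball_subset_ball (by linarith [hδr n]))
  have hnn : ∀ d z, 0 ≤ regularize μ d z := fun d z => integral_nonneg fun w => discBump_nonneg
  -- the density is the normalised regularization of radius `r`
  set h : ℂ → ℝ := fun z => (∫ w, discBump (r / (((0 : ℕ) : ℝ) + 1)) w)⁻¹ *
    regularize μ (r / (((0 : ℕ) : ℝ) + 1)) z with hh
  have hcont : Continuous h := continuous_const.mul (continuous_regularize (hδ 0))
  have hpos : ∀ z, 0 ≤ h z := fun z => mul_nonneg (inv_nonneg.2 (hC 0).le) (hnn _ _)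
  -- all normalised regularizations agree on the smaller disc: average the regularization of one
  -- radius with the bump function of the other, and use the mean value property for both
  have heq : ∀ n : ℕ, ∀ z ∈ Metric.ball c (2 * r),
      (∫ w, discBump (r / ((n : ℝ) + 1)) w)⁻¹ * regularize μ (r / (n + 1)) z = h z := by
    intro n z hz
    have hsub : ∀ m : ℕ, Metric.closedBall z (r / ((m : ℝ) + 1)) ⊆ Metric.ball c (3 * r) :=
      fun m => Metric.closedBall_subset_ball' (by linarith [hδr m, Metric.mem_ball.1 hz])
    have h1 := integral_discBump_mul_harmonic (hδ 0) ((hharm n).mono (hsub 0))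
    have h2 := integral_discBump_mul_harmonic (hδ n) ((hharm 0).mono (hsub n))
    rw [integral_discBump_mul_regularize_comm (hδ n) (hδ 0), h2] at h1
    have c0 := hC 0
    have cn := hC n
    rw [hh, inv_mul_eq_iff_eq_mul₀ cn.ne']
    simp only
    rw [mul_left_comm, h1, inv_mul_cancel_left₀ c0.ne']
  refine ⟨h, hcont, hpos, fun z hz => ?_, ?_⟩
  · have := (hharm 0).const_smul (c := (∫ w, discBump (r / (((0 : ℕ) : ℝ) + 1)) w)⁻¹)
    exact this z (Metric.ball_subset_ball (by linarith) hz)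
  have h2r : 0 < 2 * r := by linarith
  set B := Metric.ball c (2 * r) with hB
  -- a continuous function which is positive exactly on the smaller disc, to localise the measures
  set κ : ℂ → ℝ := fun z => discBump (2 * r) (z - c) with hκ
  have hκc : Continuous κ := (contDiff_discBump _).continuous.comp (by fun_prop)
  have hκcs : HasCompactSupport κ :=
    (hasCompactSupport_discBump h2r).comp_homeomorph (Homeomorph.subRight c)
  have hκ0 : ∀ z, 0 ≤ κ z := fun z => discBump_nonneg
  have hκB : ∀ z, z ∉ B → κ z = 0 := fun z hz =>
    discBump_eq_zero h2r (by simpa [hB, dist_eq_norm] using hz)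
  have hκpos : ∀ z ∈ B, 0 < κ z := fun z hz =>
    discBump_pos h2r (by simpa [hB, dist_eq_norm] using hz)
  -- the two measures agree against continuous functions
  have key : ∀ f : BoundedContinuousFunction ℂ ℝ,
      ∫ z, f z * κ z ∂μ = ∫ z, f z * κ z * h z := by
    intro f
    set k : ℂ → ℝ := fun z => f z * κ z with hk
    have hkc : Continuous k := f.continuous.mul hκc
    have hks : HasCompactSupport k := hκcs.mul_left
    obtain ⟨C, hCk⟩ := hks.exists_bound_of_continuous hkc
    -- the integral against `μ` is the limit of the integrals against the regularizations, and these
    -- are all equal to the integral against `h`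
    have lim : Tendsto (fun n : ℕ => ∫ t, ((∫ z, discBump (r / (n + 1)) z)⁻¹ *
      ∫ z, k z * discBump (r / (n + 1)) (z - t)) ∂μ) atTop (𝓝 (∫ t, k t ∂μ)) := by
      refine tendsto_integral_of_dominated_convergence (fun _ => C) (fun n => ?_)
        (integrable_const _) (fun n => Eventually.of_forall fun t => ?_)
        (Eventually.of_forall fun t => tendsto_integral_mul_discBump hkc t hr)
      · have hb : Continuous (discBump (r / ((n : ℝ) + 1))) := (contDiff_discBump _).continuous
        have hm : StronglyMeasurable fun p : ℂ × ℂ => k p.2 * discBump (r / ((n : ℝ) + 1))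
            (p.2 - p.1) := Continuous.stronglyMeasurable (by fun_prop)
        exact (hm.integral_prod_right'.const_mul _).aestronglyMeasurable
      · have hb : Continuous (discBump (r / ((n : ℝ) + 1))) := (contDiff_discBump _).continuous
        have hbc : HasCompactSupport fun z => discBump (r / ((n : ℝ) + 1)) (z - t) :=
          (hasCompactSupport_discBump (hδ n)).comp_homeomorph (Homeomorph.subRight t)
        have i1 : Integrable fun z => discBump (r / ((n : ℝ) + 1)) (z - t) :=
          Continuous.integrable_of_hasCompactSupport (by fun_prop) hbc
        rw [norm_mul, norm_inv, Real.norm_of_nonneg (hC n).le, inv_mul_le_iff₀ (hC n)]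
        have eC : ∫ z, discBump (r / ((n : ℝ) + 1)) z =
          ∫ z, discBump (r / ((n : ℝ) + 1)) (z - t) := (integral_sub_right_eq_self _ t).symm
        rw [eC, ← integral_mul_const]
        refine norm_integral_le_of_norm_le (i1.mul_const _) (Eventually.of_forall fun z => ?_)
        rw [norm_mul, Real.norm_of_nonneg (discBump_nonneg (z := z - t)), mul_comm]
        exact mul_le_mul_of_nonneg_left (hCk z) discBump_nonneg
    have hconst : ∀ n : ℕ, ∫ t, ((∫ z, discBump (r / (n + 1)) z)⁻¹ *
      ∫ z, k z * discBump (r / (n + 1)) (z - t)) ∂μ = ∫ z, k z * h z := by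
      intro n
      rw [integral_const_mul, ← integral_mul_regularize hkc hks, ← integral_const_mul]
      refine integral_congr_ae (Eventually.of_forall fun z => ?_)
      by_cases hz : z ∈ B
      · simp only [← heq n z hz]
        ring
      · simp [hk, hκB z hz]
    simp only [hconst] at lim
    exact tendsto_nhds_unique lim tendsto_const_nhds
  have hm1 : Measurable fun z => ENNReal.ofReal (κ z) := by fun_prop
  have hm2 : Measurable fun z => ENNReal.ofReal (h z) := by fun_prop
  have iκ : Integrable κ μ := hκc.integrable_of_hasCompactSupport hκcs
  have iκh : Integrable (fun z => κ z * h z) :=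
    (hκc.mul hcont).integrable_of_hasCompactSupport hκcs.mul_right
  have : IsFiniteMeasure (μ.withDensity fun z => ENNReal.ofReal (κ z)) :=
    isFiniteMeasure_withDensity_ofReal iκ.2
  have : IsFiniteMeasure (volume.withDensity fun z => ENNReal.ofReal (κ z * h z)) :=
    isFiniteMeasure_withDensity_ofReal iκh.2
  have hext : μ.withDensity (fun z => ENNReal.ofReal (κ z)) =
      volume.withDensity fun z => ENNReal.ofReal (κ z * h z) := by
    refine ext_of_forall_integral_eq_of_IsFiniteMeasure fun f => ?_
    rw [integral_withDensity_eq_integral_toReal_smul hm1 (by simp),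
      integral_withDensity_eq_integral_toReal_smul (by fun_prop) (by simp)]
    simp only [ENNReal.toReal_ofReal (hκ0 _),
      ENNReal.toReal_ofReal (mul_nonneg (hκ0 _) (hpos _)), smul_eq_mul]
    have h3 := key f
    simp only [mul_comm (f _) (κ _), mul_right_comm _ (f _) (h _)] at h3
    exact h3
  -- restrict to the disc and divide by `κ`
  have hres := congrArg (fun m => (m.restrict B).withDensity fun z => (ENNReal.ofReal (κ z))⁻¹) hext
  have hBm : MeasurableSet B := measurableSet_ball
  have e2 : (fun z => ENNReal.ofReal (κ z * h z)) =
      (fun z => ENNReal.ofReal (h z)) * fun z => ENNReal.ofReal (κ z) := by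
    funext z
    rw [Pi.mul_apply, ENNReal.ofReal_mul (hκ0 z), mul_comm]
  simp only [restrict_withDensity hBm] at hres
  have hne : ∀ ν : Measure ℂ, ∀ᵐ z ∂(ν.restrict B), ENNReal.ofReal (κ z) ≠ 0 := fun ν => by
    filter_upwards [ae_restrict_mem hBm] with z hz
    simpa using hκpos z hz
  have hne' : ∀ᵐ z ∂((volume.restrict B).withDensity fun z => ENNReal.ofReal (h z)),
      ENNReal.ofReal (κ z) ≠ 0 := (withDensity_absolutelyContinuous _ _).ae_le (hne volume)
  rwa [withDensity_inv_same hm1 (hne μ) (by simp), e2, withDensity_mul _ hm2 hm1,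
    withDensity_inv_same hm1 hne' (by simp)] at hres

end Weyl

/-! ### Green's formula and functions of harmonic functions -/

section Green

open InnerProductSpace

theorem laplacian_comp_re {k : ℝ → ℝ} (hk : ContDiff ℝ ∞ k) (ζ : ℂ) :
    Laplacian.laplacian (fun ζ : ℂ => (k ζ.re : ℂ)) ζ = ((deriv (deriv k) ζ.re : ℝ) : ℂ) := by
  have hd : ∀ {k : ℝ → ℝ}, ContDiff ℝ ∞ k → ∀ ζ v : ℂ,
      fderiv ℝ (fun ζ : ℂ => (k ζ.re : ℂ)) ζ v = ((deriv k ζ.re * v.re : ℝ) : ℂ) := by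
    intro k hk ζ v
    have h1 : HasFDerivAt (fun ζ : ℂ => ζ.re) Complex.reCLM ζ := Complex.reCLM.hasFDerivAt
    have h2 := ((hk.differentiable (by simp)) ζ.re).hasDerivAt.comp_hasFDerivAt ζ h1
    have h3 := Complex.ofRealCLM.hasFDerivAt.comp ζ h2
    have h4 : fderiv ℝ (fun ζ : ℂ => (k ζ.re : ℂ)) ζ = _ := h3.fderiv
    rw [h4]
    simp
  have hk' : ContDiff ℝ ∞ (deriv k) := (contDiff_infty_iff_deriv.1 hk).2
  have hsm : ContDiff ℝ ∞ fun ζ : ℂ => (k ζ.re : ℂ) :=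
    Complex.ofRealCLM.contDiff.comp (hk.comp Complex.reCLM.contDiff)
  rw [laplacian_eq_fderiv (hsm.contDiffAt.of_le two_le_infty)]
  simp only [hd hk]
  have e1 : (fun w : ℂ => ((deriv k w.re * (1 : ℂ).re : ℝ) : ℂ)) = fun w => ((deriv k w.re : ℝ) : ℂ) := by
    simp
  have e2 : (fun w : ℂ => ((deriv k w.re * (Complex.I).re : ℝ) : ℂ)) = fun w => 0 := by
    simp
  rw [e1, e2, hd hk']
  simp

/-- Green's formula: two integrations by parts, in each of the two directions. -/
theorem integral_mul_laplacian_comm {u θ : ℂ → ℂ} (hθ : ContDiff ℝ ∞ θ) (hc : HasCompactSupport θ)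
    (hu : ∀ z ∈ tsupport θ, ContDiffAt ℝ ∞ u z) :
    ∫ z, u z * Laplacian.laplacian θ z = ∫ z, Laplacian.laplacian u z * θ z := by
  have hint : ∀ a k : ℂ → ℂ, Continuous k → tsupport k ⊆ tsupport θ →
      (∀ z ∈ tsupport θ, ContinuousAt a z) → Integrable fun z => a z * k z := by
    intro a k hk hks ha
    have h1 : IntegrableOn (fun z => a z * k z) (tsupport θ) := by
      refine ContinuousOn.integrableOn_compact hc ?_
      exact fun z hz => ((ha z hz).mul hk.continuousAt).continuousWithinAt
    refine (integrableOn_iff_integrable_of_support_subset ?_).1 h1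
    intro z hz
    refine hks (subset_tsupport k ?_)
    intro h
    exact hz (by simp [h])
  have hd : ∀ {g : ℂ → ℂ} {z : ℂ}, ContDiffAt ℝ ∞ g z → ∀ v,
      ContDiffAt ℝ ∞ (fun z => fderiv ℝ g z v) z := fun hg v =>
    (hg.fderiv_right (m := ∞) (by simp)).clm_apply contDiffAt_const
  have hdθ : ∀ v, ContDiff ℝ ∞ fun z => fderiv ℝ θ z v := fun v =>
    contDiff_iff_contDiffAt.2 fun z => hd hθ.contDiffAt v
  have hddθ : ∀ v, ContDiff ℝ ∞ fun z => fderiv ℝ (fun z => fderiv ℝ θ z v) z v := fun v =>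
    contDiff_iff_contDiffAt.2 fun z => hd (hdθ v).contDiffAt v
  have hs1 : ∀ v, tsupport (fun z => fderiv ℝ θ z v) ⊆ tsupport θ := fun v =>
    tsupport_fderiv_apply_subset ℝ v
  have hs2 : ∀ v, tsupport (fun z => fderiv ℝ (fun z => fderiv ℝ θ z v) z v) ⊆ tsupport θ :=
    fun v => (tsupport_fderiv_apply_subset ℝ v).trans (hs1 v)
  have hdiff : ∀ {g : ℂ → ℂ} {z : ℂ}, ContDiffAt ℝ ∞ g z → DifferentiableAt ℝ g z := fun hg =>
    hg.differentiableAt (by simp)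
  have i0 : ∀ v, Integrable fun z => u z * fderiv ℝ (fun z => fderiv ℝ θ z v) z v := fun v =>
    hint _ _ (hddθ v).continuous (hs2 v) fun z hz => (hu z hz).continuousAt
  have i1 : ∀ v, Integrable fun z => fderiv ℝ u z v * fderiv ℝ θ z v := fun v =>
    hint _ _ (hdθ v).continuous (hs1 v) fun z hz => (hd (hu z hz) v).continuousAt
  have i2 : ∀ v, Integrable fun z => fderiv ℝ (fun z => fderiv ℝ u z v) z v * θ z := fun v =>
    hint _ _ hθ.continuous Subset.rfl fun z hz => (hd (hd (hu z hz) v) v).continuousAt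
  have step : ∀ v, ∫ z, u z * fderiv ℝ (fun z => fderiv ℝ θ z v) z v =
      ∫ z, fderiv ℝ (fun z => fderiv ℝ u z v) z v * θ z := by
    intro v
    rw [integral_mul_fderiv_eq_neg_fderiv_mul_of_integrable (i1 v) (i0 v)
      (hint _ _ (hdθ v).continuous (hs1 v) fun z hz => (hu z hz).continuousAt)
      (fun z hz => hdiff (hu z (hs1 v hz))) (fun z _ => hdiff (hdθ v).contDiffAt),
      integral_mul_fderiv_eq_neg_fderiv_mul_of_integrable (i2 v) (i1 v)
      (hint _ _ hθ.continuous Subset.rfl fun z hz => (hd (hu z hz) v).continuousAt)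
      (fun z hz => hdiff (hd (hu z hz) v)) (fun z _ => hdiff hθ.contDiffAt), neg_neg]
  have e1 : ∀ z, u z * Laplacian.laplacian θ z = u z * fderiv ℝ (fun z => fderiv ℝ θ z 1) z 1 +
      u z * fderiv ℝ (fun z => fderiv ℝ θ z Complex.I) z Complex.I := fun z => by
    rw [laplacian_eq_fderiv (hθ.contDiffAt.of_le two_le_infty), mul_add]
  have e2 : ∀ z, Laplacian.laplacian u z * θ z = fderiv ℝ (fun z => fderiv ℝ u z 1) z 1 * θ z +
      fderiv ℝ (fun z => fderiv ℝ u z Complex.I) z Complex.I * θ z := fun z => by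
    by_cases hz : z ∈ tsupport θ
    · rw [laplacian_eq_fderiv ((hu z hz).of_le two_le_infty), add_mul]
    · simp [image_eq_zero_of_notMem_tsupport hz]
  simp only [e1, e2]
  rw [integral_add (i0 1) (i0 Complex.I), integral_add (i2 1) (i2 Complex.I), step, step]

/-- Green's formula for the superharmonic function `1 - exp (-h)`, where `h` is the real part of
the holomorphic function `F`. -/
theorem integral_one_sub_exp_mul_laplacian {h : ℂ → ℝ} {F : ℂ → ℂ} {c : ℂ} {R r : ℝ}
    (hF : AnalyticOnNhd ℂ F (Metric.ball c R)) (hFh : ∀ z ∈ Metric.ball c R, (F z).re = h z)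
    (hr : r < R) {θ : ℂ → ℂ} (hθ : ContDiffOn ℝ ∞ θ (Metric.ball c R))
    (hθ0 : ∀ z ∈ Metric.ball c R, r < ‖z - c‖ → θ z = 0) :
    ∫ z in Metric.ball c R, ((1 - Real.exp (-h z) : ℝ) : ℂ) * Laplacian.laplacian θ z =
      -∫ z in Metric.ball c R, ((‖deriv F z‖ ^ 2 * Real.exp (-h z) : ℝ) : ℂ) * θ z := by
  set B := Metric.ball c R with hB
  have hBo : IsOpen B := Metric.isOpen_ball
  -- the extension of `θ` by zero
  set θ' : ℂ → ℂ := B.indicator θ with hθ'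
  have hout : ∀ z, r < ‖z - c‖ → θ' z = 0 := fun z hz => by
    by_cases hzB : z ∈ B
    · rw [hθ', indicator_of_mem hzB, hθ0 z hzB hz]
    · rw [hθ', indicator_of_notMem hzB]
  have hloc : ∀ z ∈ B, θ' =ᶠ[𝓝 z] θ := fun z hz => by
    filter_upwards [hBo.mem_nhds hz] with y hy using indicator_of_mem hy θ
  have hsupp : Function.support θ' ⊆ Metric.closedBall c r := fun z hz => by
    by_contra hcon
    exact hz (hout z (by simpa [dist_eq_norm] using hcon))
  have hts : tsupport θ' ⊆ Metric.closedBall c r := closure_minimal hsupp Metric.isClosed_closedBall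
  have htB : tsupport θ' ⊆ B := hts.trans (Metric.closedBall_subset_ball hr)
  have hsm : ContDiff ℝ ∞ θ' := by
    rw [contDiff_iff_contDiffAt]
    intro z
    by_cases hz : z ∈ B
    · exact (hθ.contDiffAt (hBo.mem_nhds hz)).congr_of_eventuallyEq (hloc z hz)
    · have : z ∉ tsupport θ' := fun h' => hz (htB h')
      exact contDiffAt_const.congr_of_eventuallyEq (notMem_tsupport_iff_eventuallyEq.1 this)
  have hcs : HasCompactSupport θ' :=
    HasCompactSupport.intro (isCompact_closedBall c r) fun z hz => by
      by_contra hcon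
      exact hz (hsupp hcon)
  set k : ℝ → ℝ := fun x => 1 - Real.exp (-x) with hk
  have hksm : ContDiff ℝ ∞ k := by fun_prop
  have hkd : deriv (deriv k) = fun x => -Real.exp (-x) := by
    have h1 : deriv k = fun x => Real.exp (-x) := by
      funext x
      have := ((hasDerivAt_neg x).exp).const_sub 1
      rw [hk, this.deriv]
      simp
    rw [h1]
    funext x
    rw [((hasDerivAt_neg x).exp).deriv]
    simp
  set ψ : ℂ → ℂ := fun ζ => (k ζ.re : ℂ) with hψ
  have hψsm : ContDiff ℝ ∞ ψ := Complex.ofRealCLM.contDiff.comp (hksm.comp Complex.reCLM.contDiff)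
  have hu : ∀ z ∈ tsupport θ', ContDiffAt ℝ ∞ (fun z => ψ (F z)) z := fun z hz =>
    hψsm.contDiffAt.comp z (((hF z (htB hz)).contDiffAt (n := ∞)).restrict_scalars ℝ)
  have green := integral_mul_laplacian_comm hsm hcs hu
  have hlap0 : ∀ z, z ∉ B → Laplacian.laplacian θ' z = 0 := fun z hz => by
    have : z ∉ tsupport θ' := fun h' => hz (htB h')
    rw [(laplacian_congr_nhds (notMem_tsupport_iff_eventuallyEq.1 this)).eq_of_nhds]
    exact congrFun (laplacian_const (c := (0 : ℂ))) z
  have g1 : ∫ z in B, ψ (F z) * Laplacian.laplacian θ' z =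
      ∫ z, ψ (F z) * Laplacian.laplacian θ' z :=
    setIntegral_eq_integral_of_forall_compl_eq_zero fun z hz => by rw [hlap0 z hz, mul_zero]
  have g2 : ∫ z in B, Laplacian.laplacian (fun z => ψ (F z)) z * θ' z =
      ∫ z, Laplacian.laplacian (fun z => ψ (F z)) z * θ' z :=
    setIntegral_eq_integral_of_forall_compl_eq_zero fun z hz => by
      rw [hθ', indicator_of_notMem hz, mul_zero]
  rw [← g1, ← g2] at green
  have eL : ∫ z in B, ψ (F z) * Laplacian.laplacian θ' z =
      ∫ z in B, ((1 - Real.exp (-h z) : ℝ) : ℂ) * Laplacian.laplacian θ z :=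
    setIntegral_congr_fun hBo.measurableSet fun z hz => by
      simp only [hψ, hk, hFh z hz, (laplacian_congr_nhds (hloc z hz)).eq_of_nhds]
  -- the Laplacian of `1 - exp (-Re F)` is `-‖deriv F‖² exp (-Re F)`
  have eR : ∫ z in B, Laplacian.laplacian (fun z => ψ (F z)) z * θ' z =
      ∫ z in B, -(((‖deriv F z‖ ^ 2 * Real.exp (-h z) : ℝ) : ℂ) * θ z) :=
    setIntegral_congr_fun hBo.measurableSet fun z hz => by
      have hev : ∀ᶠ w in 𝓝 z, DifferentiableAt ℂ F w := by
        filter_upwards [hBo.mem_nhds hz] with w hw using (hF w hw).differentiableAt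
      simp only [hθ', indicator_of_mem hz]
      rw [laplacian_comp_holomorphic (hψsm.contDiffAt.of_le two_le_infty) hev, hψ,
        laplacian_comp_re hksm, hkd, hFh z hz]
      push_cast
      ring
  rw [eL, eR, integral_neg] at green
  exact green

/-- The function `1 - exp (-h)` of a harmonic function `h` is superharmonic, and harmonic only
where `h` is constant. -/
theorem harmonic_one_sub_exp {h : ℂ → ℝ} {c : ℂ} {R r : ℝ}
    (hh : HarmonicOnNhd h (Metric.ball c R)) (hr : r < R) {θ : ℂ → ℂ}
    (hθ : ContDiffOn ℝ ∞ θ (Metric.ball c R))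
    (hθ0 : ∀ z ∈ Metric.ball c R, r < ‖z - c‖ → θ z = 0)
    (hθnn : ∀ z ∈ Metric.ball c R, 0 ≤ θ z) :
    (∫ z in Metric.ball c R, ((1 - Real.exp (-h z) : ℝ) : ℂ) * Laplacian.laplacian θ z).re ≤ 0 ∧
    ((∫ z in Metric.ball c R, ((1 - Real.exp (-h z) : ℝ) : ℂ) * Laplacian.laplacian θ z).re = 0 →
      ∀ ρ ≤ R, (∀ z ∈ Metric.ball c ρ, θ z ≠ 0) → ∀ z ∈ Metric.ball c ρ, h z = h c) := by
  obtain ⟨F, hF, hFh⟩ := hh.exists_analyticOnNhd_ball_re_eq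
  have hFh' : ∀ z ∈ Metric.ball c R, (F z).re = h z := fun z hz => hFh hz
  set B := Metric.ball c R with hB
  have hBo : IsOpen B := Metric.isOpen_ball
  set q : ℂ → ℝ := fun z => ‖deriv F z‖ ^ 2 * Real.exp (-h z) * (θ z).re with hq
  have e : ∫ z in B, ((‖deriv F z‖ ^ 2 * Real.exp (-h z) : ℝ) : ℂ) * θ z =
      ((∫ z in B, q z : ℝ) : ℂ) := by
    rw [← integral_complex_ofReal]
    refine setIntegral_congr_fun hBo.measurableSet fun z hz => ?_
    have h0 : θ z = ((θ z).re : ℂ) := by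
      have := (Complex.nonneg_iff.1 (hθnn z hz)).2
      exact Complex.ext rfl (by simp [← this])
    simp only [hq]
    rw [h0]
    push_cast
    simp
  have hqnn : ∀ z ∈ B, 0 ≤ q z := fun z hz =>
    mul_nonneg (by positivity) (Complex.nonneg_iff.1 (hθnn z hz)).1
  rw [integral_one_sub_exp_mul_laplacian hF hFh' hr hθ hθ0, e, ← Complex.ofReal_neg,
    Complex.ofReal_re]
  refine ⟨neg_nonpos.2 (setIntegral_nonneg hBo.measurableSet hqnn), fun h0 ρ hρ hne z hz => ?_⟩
  have hsub : Metric.ball c ρ ⊆ B := Metric.ball_subset_ball hρ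
  have hqc : ContinuousOn q B := by
    refine ContinuousOn.mul (ContinuousOn.mul ?_ ?_) ?_
    · exact ((hF.deriv).continuousOn.norm).pow 2
    · exact Real.continuous_exp.comp_continuousOn hh.continuousOn.neg
    · exact Complex.continuous_re.comp_continuousOn hθ.continuousOn
  have hqz : ∀ z ∈ B, r < ‖z - c‖ → q z = 0 := fun z hz hz' => by simp [hq, hθ0 z hz hz']
  have hqi : IntegrableOn q B := by
    have h1 : IntegrableOn q (Metric.closedBall c r) :=
      (hqc.mono (Metric.closedBall_subset_ball hr)).integrableOn_compact (isCompact_closedBall c r)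
    have h2 : IntegrableOn q (B \ Metric.closedBall c r) := by
      refine (integrableOn_zero (ε' := ℝ)).congr_fun (fun z hz => ?_)
        (hBo.measurableSet.diff Metric.isClosed_closedBall.measurableSet)
      exact (hqz z hz.1 (by simpa [dist_eq_norm] using hz.2)).symm
    refine (h1.union h2).mono_set fun z hz => ?_
    by_cases h : z ∈ Metric.closedBall c r
    · exact Or.inl h
    · exact Or.inr ⟨hz, h⟩
  -- if the integral vanishes, so does the integrand, hence the derivative of `F` where `θ` is
  -- positive
  have hae : q =ᵐ[volume.restrict B] 0 :=
    (setIntegral_eq_zero_iff_of_nonneg_ae (ae_restrict_of_forall_mem hBo.measurableSet hqnn)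
      hqi).1 (neg_eq_zero.1 h0)
  have hzero : ∀ z ∈ B, q z = 0 := fun z hz =>
    Measure.eqOn_open_of_ae_eq hae hBo hqc continuousOn_const hz
  have hd : ∀ z ∈ Metric.ball c ρ, deriv F z = 0 := fun z hz => by
    have h1 := hzero z (hsub hz)
    have h2 : (θ z).re ≠ 0 := fun h2 => hne z hz
      (Complex.ext h2 (Complex.nonneg_iff.1 (hθnn z (hsub hz))).2.symm)
    simpa [hq, h2, Real.exp_ne_zero] using h1
  have hρ0 : c ∈ Metric.ball c ρ := Metric.mem_ball_self (Metric.pos_of_mem_ball hz)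
  have hFc : F z = F c := by
    refine Metric.isOpen_ball.is_const_of_deriv_eq_zero (𝕜 := ℂ) (f := F)
      (convex_ball c ρ).isPreconnected ?_ (fun z hz => hd z hz) hz hρ0
    exact fun z hz => ((hF z (hsub hz)).differentiableAt).differentiableWithinAt
  rw [← hFh' z (hsub hz), ← hFh' c (hsub hρ0), hFc]

end Green

/-! ### Functions of `log ‖Z‖²`, for holomorphic `Z` -/

section LogNorm

theorem deriv_deriv_nonneg_of_isLocalMin {g : ℝ → ℝ} (hmin : IsLocalMin g 0)
    (hc : ContinuousAt g 0) : 0 ≤ deriv (deriv g) 0 := by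
  by_contra hneg
  have hmax := isLocalMax_of_deriv_deriv_neg (not_le.1 hneg) hmin.deriv_eq_zero hc
  have heq : g =ᶠ[𝓝 0] fun _ => g 0 := by
    filter_upwards [hmin, hmax] with x h1 h2 using le_antisymm h2 h1
  have h0 : deriv (deriv g) 0 = 0 := by
    rw [heq.deriv.deriv_eq]
    simp
  exact hneg h0.ge

/-- The second derivatives at a local minimum are nonnegative in the directions of both axes. -/
theorem laplacian_nonneg_of_isLocalMin {f : ℂ → ℂ} {v : ℂ → ℝ} {z : ℂ}
    (hfv : ∀ w, f w = v w) (hf : ContDiffAt ℝ 2 f z) (hmin : IsLocalMin v z) :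
    0 ≤ (Laplacian.laplacian f z).re := by
  have key : ∀ e : ℂ, 0 ≤ (fderiv ℝ (fun w => fderiv ℝ f w e) z e).re := by
    intro e
    -- restrict to the line through `z` in the direction `e`
    set line : ℝ → ℂ := fun x => z + x * e with hline
    have hl : ∀ x, HasDerivAt line e x := fun x => by
      convert! ((Complex.ofRealCLM.hasDerivAt (x := x)).mul_const e).const_add z using 1
      simp
    have hl0 : line 0 = z := by simp [hline]
    have hlc : Tendsto line (𝓝 0) (𝓝 z) := by
      have := (hl 0).continuousAt
      rwa [ContinuousAt, hl0] at this
    set g : ℝ → ℝ := fun x => v (line x) with hg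
    have hre : ∀ x, g x = (f (line x)).re := fun x => by simp [hg, hfv]
    have hd1 : deriv g =ᶠ[𝓝 0] fun x => (fderiv ℝ f (line x) e).re := by
      filter_upwards [hlc.eventually (hf.eventually (by simp))] with x hx
      have h1 := (hx.differentiableAt (by norm_num)).hasFDerivAt.comp_hasDerivAt x (hl x)
      have h2 := Complex.reCLM.hasFDerivAt.comp_hasDerivAt x h1
      have h3 : g = Complex.reCLM ∘ f ∘ line := funext hre
      rw [h3, h2.deriv]
      simp
    have hd2 : deriv (deriv g) 0 = (fderiv ℝ (fun w => fderiv ℝ f w e) z e).re := by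
      rw [hd1.deriv_eq]
      have hdd : DifferentiableAt ℝ (fun w => fderiv ℝ f w e) (line 0) := by
        rw [hl0]
        exact ((hf.fderiv_right (m := 1) (by norm_num)).differentiableAt (by norm_num)).clm_apply
          (differentiableAt_const e)
      have h1 := hdd.hasFDerivAt.comp_hasDerivAt 0 (hl 0)
      have h2 := Complex.reCLM.hasFDerivAt.comp_hasDerivAt 0 h1
      rw [hl0] at h2
      exact h2.deriv
    rw [← hd2]
    refine deriv_deriv_nonneg_of_isLocalMin ?_ ?_
    · have : IsLocalMin v (line 0) := by rwa [hl0]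
      exact this.comp_continuous ((hl 0).continuousAt)
    · have h1 : ContinuousAt f (line 0) := by
        rw [hl0]
        exact hf.continuousAt
      have h2 : ContinuousAt (fun x => (f (line x)).re) 0 :=
        Complex.continuous_re.continuousAt.comp (h1.comp (hl 0).continuousAt)
      exact h2.congr (Eventually.of_forall fun x => (hre x).symm)
  rw [laplacian_eq_fderiv hf, Complex.add_re]
  exact add_nonneg (key 1) (key Complex.I)

variable {E : Type*} [NormedAddCommGroup E] [InnerProductSpace ℂ E] [CompleteSpace E]

/-- The function `g (log ‖Z‖²)` of a holomorphic map `Z` without zero is subharmonic where `g` is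
convex, if `g` is nondecreasing: it is bounded from below by a function `g (log |l ∘ Z|²)`, with a
linear form `l` of norm one, and both agree at the given point. -/
theorem laplacian_comp_log_norm_nonneg {Z : ℂ → E} {z : ℂ} (hZ : AnalyticAt ℂ Z z)
    (hZ0 : Z z ≠ 0) {g : ℝ → ℝ} (hg : ContDiff ℝ ∞ g) (hmono : Monotone g)
    (hconv : 0 ≤ deriv (deriv g) (Real.log (‖Z z‖ ^ 2))) :
    0 ≤ (Laplacian.laplacian (fun w => (g (Real.log (‖Z w‖ ^ 2)) : ℂ)) z).re := by
  let _ : InnerProductSpace ℝ E := InnerProductSpace.rclikeToReal ℂ E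
  have hn : 0 < ‖Z z‖ := norm_pos_iff.2 hZ0
  -- the component of `Z` in the direction of `Z z`, a holomorphic function
  set p : ℂ → ℂ := fun w => inner ℂ (Z z) (Z w) / (‖Z z‖ : ℂ) with hp
  have hpz : p z = (‖Z z‖ : ℂ) := by
    simp only [hp, inner_self_eq_norm_sq_to_K]
    field_simp
    simp
  have hpa : AnalyticAt ℂ p z :=
    (((innerSL ℂ (Z z)).analyticAt _).comp hZ).div analyticAt_const (by simpa using hZ0)
  have hpsl : p z ∈ Complex.slitPlane := by
    rw [hpz]
    exact Complex.ofReal_mem_slitPlane.2 hn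
  -- `log |p|²` is the real part of the holomorphic function `2 log p`
  set F : ℂ → ℂ := fun w => 2 * Complex.log (p w) with hF
  have hFa : AnalyticAt ℂ F z := analyticAt_const.mul (hpa.clog hpsl)
  have hFre : ∀ w, p w ≠ 0 → (F w).re = Real.log (‖p w‖ ^ 2) := by
    intro w hw
    simp [hF, Complex.log_re]
  have hple : ∀ w, ‖p w‖ ≤ ‖Z w‖ := by
    intro w
    simp only [hp, norm_div, Complex.norm_real, norm_norm]
    rw [div_le_iff₀ hn, mul_comm]
    exact norm_inner_le_norm _ _
  have hpne : ∀ᶠ w in 𝓝 z, p w ≠ 0 := hpa.continuousAt.eventually_ne (by simp [hpz, hZ0])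
  have hpzn : p z ≠ 0 := hpne.self_of_nhds
  set v₁ : ℂ → ℝ := fun w => g (Real.log (‖Z w‖ ^ 2)) with hv₁
  set v₂ : ℂ → ℝ := fun w => g (F w).re with hv₂
  have hval : (F z).re = Real.log (‖Z z‖ ^ 2) := by
    rw [hFre z hpzn, hpz]
    simp
  have hmin : IsLocalMin (fun w => v₁ w - v₂ w) z := by
    filter_upwards [hpne] with w hw
    simp only [hv₁, hv₂, hval, sub_self, sub_nonneg]
    refine hmono ?_
    rw [hFre w hw]
    have : 0 < ‖p w‖ := norm_pos_iff.2 hw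
    exact Real.log_le_log (by positivity) (by gcongr; exact hple w)
  have hZr : ContDiffAt ℝ 2 Z z := (hZ.contDiffAt (n := 2)).restrict_scalars ℝ
  have hs1 : ContDiffAt ℝ 2 (fun w => (v₁ w : ℂ)) z := by
    refine Complex.ofRealCLM.contDiff.contDiffAt.comp z ?_
    refine (hg.contDiffAt.of_le two_le_infty).comp z ?_
    exact (hZr.norm_sq ℝ).log (by positivity)
  have hs2 : ContDiffAt ℝ 2 (fun w => (v₂ w : ℂ)) z := by
    refine Complex.ofRealCLM.contDiff.contDiffAt.comp z ?_
    refine (hg.contDiffAt.of_le two_le_infty).comp z ?_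
    exact Complex.reCLM.contDiff.contDiffAt.comp z
      ((hFa.contDiffAt (n := 2)).restrict_scalars ℝ)
  have h0 := laplacian_nonneg_of_isLocalMin (f := fun w => (v₁ w : ℂ) - v₂ w)
    (v := fun w => v₁ w - v₂ w) (fun w => by push_cast; rfl) (hs1.sub hs2) hmin
  have hsub : Laplacian.laplacian (fun w => (v₁ w : ℂ) - v₂ w) z =
      Laplacian.laplacian (fun w => (v₁ w : ℂ)) z - Laplacian.laplacian (fun w => (v₂ w : ℂ)) z :=
    hs1.laplacian_sub hs2
  have hψ : ContDiff ℝ ∞ fun ζ : ℂ => (g ζ.re : ℂ) :=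
    Complex.ofRealCLM.contDiff.comp (hg.comp Complex.reCLM.contDiff)
  -- the function composed with `Re F` has Laplacian `‖deriv F‖² (deriv (deriv g) ∘ Re F)`
  have hl2 : Laplacian.laplacian (fun w => (v₂ w : ℂ)) z =
      ((‖deriv F z‖ ^ 2 : ℝ) : ℂ) * ((deriv (deriv g) (F z).re : ℝ) : ℂ) := by
    rw [← laplacian_comp_re hg]
    exact laplacian_comp_holomorphic (g := fun ζ : ℂ => (g ζ.re : ℂ)) (τ := F)
      (hψ.contDiffAt.of_le two_le_infty)
      (by filter_upwards [hFa.eventually_analyticAt] with w hw using hw.differentiableAt)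
  rw [hsub, hl2, hval, ← Complex.ofReal_mul, Complex.sub_re, Complex.ofReal_re] at h0
  have := mul_nonneg (sq_nonneg ‖deriv F z‖) hconv
  linarith

end LogNorm

/-! ### Convex cutoff functions of a logarithmic variable -/

section Cutoff

/-- The slope of the cutoff function `logCutoff`: it is `1` on `[-(n - 1), -2]`, vanishes outside
`[-n, -1]`, and is nondecreasing on `(-∞, -2]`. -/
noncomputable def logSlope (n : ℕ) (s : ℝ) : ℝ :=
  Real.smoothTransition (s + n) * Real.smoothTransition (-1 - s)

/-- A smooth function close to `max (s, -n)` on the negative half-line, constant near `-∞` and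
zero for `s ≥ -1`.  It is nondecreasing, and it is convex on `(-∞, -2]`. -/
noncomputable def logCutoff (n : ℕ) (s : ℝ) : ℝ := ∫ x in (0 : ℝ)..s, logSlope n x

variable (n : ℕ) {s : ℝ}

theorem contDiff_logSlope : ContDiff ℝ ∞ (logSlope n) :=
  ((Real.smoothTransition.contDiff (n := (⊤ : ℕ∞))).comp (by fun_prop)).mul
    ((Real.smoothTransition.contDiff (n := (⊤ : ℕ∞))).comp (by fun_prop))

theorem logSlope_nonneg : 0 ≤ logSlope n s :=
  mul_nonneg (Real.smoothTransition.nonneg _) (Real.smoothTransition.nonneg _)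

theorem logSlope_le_one : logSlope n s ≤ 1 :=
  mul_le_one₀ (Real.smoothTransition.le_one _) (Real.smoothTransition.nonneg _)
    (Real.smoothTransition.le_one _)

theorem logSlope_eq_zero_of_ge (hs : -1 ≤ s) : logSlope n s = 0 := by
  rw [logSlope, Real.smoothTransition.zero_of_nonpos (x := -1 - s) (by linarith), mul_zero]

theorem logSlope_eq_zero_of_le (hs : s ≤ -n) : logSlope n s = 0 := by
  rw [logSlope, Real.smoothTransition.zero_of_nonpos (x := s + n) (by linarith), zero_mul]

theorem logSlope_eq_one (h1 : 1 - n ≤ s) (h2 : s ≤ -2) : logSlope n s = 1 := by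
  rw [logSlope, Real.smoothTransition.one_of_one_le (by linarith),
    Real.smoothTransition.one_of_one_le (by linarith), mul_one]

theorem logSlope_congr {m : ℕ} (h1 : 1 - n ≤ s) (h2 : 1 - m ≤ s) : logSlope n s = logSlope m s := by
  rw [logSlope, logSlope, Real.smoothTransition.one_of_one_le (x := s + n) (by linarith),
    Real.smoothTransition.one_of_one_le (x := s + m) (by linarith)]

theorem hasDerivAt_logCutoff (s : ℝ) : HasDerivAt (logCutoff n) (logSlope n s) s :=
  intervalIntegral.integral_hasDerivAt_right
    ((contDiff_logSlope n).continuous.intervalIntegrable _ _)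
    ((contDiff_logSlope n).continuous.stronglyMeasurableAtFilter _ _)
    (contDiff_logSlope n).continuous.continuousAt

theorem deriv_logCutoff : deriv (logCutoff n) = logSlope n :=
  funext fun s => (hasDerivAt_logCutoff n s).deriv

theorem contDiff_logCutoff : ContDiff ℝ ∞ (logCutoff n) := by
  rw [contDiff_infty_iff_deriv, deriv_logCutoff]
  exact ⟨fun s => (hasDerivAt_logCutoff n s).differentiableAt, contDiff_logSlope n⟩

theorem monotone_logCutoff : Monotone (logCutoff n) :=
  monotone_of_deriv_nonneg (fun s => (hasDerivAt_logCutoff n s).differentiableAt) fun s => by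
    rw [deriv_logCutoff]
    exact logSlope_nonneg n

theorem logCutoff_eq_zero (hs : -1 ≤ s) : logCutoff n s = 0 := by
  rw [logCutoff, intervalIntegral.integral_congr (g := fun _ => 0)]
  · simp
  · intro x hx
    refine logSlope_eq_zero_of_ge n ?_
    have := hx.1
    rcases le_total 0 s with h | h
    · rw [inf_eq_left.2 h] at this
      linarith
    · rw [inf_eq_right.2 h] at this
      linarith

theorem logCutoff_eq_of_le (hs : s ≤ -n) : logCutoff n s = logCutoff n (-n) := by
  have h := intervalIntegral.integral_add_adjacent_intervals
    ((contDiff_logSlope n).continuous.intervalIntegrable (μ := volume) 0 (-n))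
    ((contDiff_logSlope n).continuous.intervalIntegrable (μ := volume) (-n) s)
  have h0 : ∫ x in (-n : ℝ)..s, logSlope n x = 0 := by
    rw [intervalIntegral.integral_congr (g := fun _ => 0)]
    · simp
    · intro x hx
      rw [uIcc_of_ge hs] at hx
      exact logSlope_eq_zero_of_le n hx.2
  rw [logCutoff, logCutoff, ← h, h0, add_zero]

theorem le_logCutoff (hs : s ≤ 0) : s ≤ logCutoff n s := by
  have h : ∫ x in s..0, logSlope n x ≤ ∫ x in s..0, (1 : ℝ) :=
    intervalIntegral.integral_mono_on hs ((contDiff_logSlope n).continuous.intervalIntegrable _ _)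
      (by simp) fun x _ => logSlope_le_one n
  rw [logCutoff, intervalIntegral.integral_symm]
  simp at h
  linarith

theorem logCutoff_neg_le (hn : 3 ≤ n) : logCutoff n (-n) ≤ 3 - n := by
  have hn' : (3 : ℝ) ≤ n := by exact_mod_cast hn
  have hc := (contDiff_logSlope n).continuous
  have h1 : ∫ x in (1 - n : ℝ)..(-2), (1 : ℝ) ≤ ∫ x in (1 - n : ℝ)..(-2), logSlope n x :=
    intervalIntegral.integral_mono_on (by linarith) (by simp) (hc.intervalIntegrable _ _)
      fun x hx => (logSlope_eq_one n hx.1 hx.2).ge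
  have h2 : ∫ x in (1 - n : ℝ)..(-2), logSlope n x = logCutoff n (-2) - logCutoff n (1 - n) :=
    (intervalIntegral.integral_interval_sub_left (hc.intervalIntegrable _ _)
      (hc.intervalIntegrable _ _)).symm
  have h3 : logCutoff n (-n) ≤ logCutoff n (1 - n) := monotone_logCutoff n (by linarith)
  have h4 : logCutoff n (-2) ≤ 0 := by
    rw [← logCutoff_eq_zero n (s := -1) le_rfl]
    exact monotone_logCutoff n (by norm_num)
  rw [intervalIntegral.integral_const, smul_eq_mul, mul_one] at h1
  linarith

/-- Two of the functions agree where both have not yet become constant. -/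
theorem logCutoff_congr {m : ℕ} (h1 : 1 - n ≤ s) (h2 : 1 - m ≤ s) (hn : 1 ≤ n) (hm : 1 ≤ m) :
    logCutoff n s = logCutoff m s := by
  rw [logCutoff, logCutoff]
  refine intervalIntegral.integral_congr fun x hx => ?_
  have hn' : (1 : ℝ) ≤ n := by exact_mod_cast hn
  have hm' : (1 : ℝ) ≤ m := by exact_mod_cast hm
  have := hx.1
  rcases le_total 0 s with h | h
  · rw [inf_eq_left.2 h] at this
    exact logSlope_congr n (by linarith) (by linarith)
  · rw [inf_eq_right.2 h] at this
    exact logSlope_congr n (by linarith) (by linarith)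

theorem deriv_deriv_logCutoff_nonneg (hs : s < -2) : 0 ≤ deriv (deriv (logCutoff n)) s := by
  rw [deriv_logCutoff]
  have : logSlope n =ᶠ[𝓝 s] fun x => Real.smoothTransition (x + n) := by
    filter_upwards [isOpen_Iio.mem_nhds hs] with x hx
    have hx : x < -2 := hx
    rw [logSlope, Real.smoothTransition.one_of_one_le (x := -1 - x) (by linarith), mul_one]
  rw [this.deriv_eq]
  exact Monotone.deriv_nonneg fun a b hab => Real.smoothTransition.monotone (by linarith)

end Cutoff

/-! ### Changes of flow boxes, test functions and test forms -/

namespace FlowBox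

variable {Y : Type u} [TopologicalSpace Y]

/-- The first component of the change of coordinates from `φ` to `ψ`, on the plaque of
parameter `t`. -/
noncomputable def trans (φ ψ : FlowBox Y) (t : φ.T) (z : ℂ) : ℂ := (ψ.chart (φ.chart.symm (z, t))).1

theorem transDeriv_eq (φ ψ : FlowBox Y) (p : Y) :
    φ.transDeriv ψ p = deriv (φ.trans ψ (φ.chart p).2) (φ.chart p).1 := rfl

theorem mem_target_iff {φ : FlowBox Y} {q : ℂ × φ.T} : q ∈ φ.chart.target ↔ q.1 ∈ φ.base := by
  rw [φ.target_eq]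
  simp

variable {φ ψ : FlowBox Y} {p : Y}

theorem eventually_mem (hpφ : p ∈ φ.chart.source) {U : Set Y} (hU : U ∈ 𝓝 p) :
    ∀ᶠ q in 𝓝 (φ.chart p), q ∈ φ.chart.target ∧ φ.chart.symm q ∈ U := by
  refine Filter.Eventually.and (φ.chart.open_target.mem_nhds (φ.chart.map_source hpφ)) ?_
  have h := φ.chart.continuousAt_symm (φ.chart.map_source hpφ)
  rw [ContinuousAt, φ.chart.left_inv hpφ] at h
  exact h hU

theorem slice_chart (f : Y → ℂ) (hp : p ∈ φ.chart.source) :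
    φ.slice f (φ.chart p).2 (φ.chart p).1 = f p := by
  simp [slice, φ.chart.left_inv hp]

theorem Compatible.continuousAt_change (hpφ : p ∈ φ.chart.source) (hpψ : p ∈ ψ.chart.source) :
    ContinuousAt (fun q : ℂ × φ.T => ψ.chart (φ.chart.symm q)) (φ.chart p) := by
  refine ContinuousAt.comp ?_ (φ.chart.continuousAt_symm (φ.chart.map_source hpφ))
  rw [φ.chart.left_inv hpφ]
  exact ψ.chart.continuousAt hpψ

theorem Compatible.eventually_param (h : φ.Compatible ψ) (hpφ : p ∈ φ.chart.source)
    (hpψ : p ∈ ψ.chart.source) : ∀ᶠ q in 𝓝 (φ.chart p), ∀ᶠ z in 𝓝 q.1,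
      (ψ.chart (φ.chart.symm (z, q.2))).2 = (ψ.chart (φ.chart.symm q)).2 := by
  filter_upwards [eventually_mem hpφ (ψ.chart.open_source.mem_nhds hpψ)] with q hq
  have := (h (φ.chart.symm q) ⟨φ.chart.map_target hq.1, hq.2⟩).1
  rwa [φ.chart.right_inv hq.1] at this

theorem Compatible.holFamilyAt (h : φ.Compatible ψ) (hpφ : p ∈ φ.chart.source)
    (hpψ : p ∈ ψ.chart.source) : HolFamilyAt (φ.trans ψ) (φ.chart p) := by
  filter_upwards [eventually_mem hpφ (ψ.chart.open_source.mem_nhds hpψ)] with q hq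
  have hs := φ.chart.map_target hq.1
  have h1 := Compatible.continuousAt_change hs hq.2
  have h2 := (h (φ.chart.symm q) ⟨hs, hq.2⟩).2
  rw [φ.chart.right_inv hq.1] at h1 h2
  exact ⟨continuousAt_fst.comp h1, h2⟩

/-- Smoothness along the leaves does not depend on the flow box. -/
theorem Compatible.familyAt_slice (h : φ.Compatible ψ) (hpφ : p ∈ φ.chart.source)
    (hpψ : p ∈ ψ.chart.source) {f : Y → ℂ} (hf : FamilyAt (ψ.slice f) (ψ.chart p)) :
    FamilyAt (φ.slice f) (φ.chart p) := by
  have hτ := (h.holFamilyAt hpφ hpψ).familyAt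
  have hc := Compatible.continuousAt_change hpφ hpψ
  have hcomp := hτ.comp (H := ψ.slice f) (l := fun q => (ψ.chart (φ.chart.symm q)).2)
    (by simpa [trans, φ.chart.left_inv hpφ] using hf) (continuousAt_snd.comp hc)
    (h.eventually_param hpφ hpψ)
  refine hcomp.congr ?_
  filter_upwards [eventually_mem hpφ (ψ.chart.open_source.mem_nhds hpψ)] with q hq
  simp only [slice, trans]
  rw [ψ.chart.left_inv hq.2]

/-- The chain rule for changes of coordinates. -/
theorem transDeriv_mul {χ : FlowBox Y} (h : φ.Compatible ψ) (h' : ψ.Compatible χ)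
    (hpφ : p ∈ φ.chart.source) (hpψ : p ∈ ψ.chart.source) (hpχ : p ∈ χ.chart.source) :
    φ.transDeriv χ p = φ.transDeriv ψ p * ψ.transDeriv χ p := by
  have h1 := (h p ⟨hpφ, hpψ⟩).2
  have h2 := (h' p ⟨hpψ, hpχ⟩).2
  have e0 : φ.trans ψ (φ.chart p).2 (φ.chart p).1 = (ψ.chart p).1 := by
    simp [trans, φ.chart.left_inv hpφ]
  have hline : Tendsto (fun z : ℂ => (z, (φ.chart p).2)) (𝓝 (φ.chart p).1) (𝓝 (φ.chart p)) :=
    (Continuous.tendsto (by fun_prop : Continuous fun z : ℂ => (z, (φ.chart p).2)) _)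
  have ev : φ.trans χ (φ.chart p).2 =ᶠ[𝓝 (φ.chart p).1]
      ψ.trans χ (ψ.chart p).2 ∘ φ.trans ψ (φ.chart p).2 := by
    filter_upwards [hline.eventually (eventually_mem hpφ (ψ.chart.open_source.mem_nhds hpψ)),
      (h p ⟨hpφ, hpψ⟩).1] with z hz hz2
    have : (φ.trans ψ (φ.chart p).2 z, (ψ.chart p).2) =
        ψ.chart (φ.chart.symm (z, (φ.chart p).2)) := Prod.ext rfl hz2.symm
    simp only [Function.comp_apply, trans] at this ⊢
    rw [this, ψ.chart.left_inv hz.2]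
  rw [transDeriv_eq, ev.deriv_eq, deriv_comp (h₂ := ψ.trans χ (ψ.chart p).2)]
  · rw [e0, transDeriv_eq, transDeriv_eq, mul_comm]
  · rw [e0]
    exact h2
  · exact h1

end FlowBox

namespace RiemannSurfaceLamination

variable {Y : Type u} [TopologicalSpace Y] {lam : RiemannSurfaceLamination Y}

theorem leafSmooth_iff {φ : FlowBox Y} {f : Y → ℂ} :
    φ.LeafSmooth f ↔ ∀ p ∈ φ.chart.source, FamilyAt (φ.slice f) (φ.chart p) := by
  rw [FlowBox.LeafSmooth, smoothFamily_iff φ.isOpen_base, ← φ.target_eq]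
  refine ⟨fun h p hp => h _ (φ.chart.map_source hp), fun h q hq => ?_⟩
  have := h _ (φ.chart.map_target hq)
  rwa [φ.chart.right_inv hq] at this

theorem IsTestFunction.familyAt {f : Y → ℂ} (hf : lam.IsTestFunction f) {φ : FlowBox Y}
    (hφ : φ ∈ lam.atlas) {p : Y} (hp : p ∈ φ.chart.source) :
    FamilyAt (φ.slice f) (φ.chart p) :=
  leafSmooth_iff.1 (hf.2 φ hφ) p hp

theorem leafSmooth_of_local {f : Y → ℂ} (h : ∀ p, ∃ φ ∈ lam.atlas, p ∈ φ.chart.source ∧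
    FamilyAt (φ.slice f) (φ.chart p)) : ∀ φ ∈ lam.atlas, φ.LeafSmooth f := by
  intro φ hφ
  rw [leafSmooth_iff]
  intro p hp
  obtain ⟨ψ, hψ, hpψ, hf⟩ := h p
  exact (lam.compatible φ hφ ψ hψ).familyAt_slice hp hpψ hf

theorem familyAt_slice_zero {f : Y → ℂ} {φ : FlowBox Y} {p : Y} (hp : p ∈ φ.chart.source)
    (hf : f =ᶠ[𝓝 p] 0) : FamilyAt (φ.slice f) (φ.chart p) := by
  refine (FamilyAt.const (0 : ℂ)).congr ?_
  filter_upwards [FlowBox.eventually_mem hp hf] with q hq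
  exact hq.2

theorem IsTestFunction.mul_of_leafSmooth {f g : Y → ℂ} (hf : lam.IsTestFunction f)
    (hg : ∀ p ∈ tsupport f, ∀ φ ∈ lam.atlas, p ∈ φ.chart.source →
      FamilyAt (φ.slice g) (φ.chart p)) : lam.IsTestFunction fun p => f p * g p := by
  refine ⟨hf.1.mul_right, leafSmooth_of_local fun p => ?_⟩
  obtain ⟨φ, hφ, hp⟩ := lam.cover p
  refine ⟨φ, hφ, hp, ?_⟩
  by_cases hpf : p ∈ tsupport f
  · exact (hf.familyAt hφ hp).mul (hg p hpf φ hφ hp)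
  · refine familyAt_slice_zero hp ?_
    filter_upwards [notMem_tsupport_iff_eventuallyEq.1 hpf] with q hq
    simp [hq]

theorem IsTestFunction.add {f g : Y → ℂ} (hf : lam.IsTestFunction f) (hg : lam.IsTestFunction g) :
    lam.IsTestFunction fun p => f p + g p :=
  ⟨hf.1.add hg.1, fun _ hφ => leafSmooth_iff.2 fun _ hp =>
    (hf.familyAt hφ hp).add (hg.familyAt hφ hp)⟩

theorem IsTestFunction.const_mul {f : Y → ℂ} (hf : lam.IsTestFunction f) (c : ℂ) :
    lam.IsTestFunction fun p => c * f p :=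
  ⟨hf.1.mul_left, fun φ hφ => (hf.2 φ hφ).const_mul φ.isOpen_base c⟩

/-! ### Functions in product form in a flow box -/

/-- The function `u (z) k (t)` in the coordinates of a flow box, extended by zero. -/
noncomputable def boxFun (φ : FlowBox Y) (u : ℂ → ℂ) (k : φ.T → ℂ) : Y → ℂ :=
  φ.chart.source.indicator fun p => u (φ.chart p).1 * k (φ.chart p).2

variable {φ : FlowBox Y} {u : ℂ → ℂ} {k : φ.T → ℂ}

theorem boxFun_apply {p : Y} (hp : p ∈ φ.chart.source) :
    boxFun φ u k p = u (φ.chart p).1 * k (φ.chart p).2 := indicator_of_mem hp _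

/-- The compact set `A × C` of a flow box. -/
def boxSet (φ : FlowBox Y) (A : Set ℂ) (C : Set φ.T) : Set Y :=
  {p | p ∈ φ.chart.source ∧ (φ.chart p).1 ∈ A ∧ (φ.chart p).2 ∈ C}

theorem boxSet_eq_image {A : Set ℂ} (hA : A ⊆ φ.base) (C : Set φ.T) :
    boxSet φ A C = φ.chart.symm '' (A ×ˢ C) := by
  ext p
  constructor
  · rintro ⟨hp, h1, h2⟩
    exact ⟨φ.chart p, ⟨h1, h2⟩, φ.chart.left_inv hp⟩
  · rintro ⟨q, ⟨h1, h2⟩, rfl⟩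
    have hq : q ∈ φ.chart.target := FlowBox.mem_target_iff.2 (hA h1)
    refine ⟨φ.chart.map_target hq, ?_, ?_⟩
    · rwa [φ.chart.right_inv hq]
    · rwa [φ.chart.right_inv hq]

theorem isCompact_boxSet {A : Set ℂ} (hA : A ⊆ φ.base) (hAc : IsCompact A) {C : Set φ.T}
    (hC : IsCompact C) : IsCompact (boxSet φ A C) := by
  rw [boxSet_eq_image hA]
  refine (hAc.prod hC).image_of_continuousOn (φ.chart.continuousOn_symm.mono ?_)
  exact fun q hq => FlowBox.mem_target_iff.2 (hA hq.1)

theorem isOpen_boxSet {A : Set ℂ} (hA : IsOpen A) {C : Set φ.T} (hC : IsOpen C) :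
    IsOpen (boxSet φ A C) :=
  φ.chart.isOpen_inter_preimage (hA.prod hC)

theorem boxFun_eq_zero {p : Y} (hp : p ∉ boxSet φ (tsupport u) (tsupport k)) :
    boxFun φ u k p = 0 := by
  by_cases hs : p ∈ φ.chart.source
  · rw [boxFun_apply hs]
    by_contra hne
    exact hp ⟨hs, subset_tsupport u fun h => hne (by simp [h]),
      subset_tsupport k fun h => hne (by simp [h])⟩
  · exact indicator_of_notMem hs _

theorem hasCompactSupport_boxFun [T2Space Y] (hu : HasCompactSupport u)
    (hub : tsupport u ⊆ φ.base) (hk : HasCompactSupport k) :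
    HasCompactSupport (boxFun φ u k) :=
  HasCompactSupport.intro (isCompact_boxSet hub hu hk) fun _ hp => boxFun_eq_zero hp

theorem tsupport_boxFun [T2Space Y] (hu : HasCompactSupport u)
    (hub : tsupport u ⊆ φ.base) (hk : HasCompactSupport k) :
    tsupport (boxFun φ u k) ⊆ boxSet φ (tsupport u) (tsupport k) :=
  closure_minimal (fun _ hp => by_contra fun h => hp (boxFun_eq_zero h))
    (isCompact_boxSet hub hu hk).isClosed

theorem familyAt_boxFun (hu : ContDiff ℝ ∞ u) (hk : Continuous k) {p : Y}
    (hp : p ∈ φ.chart.source) : FamilyAt (φ.slice (boxFun φ u k)) (φ.chart p) := by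
  refine ((FamilyAt.of_contDiff hu).mul (FamilyAt.of_param hk.continuousAt)).congr ?_
  filter_upwards [φ.chart.open_target.mem_nhds (φ.chart.map_source hp)] with q hq
  simp only [FlowBox.slice, boxFun_apply (φ.chart.map_target hq), φ.chart.right_inv hq]

theorem isTestFunction_boxFun [T2Space Y] (hφ : φ ∈ lam.atlas) (hu : ContDiff ℝ ∞ u)
    (huc : HasCompactSupport u) (hub : tsupport u ⊆ φ.base) (hk : Continuous k)
    (hkc : HasCompactSupport k) : lam.IsTestFunction (boxFun φ u k) := by
  refine ⟨hasCompactSupport_boxFun huc hub hkc, leafSmooth_of_local fun p => ?_⟩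
  by_cases hp : p ∈ φ.chart.source
  · exact ⟨φ, hφ, hp, familyAt_boxFun hu hk hp⟩
  · obtain ⟨ψ, hψ, hpψ⟩ := lam.cover p
    refine ⟨ψ, hψ, hpψ, familyAt_slice_zero hpψ ?_⟩
    exact notMem_tsupport_iff_eventuallyEq.1 fun h => hp (tsupport_boxFun huc hub hkc h).1

theorem ddbarCoeff_boxFun (hφ : φ ∈ lam.atlas) (hu : ContDiff ℝ ∞ u) {p : Y}
    (hp : p ∈ φ.chart.source) : lam.ddbarCoeff (boxFun φ u k) ⟨φ, hφ⟩ p =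
      1 / 2 * (Laplacian.laplacian u (φ.chart p).1 * k (φ.chart p).2) := by
  have hz := base_mem hp
  have hev : φ.slice (boxFun φ u k) (φ.chart p).2 =ᶠ[𝓝 (φ.chart p).1]
      k (φ.chart p).2 • u := by
    filter_upwards [φ.isOpen_base.mem_nhds hz] with z hz
    have hq : (z, (φ.chart p).2) ∈ φ.chart.target := FlowBox.mem_target_iff.2 hz
    simp only [FlowBox.slice, boxFun_apply (φ.chart.map_target hq), φ.chart.right_inv hq,
      Pi.smul_apply, smul_eq_mul]
    ring
  simp only [ddbarCoeff, indicator_of_mem hp]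
  rw [(InnerProductSpace.laplacian_congr_nhds hev).eq_of_nhds,
    InnerProductSpace.laplacian_smul _ (hu.contDiffAt.of_le two_le_infty), smul_eq_mul]
  ring

/-! ### Test forms supported in a flow box -/

open Classical in
/-- The form `F · (i/2) dz ∧ dz̄` in the coordinate of the flow box `φ`, extended by zero. -/
noncomputable def boxForm (lam : RiemannSurfaceLamination Y) (φ : FlowBox Y) (F : Y → ℂ) :
    lam.atlas → Y → ℂ :=
  fun ψ p => if p ∈ ψ.1.chart.source ∩ φ.chart.source then
    ((‖ψ.1.transDeriv φ p‖ ^ 2 : ℝ) : ℂ) * F p else 0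

theorem isTestForm_boxForm (hφ : φ ∈ lam.atlas) {F : Y → ℂ} (hF : lam.IsTestFunction F)
    (hFs : tsupport F ⊆ φ.chart.source) : lam.IsTestForm (lam.boxForm φ F) := by
  refine ⟨fun ψ p hp => if_neg fun h => hp h.1, fun ψ χ p hp => ?_, fun ψ => ?_,
    ⟨tsupport F, hF.1, fun ψ p hp => ?_⟩⟩
  · by_cases hpφ : p ∈ φ.chart.source
    · rw [boxForm, if_pos ⟨hp.1, hpφ⟩, boxForm, if_pos ⟨hp.2, hpφ⟩,
        FlowBox.transDeriv_mul (lam.compatible _ ψ.2 _ χ.2) (lam.compatible _ χ.2 _ hφ) hp.1 hp.2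
          hpφ]
      rw [norm_mul, mul_pow]
      push_cast
      ring
    · rw [boxForm, if_neg fun h => hpφ h.2, boxForm, if_neg fun h => hpφ h.2, mul_zero]
  · rw [leafSmooth_iff]
    intro p hp
    by_cases hpφ : p ∈ φ.chart.source
    · have h1 := ((lam.compatible _ ψ.2 _ hφ).holFamilyAt hp hpφ).deriv.familyAt
      have hsq : ContDiff ℝ ∞ fun z : ℂ => ((‖z‖ ^ 2 : ℝ) : ℂ) :=
        Complex.ofRealCLM.contDiff.comp (contDiff_norm_sq ℝ)
      refine ((h1.comp_contDiff hsq).mul (hF.familyAt ψ.2 hp)).congr ?_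
      filter_upwards [FlowBox.eventually_mem hp (φ.chart.open_source.mem_nhds hpφ)] with q hq
      simp only [FlowBox.slice, boxForm]
      rw [if_pos ⟨ψ.1.chart.map_target hq.1, hq.2⟩, FlowBox.transDeriv_eq,
        ψ.1.chart.right_inv hq.1]
    · refine familyAt_slice_zero hp ?_
      have : p ∉ tsupport F := fun h => hpφ (hFs h)
      filter_upwards [notMem_tsupport_iff_eventuallyEq.1 this] with q hq
      simp [boxForm, hq]
  · simp [boxForm, image_eq_zero_of_notMem_tsupport hp]

/-! ### Densities with respect to an area form -/

/-- A continuous positive `(1,1)`-form along the leaves, given by its coefficients. -/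
structure IsAreaForm (lam : RiemannSurfaceLamination Y) (a : FlowBox Y → Y → ℝ) : Prop where
  pos : ∀ φ ∈ lam.atlas, ∀ p ∈ φ.chart.source, 0 < a φ p
  continuousOn : ∀ φ ∈ lam.atlas, ContinuousOn (a φ) φ.chart.source
  transform : ∀ φ ∈ lam.atlas, ∀ ψ ∈ lam.atlas, ∀ p ∈ φ.chart.source ∩ ψ.chart.source,
    a φ p = ‖φ.transDeriv ψ p‖ ^ 2 * a ψ p

/-- The quotient of a form by an area form. -/
noncomputable def dens (lam : RiemannSurfaceLamination Y) (a : FlowBox Y → Y → ℝ)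
    (α : lam.atlas → Y → ℂ) (p : Y) : ℂ :=
  α ⟨(lam.cover p).choose, (lam.cover p).choose_spec.1⟩ p / (a (lam.cover p).choose p : ℂ)

variable {a : FlowBox Y → Y → ℝ} {α : lam.atlas → Y → ℂ}

theorem dens_eq (ha : lam.IsAreaForm a) (hα : lam.IsTestForm α) (φ : lam.atlas) {p : Y}
    (hp : p ∈ φ.1.chart.source) : lam.dens a α p = α φ p / (a φ.1 p : ℂ) := by
  have hc := (lam.cover p).choose_spec
  set ψ : lam.atlas := ⟨(lam.cover p).choose, hc.1⟩ with hψ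
  have h1 := ha.transform φ.1 φ.2 ψ.1 ψ.2 p ⟨hp, hc.2⟩
  have h2 := hα.transform φ ψ p ⟨hp, hc.2⟩
  have hpos := ha.pos φ.1 φ.2 p hp
  have hne : (‖φ.1.transDeriv ψ.1 p‖ ^ 2 : ℝ) ≠ 0 := fun h => by
    rw [h, zero_mul] at h1
    exact hpos.ne' h1
  rw [h1, h2, Complex.ofReal_mul, mul_div_mul_left _ _ (Complex.ofReal_ne_zero.2 hne)]
  rfl

theorem dens_eq_zero {K : Set Y} (h : ∀ φ : lam.atlas, ∀ p ∉ K, α φ p = 0) {p : Y} (hp : p ∉ K) :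
    lam.dens a α p = 0 := by
  rw [dens, h _ p hp, zero_div]

theorem IsTestForm.continuousAt (hα : lam.IsTestForm α) (φ : lam.atlas) {p : Y}
    (hp : p ∈ φ.1.chart.source) : ContinuousAt (α φ) p := by
  have h1 := (leafSmooth_iff.1 (hα.smooth φ) p hp).continuousAt
  have h2 := ContinuousAt.comp (f := φ.1.chart) (x := p) h1 (φ.1.chart.continuousAt hp)
  refine h2.congr ?_
  filter_upwards [φ.1.chart.open_source.mem_nhds hp] with q hq
  exact FlowBox.slice_chart _ hq

theorem continuous_dens (ha : lam.IsAreaForm a) (hα : lam.IsTestForm α) :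
    Continuous (lam.dens a α) := by
  rw [continuous_iff_continuousAt]
  intro p
  obtain ⟨φ, hφ, hp⟩ := lam.cover p
  have hs := φ.chart.open_source.mem_nhds hp
  have h1 : ContinuousAt (fun q => α ⟨φ, hφ⟩ q / (a φ q : ℂ)) p := by
    refine (hα.continuousAt ⟨φ, hφ⟩ hp).div ?_ ?_
    · exact Complex.continuous_ofReal.continuousAt.comp ((ha.continuousOn φ hφ).continuousAt hs)
    · exact Complex.ofReal_ne_zero.2 (ha.pos φ hφ p hp).ne'
  refine h1.congr ?_
  filter_upwards [hs] with q hq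
  exact (dens_eq ha hα ⟨φ, hφ⟩ hq).symm

theorem hasCompactSupport_dens [T2Space Y] (hα : lam.IsTestForm α) :
    HasCompactSupport (lam.dens a α) := by
  obtain ⟨K, hK, h⟩ := hα.compact_support
  exact HasCompactSupport.intro hK fun p hp => dens_eq_zero h hp

end RiemannSurfaceLamination

/-! ### Covers by boxes -/

namespace RiemannSurfaceLamination

variable {Y : Type u} [TopologicalSpace Y] {lam : RiemannSurfaceLamination Y}

/-- A box of the lamination: a flow box of the atlas, with a disc whose fourfold closed multiple
lies in the base, and a nonnegative cutoff function of compact support on the transversal. -/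
structure Box (lam : RiemannSurfaceLamination Y) where
  φ : FlowBox Y
  mem : φ ∈ lam.atlas
  c : ℂ
  r : ℝ
  r_pos : 0 < r
  subset_base : Metric.closedBall c (4 * r) ⊆ φ.base
  g : φ.T → ℝ
  g_cont : Continuous g
  g_supp : HasCompactSupport g
  g_nonneg : ∀ t, 0 ≤ g t

namespace Box

variable (b : Box lam)

/-- The coordinate along the plaques of a box. -/
noncomputable def z (p : Y) : ℂ := (b.φ.chart p).1

/-- The transversal coordinate of a box. -/
noncomputable def τ (p : Y) : b.φ.T := (b.φ.chart p).2

/-- The point of a box with given coordinates. -/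
noncomputable def pt (w : ℂ) (t : b.φ.T) : Y := b.φ.chart.symm (w, t)

/-- The open set where the bump function of a box is positive. -/
def core : Set Y := boxSet b.φ (Metric.ball b.c b.r) {t | 0 < b.g t}

/-- The compact set of a box. -/
def closed : Set Y := boxSet b.φ (Metric.closedBall b.c (4 * b.r)) (tsupport b.g)

variable {b}

theorem isOpen_core : IsOpen b.core :=
  isOpen_boxSet Metric.isOpen_ball (isOpen_lt continuous_const b.g_cont)

theorem isCompact_closed : IsCompact b.closed :=
  isCompact_boxSet b.subset_base (isCompact_closedBall _ _) b.g_supp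

theorem core_subset : b.core ⊆ b.closed := fun _ hp =>
  ⟨hp.1, Metric.ball_subset_closedBall (Metric.ball_subset_ball (by linarith [b.r_pos]) hp.2.1),
    subset_tsupport _ (ne_of_gt hp.2.2)⟩

theorem mem_target {w : ℂ} (hw : w ∈ b.φ.base) (t : b.φ.T) : (w, t) ∈ b.φ.chart.target :=
  FlowBox.mem_target_iff.2 hw

theorem pt_mem {w : ℂ} (hw : w ∈ b.φ.base) (t : b.φ.T) : b.pt w t ∈ b.φ.chart.source :=
  b.φ.chart.map_target (mem_target hw t)

theorem z_pt {w : ℂ} (hw : w ∈ b.φ.base) (t : b.φ.T) : b.z (b.pt w t) = w := by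
  rw [z, pt, b.φ.chart.right_inv (mem_target hw t)]

theorem τ_pt {w : ℂ} (hw : w ∈ b.φ.base) (t : b.φ.T) : b.τ (b.pt w t) = t := by
  rw [τ, pt, b.φ.chart.right_inv (mem_target hw t)]

theorem pt_z_τ {p : Y} (hp : p ∈ b.φ.chart.source) : b.pt (b.z p) (b.τ p) = p :=
  b.φ.chart.left_inv hp

theorem z_mem {p : Y} (hp : p ∈ b.φ.chart.source) : b.z p ∈ b.φ.base := base_mem hp

theorem continuousOn_z : ContinuousOn b.z b.φ.chart.source :=
  continuous_fst.comp_continuousOn b.φ.chart.continuousOn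

theorem continuousOn_τ : ContinuousOn b.τ b.φ.chart.source :=
  continuous_snd.comp_continuousOn b.φ.chart.continuousOn

theorem continuousAt_pt {w : ℂ} (hw : w ∈ b.φ.base) (t : b.φ.T) :
    ContinuousAt (fun w => b.pt w t) w :=
  ContinuousAt.comp (f := fun w => (w, t)) (b.φ.chart.continuousAt_symm (mem_target hw t))
    (by fun_prop)

theorem continuousOn_pt (t : b.φ.T) : ContinuousOn (fun w => b.pt w t) b.φ.base :=
  fun _ hw => (continuousAt_pt hw t).continuousWithinAt

theorem continuousAt_pt_param {w : ℂ} (hw : w ∈ b.φ.base) (t : b.φ.T) :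
    ContinuousAt (fun t => b.pt w t) t :=
  ContinuousAt.comp (f := fun t => (w, t)) (b.φ.chart.continuousAt_symm (mem_target hw t))
    (by fun_prop)

theorem ball_subset_base {ρ : ℝ} (hρ : ρ ≤ 4 * b.r) : Metric.ball b.c ρ ⊆ b.φ.base :=
  (Metric.ball_subset_ball hρ).trans (Metric.ball_subset_closedBall.trans b.subset_base)

theorem c_mem : b.c ∈ b.φ.base :=
  b.subset_base (Metric.mem_closedBall_self (by linarith [b.r_pos]))

theorem exists_mem_core (lam : RiemannSurfaceLamination Y) (p : Y) :
    ∃ b : Box lam, p ∈ b.core := by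
  obtain ⟨φ, hφ, hp⟩ := lam.cover p
  obtain ⟨ε, hε, hb⟩ := Metric.isOpen_iff.1 φ.isOpen_base _ (base_mem hp)
  obtain ⟨g, hg1, -, hgc, hg01⟩ := exists_continuous_one_zero_of_isCompact
    (isCompact_singleton (x := (φ.chart p).2)) isClosed_empty (disjoint_empty _)
  refine ⟨⟨φ, hφ, (φ.chart p).1, ε / 5, by positivity,
    (Metric.closedBall_subset_ball (by linarith)).trans hb, g, g.continuous, hgc,
    fun t => (hg01 t).1⟩, hp, Metric.mem_ball_self (by positivity), ?_⟩
  have := hg1 (mem_singleton _)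
  simp only [mem_ofPred_eq]
  simp [this]

/-- Between two boxes, the transversal coordinate is locally constant on the plaques. -/
theorem eventually_τ_eq {b b' : Box lam} {p : Y} (hp : p ∈ b.φ.chart.source)
    (hp' : p ∈ b'.φ.chart.source) : ∀ᶠ w in 𝓝 (b.z p),
      b.pt w (b.τ p) ∈ b'.φ.chart.source ∧ b'.τ (b.pt w (b.τ p)) = b'.τ p := by
  have h1 := (lam.compatible _ b.mem _ b'.mem p ⟨hp, hp'⟩).1
  have h2 : ∀ᶠ w in 𝓝 (b.z p), b.pt w (b.τ p) ∈ b'.φ.chart.source := by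
    refine (continuousAt_pt (z_mem hp) (b.τ p)).eventually ?_
    simp only [pt_z_τ hp]
    exact b'.φ.chart.open_source.mem_nhds hp'
  exact h2.and h1

end Box

/-! ### Leaves as classes of points linked by chains of plaques -/

section Leaves

variable {ι : Type*} (b : ι → Box lam)

/-- Two points are linked if they lie on the same plaque of one of the boxes. -/
def Linked (p q : Y) : Prop :=
  ∃ i, p ∈ (b i).closed ∧ q ∈ (b i).closed ∧ (b i).τ p = (b i).τ q

/-- The points reached from `p` by a chain of plaques. -/
def leafOf (p : Y) : Set Y := {q | Relation.ReflTransGen (Linked b) p q}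

variable {b} {p q : Y}

theorem Linked.symm (h : Linked b p q) : Linked b q p := by
  obtain ⟨i, h1, h2, h3⟩ := h
  exact ⟨i, h2, h1, h3.symm⟩

theorem mem_leafOf_self : p ∈ leafOf b p := Relation.ReflTransGen.refl

theorem mem_leafOf_symm (h : q ∈ leafOf b p) : p ∈ leafOf b q :=
  Relation.ReflTransGen.head_induction_on h .refl fun h' _ ih => ih.tail h'.symm

theorem mem_leafOf_trans {s : Y} (h : q ∈ leafOf b p) (h' : s ∈ leafOf b q) : s ∈ leafOf b p :=
  Relation.ReflTransGen.trans h h'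

theorem leafOf_eq (h : q ∈ leafOf b p) : leafOf b q = leafOf b p :=
  Subset.antisymm (fun _ hs => mem_leafOf_trans h hs)
    fun _ hs => mem_leafOf_trans (mem_leafOf_symm h) hs

theorem Linked.mem_leafOf (h : Linked b p q) : q ∈ leafOf b p := Relation.ReflTransGen.single h

theorem mem_leafOf_of_τ_eq {i : ι} (hp : p ∈ (b i).closed) (hq : q ∈ (b i).closed)
    (h : (b i).τ p = (b i).τ q) : q ∈ leafOf b p :=
  Linked.mem_leafOf ⟨i, hp, hq, h⟩

variable (hb : ∀ p, ∃ i, p ∈ (b i).core)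
include hb

/-- The plaques of the flow boxes of the atlas are contained in the classes of linked points. -/
theorem plaque_subset_leafOf {φ : FlowBox Y} (hφ : φ ∈ lam.atlas) {t : φ.T} (hp : p ∈ φ.plaque t) :
    φ.plaque t ⊆ leafOf b p := by
  intro q hq
  obtain ⟨hps, rfl⟩ := hp
  obtain ⟨hqs, hqt⟩ := hq
  set t := (φ.chart p).2 with ht
  -- nearby points of the plaque are linked, and the plaque is connected
  have key : φ.chart.symm ((φ.chart q).1, t) ∈ leafOf b (φ.chart.symm ((φ.chart p).1, t)) := by
    refine φ.isConnected_base.isPreconnected.induction₂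
      (fun w w' => φ.chart.symm (w', t) ∈ leafOf b (φ.chart.symm (w, t))) ?_
      (fun _ _ _ _ _ _ h h' => mem_leafOf_trans h h') (fun _ _ _ _ h => mem_leafOf_symm h)
      (base_mem hps) (base_mem hqs)
    intro w hw
    refine Filter.Eventually.filter_mono nhdsWithin_le_nhds ?_
    have hT : (w, t) ∈ φ.chart.target := FlowBox.mem_target_iff.2 hw
    have hs := φ.chart.map_target hT
    obtain ⟨i, hi⟩ := hb (φ.chart.symm (w, t))
    have h1 := (lam.compatible _ hφ _ (b i).mem _ ⟨hs, hi.1⟩).1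
    rw [φ.chart.right_inv hT] at h1
    have h2 : ContinuousAt (fun w => φ.chart.symm (w, t)) w :=
      ContinuousAt.comp (f := fun w => (w, t)) (φ.chart.continuousAt_symm hT) (by fun_prop)
    filter_upwards [h1, h2.eventually (Box.isOpen_core.mem_nhds hi)] with w' hw1 hw2
    exact mem_leafOf_of_τ_eq (Box.core_subset hi) (Box.core_subset hw2) hw1.symm
  rwa [ht, φ.chart.left_inv hps, ← ht, ← hqt, φ.chart.left_inv hqs] at key

omit hb in
/-- A chain of plaques is connected. -/
theorem isConnected_leafOf (p : Y) : IsConnected (leafOf b p) := by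
  refine ⟨⟨p, mem_leafOf_self⟩, isPreconnected_of_forall p fun q hq => ?_⟩
  induction hq with
  | refl => exact ⟨{p}, by simpa using mem_leafOf_self, rfl, rfl, isPreconnected_singleton⟩
  | @tail q s hq hqs ih =>
    obtain ⟨S, hS, hpS, hqS, hSc⟩ := ih
    obtain ⟨i, h1, h2, h3⟩ := hqs
    set D := (fun w => (b i).pt w ((b i).τ q)) '' Metric.closedBall (b i).c (4 * (b i).r) with hD
    have hDc : IsPreconnected D :=
      ((convex_closedBall _ _).isPreconnected).image _
        (((b i).continuousOn_pt _).mono (b i).subset_base)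
    have hqD : q ∈ D := ⟨(b i).z q, h1.2.1, Box.pt_z_τ h1.1⟩
    have hsD : s ∈ D := ⟨(b i).z s, h2.2.1, by
      simp only [h3]
      exact Box.pt_z_τ h2.1⟩
    refine ⟨S ∪ D, union_subset hS ?_, Or.inl hpS, Or.inr hsD, hSc.union q hqS hqD hDc⟩
    rintro _ ⟨w, hw, rfl⟩
    refine mem_leafOf_trans hq (mem_leafOf_of_τ_eq h1 ?_ ?_)
    · refine ⟨Box.pt_mem ((b i).subset_base hw) _, ?_, ?_⟩
      · have := Box.z_pt ((b i).subset_base hw) ((b i).τ q)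
        rw [Box.z] at this
        rwa [this]
      · have := Box.τ_pt ((b i).subset_base hw) ((b i).τ q)
        rw [Box.τ] at this
        rw [this]
        exact h1.2.2
    · exact (Box.τ_pt ((b i).subset_base hw) _).symm

/-- A leaf is the class of each of its points: it contains the class since it contains the plaques
that it meets, and it is contained in the class by minimality. -/
theorem IsLeaf.eq_leafOf {L : Set Y} (hL : lam.IsLeaf L) (hp : p ∈ L) : L = leafOf b p := by
  have hsub : leafOf b p ⊆ L := by
    intro q hq
    induction hq with
    | refl => exact hp
    | @tail q s hq hqs ih =>
      obtain ⟨i, h1, h2, h3⟩ := hqs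
      exact hL.prop.2 (b i).φ (b i).mem ((b i).τ q) ⟨q, ih, h1.1, rfl⟩ ⟨h2.1, h3.symm⟩
  refine Subset.antisymm (hL.le_of_le ⟨isConnected_leafOf p, ?_⟩ hsub) hsub
  rintro φ hφ t ⟨q, hq, hqt⟩
  exact (plaque_subset_leafOf hb hφ hqt).trans (leafOf_eq hq).subset

omit hb in
/-- A leaf has countably many plaques in each box. -/
theorem countable_plaques [Countable ι] (p : Y) (i : ι) :
    {t | ∃ q ∈ leafOf b p, q ∈ (b i).closed ∧ (b i).τ q = t}.Countable := by
  obtain ⟨D, hDc, hD⟩ := TopologicalSpace.exists_countable_dense ℂ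
  -- the points reached from `p` by moving to points with coordinate in `D`
  let P : ℕ → Set Y := fun n => Nat.rec {p}
    (fun _ A => A ∪ ⋃ i, ⋃ ζ ∈ D, (fun q => (b i).pt ζ ((b i).τ q)) '' A) n
  -- every plaque of the leaf contains such a point: the overlap of two plaques is open, so that it
  -- contains a point with coordinate in `D`
  have hPs : ∀ n, P (n + 1) = P n ∪ ⋃ i, ⋃ ζ ∈ D, (fun q => (b i).pt ζ ((b i).τ q)) '' P n :=
    fun n => rfl
  have hPc : ∀ n, (P n).Countable := by
    intro n
    induction n with
    | zero => exact countable_singleton p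
    | succ n ih =>
      rw [hPs]
      exact ih.union (countable_iUnion fun i => hDc.biUnion fun ζ _ => ih.image _)
  have hP : ∀ q ∈ leafOf b p, ∀ j, q ∈ (b j).φ.chart.source →
      ∃ n, ∃ q' ∈ P n, q' ∈ (b j).φ.chart.source ∧ (b j).τ q' = (b j).τ q := by
    intro q hq
    induction hq with
    | refl => exact fun j hj => ⟨0, p, rfl, hj, rfl⟩
    | @tail q s hq hqs ih =>
      intro j hj
      obtain ⟨i, h1, h2, h3⟩ := hqs
      obtain ⟨n, q', hq', -, hq'τ⟩ := ih i h1.1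
      obtain ⟨ζ, hζD, hζ⟩ := hD.inter_nhds_nonempty (Box.eventually_τ_eq h2.1 hj)
      refine ⟨n + 1, (b i).pt ζ ((b i).τ q'), ?_, ?_⟩
      · rw [hPs]
        exact Or.inr (mem_iUnion.2 ⟨i, mem_iUnion₂.2 ⟨ζ, hζD, q', hq', rfl⟩⟩)
      · rw [hq'τ, h3]
        exact hζ
  refine (countable_iUnion fun n => (hPc n).image (b i).τ).mono ?_
  rintro t ⟨q, hq, hqi, rfl⟩
  obtain ⟨n, q', hq', -, h⟩ := hP q hq i hqi.1
  exact mem_iUnion.2 ⟨n, q', hq', h⟩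

omit hb

/-! ### Saturations of σ-compact sets -/

/-- The union of the leaves that meet `S`. -/
def sat (b : ι → Box lam) (S : Set Y) : Set Y := {q | ∃ p ∈ S, q ∈ leafOf b p}

theorem mem_sat {S : Set Y} : p ∈ sat b S ↔ (leafOf b p ∩ S).Nonempty :=
  ⟨fun ⟨q, hq, h⟩ => ⟨q, mem_leafOf_symm h, hq⟩, fun ⟨q, h, hq⟩ => ⟨q, hq, mem_leafOf_symm h⟩⟩

/-- The saturation is reached by repeating countably often the passage to the plaques that meet a
set, which preserves σ-compactness. -/
theorem isSigmaCompact_sat [T2Space Y] [Countable ι] {S : Set Y} (hS : IsSigmaCompact S) :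
    IsSigmaCompact (sat b S) := by
  let step : Set Y → Set Y := fun A => {q | ∃ p ∈ A, Linked b p q}
  have hstep : ∀ A, IsSigmaCompact A → IsSigmaCompact (step A) := by
    rintro A ⟨K, hK, rfl⟩
    have e : step (⋃ n, K n) = ⋃ i, ⋃ n, boxSet (b i).φ
        (Metric.closedBall (b i).c (4 * (b i).r)) ((b i).τ '' (K n ∩ (b i).closed)) := by
      ext q
      constructor
      · rintro ⟨p, hp, i, h1, h2, h3⟩
        obtain ⟨n, hn⟩ := mem_iUnion.1 hp
        exact mem_iUnion.2 ⟨i, mem_iUnion.2 ⟨n, h2.1, h2.2.1, p, ⟨hn, h1⟩, h3⟩⟩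
      · intro hq
        obtain ⟨i, hq⟩ := mem_iUnion.1 hq
        obtain ⟨n, h1, h2, p, ⟨hp, hpc⟩, hpt⟩ := mem_iUnion.1 hq
        refine ⟨p, mem_iUnion.2 ⟨n, hp⟩, i, hpc, ⟨h1, h2, ?_⟩, hpt⟩
        rw [← hpt]
        exact hpc.2.2
    rw [e]
    refine isSigmaCompact_iUnion _ fun i => isSigmaCompact_iUnion_of_isCompact _ fun n => ?_
    refine isCompact_boxSet (b i).subset_base (isCompact_closedBall _ _) ?_
    refine ((hK n).inter_right Box.isCompact_closed.isClosed).image_of_continuousOn ?_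
    exact (b i).continuousOn_τ.mono fun q hq => hq.2.1
  have e : sat b S = ⋃ n : ℕ, step^[n] S := by
    ext q
    constructor
    · rintro ⟨p, hp, hq⟩
      induction hq with
      | refl => exact mem_iUnion.2 ⟨0, hp⟩
      | @tail q s _ hqs ih =>
        obtain ⟨n, hn⟩ := mem_iUnion.1 ih
        refine mem_iUnion.2 ⟨n + 1, ?_⟩
        rw [Function.iterate_succ_apply']
        exact ⟨q, hn, hqs⟩
    · intro hq
      obtain ⟨n, hn⟩ := mem_iUnion.1 hq
      clear hq
      induction n generalizing q with
      | zero => exact ⟨q, hn, mem_leafOf_self⟩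
      | succ n ih =>
        rw [Function.iterate_succ_apply'] at hn
        obtain ⟨s, hs, hsq⟩ := hn
        obtain ⟨p, hp, hps⟩ := ih _ hs
        exact ⟨p, hp, mem_leafOf_trans hps hsq.mem_leafOf⟩
  rw [e]
  refine isSigmaCompact_iUnion _ fun n => ?_
  induction n with
  | zero => exact hS
  | succ n ih =>
    rw [Function.iterate_succ_apply']
    exact hstep _ ih

theorem _root_.IsSigmaCompact.measurableSet_of_t2 {X : Type*} [TopologicalSpace X] [T2Space X]
    [MeasurableSpace X] [BorelSpace X] {S : Set X} (hS : IsSigmaCompact S) : MeasurableSet S := by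
  obtain ⟨K, hK, rfl⟩ := hS
  exact MeasurableSet.iUnion fun n => (hK n).measurableSet

end Leaves

end RiemannSurfaceLamination

/-! ### Leaves that meet a compact set in one point -/

namespace RiemannSurfaceLamination

variable {Y : Type u} [TopologicalSpace Y] {lam : RiemannSurfaceLamination Y}
  {ι : Type*} {b : ι → Box lam} {p q : Y}

/-- The union of the leaves that meet `K` in exactly one point. -/
def sliceSet (b : ι → Box lam) (K : Set Y) : Set Y := {p | ∃! q, q ∈ leafOf b p ∩ K}

open Classical in
/-- The point of `K` on the leaf of `p` if it is unique, and `p` otherwise. -/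
noncomputable def sliceProj (b : ι → Box lam) (K : Set Y) (p : Y) : Y :=
  if h : p ∈ sliceSet b K then h.choose else p

theorem sliceProj_mem {K : Set Y} (hp : p ∈ sliceSet b K) :
    sliceProj b K p ∈ leafOf b p ∩ K := by
  rw [sliceProj, dif_pos hp]
  exact hp.choose_spec.1

theorem eq_sliceProj {K : Set Y} (hp : p ∈ sliceSet b K) (hq : q ∈ leafOf b p ∩ K) :
    q = sliceProj b K p := by
  rw [sliceProj, dif_pos hp]
  exact hp.choose_spec.2 q hq

theorem mem_sliceSet_iff {K : Set Y} (h : q ∈ leafOf b p) :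
    q ∈ sliceSet b K ↔ p ∈ sliceSet b K := by
  simp only [sliceSet, mem_ofPred_eq, leafOf_eq h]

theorem sliceProj_eq {K : Set Y} (hp : p ∈ sliceSet b K) (h : q ∈ leafOf b p) :
    sliceProj b K q = sliceProj b K p := by
  have := sliceProj_mem ((mem_sliceSet_iff h).2 hp)
  rw [leafOf_eq h] at this
  exact eq_sliceProj hp this

variable [T2Space Y] [LocallyCompactSpace Y] [SecondCountableTopology Y] [Countable ι]
  [MeasurableSpace Y] [BorelSpace Y] {K : Set Y}

omit [LocallyCompactSpace Y] [SecondCountableTopology Y] in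
theorem measurableSet_sat (hK : IsCompact K) : MeasurableSet (sat b K) :=
  (isSigmaCompact_sat hK.isSigmaCompact).measurableSet_of_t2

/-- A condition on saturations of compact sets, which are σ-compact. -/
theorem measurableSet_sliceSet (hK : IsCompact K) : MeasurableSet (sliceSet b K) := by
  set 𝒪 := TopologicalSpace.countableBasis Y
  have hc : 𝒪.Countable := TopologicalSpace.countable_countableBasis Y
  have hB := TopologicalSpace.isBasis_countableBasis Y
  -- a leaf meets `K` in two points iff it meets two disjoint closures of basic open sets in `K`
  have e : sliceSet b K = sat b K \ ⋃ O ∈ 𝒪, ⋃ O' ∈ 𝒪, {p | Disjoint (closure O) (closure O') ∧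
      p ∈ sat b (K ∩ closure O) ∩ sat b (K ∩ closure O')} := by
    ext p
    constructor
    · intro hp
      refine ⟨mem_sat.2 ⟨_, sliceProj_mem hp⟩, fun h => ?_⟩
      simp only [mem_iUnion] at h
      obtain ⟨O, -, O', -, hd, h1, h2⟩ := h
      obtain ⟨q, hq, hqK, hqO⟩ := mem_sat.1 h1
      obtain ⟨q', hq', hqK', hqO'⟩ := mem_sat.1 h2
      have : q = q' := (eq_sliceProj hp ⟨hq, hqK⟩).trans (eq_sliceProj hp ⟨hq', hqK'⟩).symm
      exact hd.le_bot ⟨hqO, this ▸ hqO'⟩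
    · rintro ⟨h1, h2⟩
      obtain ⟨q, hq⟩ := mem_sat.1 h1
      refine ⟨q, hq, fun q' hq' => ?_⟩
      by_contra hne
      apply h2
      obtain ⟨U, hqU, hU, V, hqV, hV, hd⟩ := exists_open_nhds_disjoint_closure hne
      obtain ⟨O, hO, hqO, hOU⟩ := hB.exists_subset_of_mem_open hqU hU
      obtain ⟨O', hO', hqO', hOV⟩ := hB.exists_subset_of_mem_open hqV hV
      simp only [mem_iUnion]
      refine ⟨O, hO, O', hO', hd.mono (closure_mono hOU) (closure_mono hOV),
        mem_sat.2 ⟨q', hq'.1, hq'.2, subset_closure hqO⟩,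
        mem_sat.2 ⟨q, hq.1, hq.2, subset_closure hqO'⟩⟩
  rw [e]
  refine (measurableSet_sat hK).diff (MeasurableSet.biUnion hc fun O _ =>
    MeasurableSet.biUnion hc fun O' _ => ?_)
  by_cases hd : Disjoint (closure O) (closure O')
  · simp only [hd, true_and]
    exact (measurableSet_sat (hK.inter_right isClosed_closure)).inter
      (measurableSet_sat (hK.inter_right isClosed_closure))
  · simp [hd]

/-- The preimage of a closed set `C` is given by the leaves that meet `K ∩ C`. -/
theorem measurable_sliceProj (hK : IsCompact K) : Measurable (sliceProj b K) := by
  refine measurable_of_isClosed fun C hC => ?_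
  have e : sliceProj b K ⁻¹' C = (sliceSet b K ∩ sat b (K ∩ C)) ∪ ((sliceSet b K)ᶜ ∩ C) := by
    ext p
    by_cases hp : p ∈ sliceSet b K
    · have hm := sliceProj_mem hp
      simp only [mem_preimage, mem_union, mem_inter_iff, hp, true_and, mem_compl_iff, not_true,
        false_and, or_false, mem_sat]
      refine ⟨fun h => ⟨_, hm.1, hm.2, h⟩, ?_⟩
      rintro ⟨q, hq, hqK, hqC⟩
      rwa [← eq_sliceProj hp ⟨hq, hqK⟩]
    · simp [hp, sliceProj]
  rw [e]
  exact ((measurableSet_sliceSet hK).inter (measurableSet_sat (hK.inter_right hC))).union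
    ((measurableSet_sliceSet hK).compl.inter hC.measurableSet)

/-! ### Transversals -/

omit [T2Space Y] [LocallyCompactSpace Y] [SecondCountableTopology Y] [Countable ι]
  [MeasurableSpace Y] [BorelSpace Y]

/-- The part in the closure of `O` of the transversal of a box where the coordinate along the
plaques is `ζ`. -/
def Box.transversal (b : Box lam) (ζ : ℂ) (O : Set Y) : Set Y :=
  {p | p ∈ b.closed ∧ b.z p = ζ} ∩ closure O

theorem Box.isCompact_transversal (b : Box lam) (ζ : ℂ) (O : Set Y) :
    IsCompact (b.transversal ζ O) := by
  have e : {p | p ∈ b.closed ∧ b.z p = ζ} =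
      boxSet b.φ (Metric.closedBall b.c (4 * b.r) ∩ {ζ}) (tsupport b.g) := by
    ext p
    simp only [Box.closed, boxSet, mem_ofPred_eq, mem_inter_iff, mem_singleton_iff, Box.z]
    tauto
  rw [Box.transversal, e]
  exact (isCompact_boxSet (inter_subset_left.trans b.subset_base)
    ((isCompact_closedBall _ _).inter_right isClosed_singleton) b.g_supp).inter_right
      isClosed_closure

/-- A wandering leaf meets one of countably many transversals in exactly one point. -/
theorem IsWanderingLeaf.exists_transversal [RegularSpace Y] (hb : ∀ p, ∃ i, p ∈ (b i).core)
    {D : Set ℂ} (hD : Dense D) {𝒪 : Set (Set Y)} (h𝒪 : TopologicalSpace.IsTopologicalBasis 𝒪)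
    {L : Set Y} (hL : lam.IsWanderingLeaf L) :
    ∃ i, ∃ ζ ∈ D, ∃ O ∈ 𝒪, L ⊆ sliceSet b ((b i).transversal ζ O) := by
  obtain ⟨hL, -, p, hp, ψ, hψ, hpψ, t, ht⟩ := hL
  obtain ⟨i, hi⟩ := hb p
  have hLeq := IsLeaf.eq_leafOf hb hL hp
  have hpt : (ψ.chart p).2 = t := by
    have : p ∈ ψ.plaque t := ht ▸ ⟨hp, hpψ⟩
    exact this.2
  have hev := ((hψ _ (b i).mem).1 p ⟨hpψ, hi.1⟩).1
  -- near `p`, the points of `L` have the same transversal coordinate as `p`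
  have hN : ∀ᶠ q in 𝓝 p, q ∈ L → q ∈ (b i).φ.chart.source ∧ (b i).τ q = (b i).τ p := by
    have h1 : Tendsto (fun q => (ψ.chart q).1) (𝓝 p) (𝓝 (ψ.chart p).1) :=
      continuousAt_fst.comp (ψ.chart.continuousAt hpψ)
    filter_upwards [ψ.chart.open_source.mem_nhds hpψ, (b i).φ.chart.open_source.mem_nhds hi.1,
      h1.eventually hev] with q hq hqi h hqL
    refine ⟨hqi, ?_⟩
    have hqt : q ∈ ψ.plaque t := ht ▸ ⟨hqL, hq⟩
    rw [hpt, ← hqt.2] at h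
    simp only [Prod.mk.eta, ψ.chart.left_inv hq] at h
    exact h
  obtain ⟨C, ⟨hC, hCc⟩, hCN⟩ := (closed_nhds_basis p).mem_iff.1 hN
  obtain ⟨O, hO, hpO, hOC⟩ := h𝒪.mem_nhds_iff.1 hC
  have hOcl : closure O ⊆ C := closure_minimal hOC hCc
  -- move `p` on its plaque to a point with coordinate in `D`
  obtain ⟨ζ, hζD, hζ⟩ := hD.inter_nhds_nonempty
    (((b i).continuousAt_pt (Box.z_mem hi.1) ((b i).τ p)).eventually
      (p := fun q => q ∈ O ∩ (b i).core)
      (by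
        simp only [Box.pt_z_τ hi.1]
        exact Filter.inter_mem (h𝒪.mem_nhds hO hpO) (Box.isOpen_core.mem_nhds hi)) |>.and
      ((b i).φ.isOpen_base.mem_nhds (Box.z_mem hi.1)))
  obtain ⟨⟨hζO, hζc⟩, hζb⟩ := hζ
  set q := (b i).pt ζ ((b i).τ p) with hq
  have hqL : q ∈ L := by
    rw [hLeq]
    exact mem_leafOf_of_τ_eq (Box.core_subset hi) (Box.core_subset hζc) (Box.τ_pt hζb _).symm
  refine ⟨i, ζ, hζD, O, hO, fun s hs => ⟨q, ⟨?_, ⟨Box.core_subset hζc, Box.z_pt hζb _⟩,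
    subset_closure hζO⟩, ?_⟩⟩
  · rwa [← IsLeaf.eq_leafOf hb hL hs]
  · rintro s' ⟨hs', ⟨hs'c, hs'z⟩, hs'O⟩
    rw [← IsLeaf.eq_leafOf hb hL hs] at hs'
    obtain ⟨h1, h2⟩ := hCN (hOcl hs'O) hs'
    rw [← Box.pt_z_τ h1, h2, hs'z]

end RiemannSurfaceLamination

/-! ### Harmonic measures on a plaque -/

theorem ContinuousOn.measurableSet_inter_preimage {X Z : Type*} [TopologicalSpace X]
    [MeasurableSpace X] [OpensMeasurableSpace X] [TopologicalSpace Z] [MeasurableSpace Z]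
    [BorelSpace Z] {f : X → Z} {s : Set X} (hf : ContinuousOn f s) (hs : MeasurableSet s)
    {A : Set Z} (hA : MeasurableSet A) : MeasurableSet (s ∩ f ⁻¹' A) := by
  have h := hs.subtype_image ((continuousOn_iff_continuous_domRestrict.1 hf).measurable hA)
  rwa [show (Subtype.val '' (s.domRestrict f ⁻¹' A) : Set X) = s ∩ f ⁻¹' A from by
    ext x
    simp [and_comm]] at h

namespace RiemannSurfaceLamination

open InnerProductSpace

variable {Y : Type u} [TopologicalSpace Y] {lam : RiemannSurfaceLamination Y}

/-- The part of a plaque of a box over a subset of the base. -/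
def Box.plaque (b : Box lam) (A : Set ℂ) (t : b.φ.T) : Set Y := boxSet b.φ A {t}

open Classical in
/-- The coefficient of an area form on a plaque of a box, extended by `1` to the plane. -/
noncomputable def Box.areaOn (a : FlowBox Y → Y → ℝ) (b : Box lam) (t : b.φ.T) (z : ℂ) : ℝ :=
  if z ∈ b.φ.base then a b.φ (b.pt z t) else 1

variable {a : FlowBox Y → Y → ℝ} {b : Box lam} {t : b.φ.T}

theorem Box.mem_plaque {A : Set ℂ} {p : Y} :
    p ∈ b.plaque A t ↔ p ∈ b.φ.chart.source ∧ b.z p ∈ A ∧ b.τ p = t := Iff.rfl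

theorem Box.areaOn_apply {z : ℂ} (hz : z ∈ b.φ.base) : b.areaOn a t z = a b.φ (b.pt z t) :=
  if_pos hz

theorem Box.areaOn_z {p : Y} (hp : p ∈ b.φ.chart.source) :
    b.areaOn a (b.τ p) (b.z p) = a b.φ p := by
  rw [b.areaOn_apply (Box.z_mem hp), Box.pt_z_τ hp]

theorem Box.areaOn_pos (ha : lam.IsAreaForm a) (z : ℂ) : 0 < b.areaOn a t z := by
  by_cases hz : z ∈ b.φ.base
  · rw [b.areaOn_apply hz]
    exact ha.pos _ b.mem _ (Box.pt_mem hz t)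
  · rw [Box.areaOn, if_neg hz]
    exact one_pos

theorem Box.continuousOn_areaOn (ha : lam.IsAreaForm a) :
    ContinuousOn (b.areaOn a t) b.φ.base := by
  refine ((ha.continuousOn _ b.mem).comp (b.continuousOn_pt t) fun z hz => Box.pt_mem hz t).congr ?_
  exact fun z hz => b.areaOn_apply hz

theorem Box.measurable_areaOn (ha : lam.IsAreaForm a) : Measurable (b.areaOn a t) := by
  classical
  have := (b.continuousOn_areaOn ha (t := t)).measurable_piecewise
    (continuous_const (y := (1 : ℝ))).continuousOn b.φ.isOpen_base.measurableSet
  convert! this using 1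
  ext z
  by_cases hz : z ∈ b.φ.base
  · simp [hz]
  · simp [hz, Box.areaOn]

variable [MeasurableSpace Y] [BorelSpace Y]

theorem Box.measurableSet_plaque {A : Set ℂ} (hA : MeasurableSet A) (t : b.φ.T) :
    MeasurableSet (b.plaque A t) := by
  have hs := b.φ.chart.open_source
  have h1 := b.continuousOn_z.measurableSet_inter_preimage hs.measurableSet hA
  have h2 : IsOpen (b.φ.chart.source ∩ b.τ ⁻¹' {t}ᶜ) :=
    b.continuousOn_τ.isOpen_inter_preimage hs isClosed_singleton.isOpen_compl
  convert! h1.diff h2.measurableSet using 1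
  ext p
  simp only [Box.mem_plaque, mem_inter_iff, Set.mem_sdiff, mem_preimage, mem_compl_iff,
    mem_singleton_iff]
  tauto

theorem Box.aemeasurable_z {μ : Measure Y} {S : Set Y} (hS : S ⊆ b.φ.chart.source) :
    AEMeasurable b.z (μ.restrict S) :=
  (b.continuousOn_z.aemeasurable b.φ.chart.open_source.measurableSet).mono_measure
    (Measure.restrict_mono hS le_rfl)

theorem Box.map_plaque_apply (μ : Measure Y) {B A : Set ℂ} (hA : MeasurableSet A) :
    (μ.restrict (b.plaque B t)).map b.z A = μ (b.plaque (A ∩ B) t) := by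
  rw [Measure.map_apply_of_aemeasurable (Box.aemeasurable_z fun p hp => hp.1) hA]
  have h1 := b.continuousOn_z.measurableSet_inter_preimage b.φ.chart.open_source.measurableSet hA
  have h2 : NullMeasurableSet (b.z ⁻¹' A) (μ.restrict (b.plaque B t)) :=
    (Box.aemeasurable_z fun p hp => hp.1).nullMeasurable hA
  rw [Measure.restrict_apply₀ h2]
  congr 1
  ext p
  simp only [Box.mem_plaque, mem_inter_iff, mem_preimage]
  tauto

/-- The condition that a measure, divided by the area form, is harmonic on the plaques of a box:
it is tested on the bump functions with centres in `D` and radii `r / (n + 1)`. -/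
def Box.HarmonicOnPlaque (a : FlowBox Y → Y → ℝ) (D : Set ℂ) (μ : Measure Y) (b : Box lam)
    (t : b.φ.T) : Prop :=
  ∀ n : ℕ, ∀ ζ ∈ D, Metric.closedBall ζ (b.r / (n + 1)) ⊆ Metric.ball b.c (4 * b.r) →
    ∫ q in b.plaque (Metric.ball b.c (4 * b.r)) t,
      Laplacian.laplacian (fun w => (discBump (b.r / (n + 1)) (ζ - w) : ℂ)) (b.z q) /
        (a b.φ q : ℂ) ∂μ = 0

/-- On a plaque, the measure `μ` is the area form times the nonnegative harmonic function `h` of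
the coordinate. -/
structure Box.IsDensity (a : FlowBox Y → Y → ℝ) (μ : Measure Y) (b : Box lam) (t : b.φ.T)
    (h : ℂ → ℝ) : Prop where
  continuous : Continuous h
  nonneg : ∀ z, 0 ≤ h z
  harmonic : HarmonicOnNhd h (Metric.ball b.c (2 * b.r))
  map_eq : (μ.restrict (b.plaque (Metric.ball b.c (2 * b.r)) t)).map b.z =
    (volume.restrict (Metric.ball b.c (2 * b.r))).withDensity
      fun z => ENNReal.ofReal (h z * b.areaOn a t z)

/-- Weyl's lemma, for the quotient of the measure by the area form. -/
theorem Box.HarmonicOnPlaque.exists_isDensity [T2Space Y] (ha : lam.IsAreaForm a) {μ : Measure Y}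
    [IsFiniteMeasureOnCompacts μ] {D : Set ℂ} (hD : Dense D)
    (hμ : b.HarmonicOnPlaque a D μ t) : ∃ h, b.IsDensity a μ t h := by
  set B := Metric.ball b.c (4 * b.r) with hB
  set B' := Metric.ball b.c (2 * b.r) with hB'
  have hr := b.r_pos
  have hB'B : B' ⊆ B := Metric.ball_subset_ball (by linarith)
  set ν := (μ.restrict (b.plaque B t)).map b.z with hν
  set k : ℂ → ENNReal := fun z => ENNReal.ofReal (b.areaOn a t z) with hk
  have hkm : Measurable k := (b.measurable_areaOn ha).ennreal_ofReal
  have hk0 : ∀ z, k z ≠ 0 := fun z => by simpa [hk] using b.areaOn_pos ha z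
  have hkt : ∀ z, k z ≠ ⊤ := fun z => ENNReal.ofReal_ne_top
  -- divide the measure by the coefficient of the area form
  set l := ν.withDensity k⁻¹ with hl
  have hνl : ν = l.withDensity k :=
    (withDensity_inv_same₀ (hkm.inv.aemeasurable)
      (Eventually.of_forall fun z => by simp [hkt z])
      (Eventually.of_forall fun z => by simp [hk0 z])).symm.trans (by simp [hl])
  have hsub : b.plaque B t ⊆ b.φ.chart.source := fun p hp => hp.1
  have hνB : ν Bᶜ = 0 := by
    rw [hν, b.map_plaque_apply μ Metric.isOpen_ball.measurableSet.compl, compl_inter_self]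
    convert! measure_empty (μ := μ)
    ext p
    simp [Box.mem_plaque]
  -- the coefficient of the area form is bounded below on the disc
  obtain ⟨M, hM⟩ : ∃ M : ℝ, ∀ z ∈ B, (b.areaOn a t z)⁻¹ ≤ M := by
    have hc : ContinuousOn (fun z => (b.areaOn a t z)⁻¹) (Metric.closedBall b.c (4 * b.r)) :=
      ((b.continuousOn_areaOn ha).mono b.subset_base).inv₀ fun z _ => (b.areaOn_pos ha z).ne'
    obtain ⟨M, hM⟩ := (isCompact_closedBall _ _).bddAbove_image hc
    exact ⟨M, fun z hz => hM (mem_image_of_mem _ (Metric.ball_subset_closedBall hz))⟩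
  have hνfin : IsFiniteMeasure ν := by
    refine ⟨?_⟩
    rw [hν, b.map_plaque_apply μ MeasurableSet.univ, univ_inter]
    refine lt_of_le_of_lt (measure_mono ?_)
      (isCompact_boxSet b.subset_base (isCompact_closedBall _ _)
        (isCompact_singleton (x := t))).measure_lt_top
    exact fun p hp => ⟨hp.1, Metric.ball_subset_closedBall hp.2.1, hp.2.2⟩
  have hlfin : IsFiniteMeasure l := by
    refine isFiniteMeasure_withDensity ?_
    refine ne_of_lt (lt_of_le_of_lt (lintegral_mono_ae (g := fun _ => ENNReal.ofReal M) ?_) ?_)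
    · have : ∀ᵐ z ∂ν, z ∈ B := by
        rw [ae_iff]
        exact hνB
      filter_upwards [this] with z hz
      rw [Pi.inv_apply, hk, ← ENNReal.ofReal_inv_of_pos (b.areaOn_pos ha z)]
      exact ENNReal.ofReal_le_ofReal (hM z hz)
    · rw [lintegral_const]
      exact ENNReal.mul_lt_top ENNReal.ofReal_lt_top (measure_lt_top _ _)
  obtain ⟨h, hhc, hh0, hhh, hh⟩ := exists_harmonic_density (μ := l) (c := b.c) b.r_pos hD (by
    intro n ζ hζ hsubζ
    have hlap : Continuous (Laplacian.laplacian
        fun w => (discBump (b.r / (n + 1)) (ζ - w) : ℂ)) :=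
      continuous_laplacian ((contDiff_ofReal_discBump _).comp (contDiff_const.sub contDiff_id))
    rw [hl, integral_withDensity_eq_integral_toReal_smul hkm.inv
      (Eventually.of_forall fun z => by simpa [pos_iff_ne_zero] using hk0 z), hν,
      integral_map (Box.aemeasurable_z hsub)]
    · rw [← hμ n ζ hζ hsubζ]
      refine setIntegral_congr_fun (b.measurableSet_plaque Metric.isOpen_ball.measurableSet t) ?_
      rintro q ⟨hq, hqz, hqt⟩
      have : b.areaOn a t (b.z q) = a b.φ q := by
        rw [← b.areaOn_z (a := a) hq]
        exact congrArg (fun s => b.areaOn a s (b.z q)) hqt.symm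
      simp only [Pi.inv_apply, hk, ENNReal.toReal_inv, this,
        ENNReal.toReal_ofReal (ha.pos _ b.mem _ hq).le, Complex.real_smul, Complex.ofReal_inv]
      exact (div_eq_inv_mul _ _).symm
    · exact (hkm.inv.ennreal_toReal.aestronglyMeasurable).smul hlap.aestronglyMeasurable)
  refine ⟨h, hhc, hh0, hhh, ?_⟩
  have hB'm : MeasurableSet B' := Metric.isOpen_ball.measurableSet
  have h1 : (μ.restrict (b.plaque B' t)).map b.z = ν.restrict B' := by
    ext A hA
    rw [b.map_plaque_apply μ hA, Measure.restrict_apply hA, hν, b.map_plaque_apply μ (hA.inter hB'm),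
      inter_assoc, inter_eq_left.2 hB'B]
  rw [h1, hνl, restrict_withDensity hB'm, hh,
    ← withDensity_mul _ hhc.measurable.ennreal_ofReal hkm]
  congr 1
  ext z
  simp only [Pi.mul_apply, hk]
  rw [← ENNReal.ofReal_mul (hh0 z)]

end RiemannSurfaceLamination

/-! ### The density of a harmonic measure on a leaf -/

/-- Continuous densities of the same measure agree. -/
theorem eq_of_setLIntegral_eq {k₁ k₂ : ℂ → ℝ} {V : Set ℂ} {z₀ : ℂ} (hV : V ∈ 𝓝 z₀)
    (h₁ : ContinuousAt k₁ z₀) (h₂ : ContinuousAt k₂ z₀) (hp₁ : 0 ≤ k₁ z₀) (hp₂ : 0 ≤ k₂ z₀)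
    (h : ∀ A ⊆ V, MeasurableSet A →
      ∫⁻ z in A, ENNReal.ofReal (k₁ z) = ∫⁻ z in A, ENNReal.ofReal (k₂ z)) : k₁ z₀ = k₂ z₀ := by
  wlog hlt : k₁ z₀ < k₂ z₀ generalizing k₁ k₂
  · by_contra hne
    rcases lt_or_gt_of_ne hne with h' | h'
    · exact hne (this h₁ h₂ hp₁ hp₂ h h')
    · exact hne (this h₂ h₁ hp₂ hp₁ (fun A hA hAm => (h A hA hAm).symm) h').symm
  exfalso
  obtain ⟨c₁, hc₁, hc₁'⟩ := exists_between hlt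
  obtain ⟨c₂, hc₂, hc₂'⟩ := exists_between hc₁'
  obtain ⟨ε, hε, hball⟩ := Metric.mem_nhds_iff.1 (Filter.inter_mem hV (Filter.inter_mem
    (h₁.eventually (gt_mem_nhds hc₁)) (h₂.eventually (lt_mem_nhds hc₂'))))
  have hm : MeasurableSet (Metric.ball z₀ ε) := Metric.isOpen_ball.measurableSet
  have e := h (Metric.ball z₀ ε) (fun z hz => (hball hz).1) hm
  have l1 : ∫⁻ z in Metric.ball z₀ ε, ENNReal.ofReal (k₁ z) ≤
      ENNReal.ofReal c₁ * volume (Metric.ball z₀ ε) := by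
    rw [← setLIntegral_const]
    exact setLIntegral_mono' hm fun z hz => ENNReal.ofReal_le_ofReal (hball hz).2.1.le
  have l2 : ENNReal.ofReal c₂ * volume (Metric.ball z₀ ε) ≤
      ∫⁻ z in Metric.ball z₀ ε, ENNReal.ofReal (k₂ z) := by
    rw [← setLIntegral_const]
    exact setLIntegral_mono' hm fun z hz => ENNReal.ofReal_le_ofReal (hball hz).2.2.le
  have hv0 : volume (Metric.ball z₀ ε) ≠ 0 := (Metric.measure_ball_pos _ _ hε).ne'
  have hvt : volume (Metric.ball z₀ ε) ≠ ⊤ := measure_ball_lt_top.ne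
  have := (ENNReal.mul_le_mul_iff_left hv0 hvt).1 (l2.trans (e ▸ l1))
  rw [ENNReal.ofReal_le_ofReal_iff (hp₁.trans hc₁.le)] at this
  linarith

namespace RiemannSurfaceLamination

variable {Y : Type u} [TopologicalSpace Y] {lam : RiemannSurfaceLamination Y}
  {a : FlowBox Y → Y → ℝ} [MeasurableSpace Y] [BorelSpace Y] {μ : Measure Y}

theorem Box.IsDensity.measure_plaque {b : Box lam} {t : b.φ.T} {h : ℂ → ℝ}
    (H : b.IsDensity a μ t h) {A : Set ℂ} (hA : MeasurableSet A)
    (hAb : A ⊆ Metric.ball b.c (2 * b.r)) :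
    μ (b.plaque A t) = ∫⁻ z in A, ENNReal.ofReal (h z * b.areaOn a t z) := by
  have e := b.map_plaque_apply (t := t) μ (B := Metric.ball b.c (2 * b.r)) hA
  rw [inter_eq_left.2 hAb, H.map_eq, withDensity_apply _ hA, Measure.restrict_restrict hA,
    inter_eq_left.2 hAb] at e
  exact e.symm

/-- The densities of a measure on two plaques agree on the intersection of the plaques. -/
theorem Box.IsDensity.eq_of_mem {b b' : Box lam} {t : b.φ.T} {t' : b'.φ.T} {h h' : ℂ → ℝ}
    (ha : lam.IsAreaForm a) (H : b.IsDensity a μ t h) (H' : b'.IsDensity a μ t' h') {p : Y}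
    (hp : p ∈ b.plaque (Metric.ball b.c (2 * b.r)) t)
    (hp' : p ∈ b'.plaque (Metric.ball b'.c (2 * b'.r)) t') : h (b.z p) = h' (b'.z p) := by
  obtain ⟨hps, hpz, rfl⟩ := hp
  obtain ⟨hps', hpz', rfl⟩ := hp'
  change b.z p ∈ _ at hpz
  change b'.z p ∈ _ at hpz'
  set t : b.φ.T := b.τ p
  set t' : b'.φ.T := b'.τ p
  change b.IsDensity a μ t h at H
  change b'.IsDensity a μ t' h' at H'
  -- the change of coordinates from the first box to the second
  set f : ℂ → ℂ := fun z => b'.z (b.pt z t) with hf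
  have hzb := Box.z_mem hps
  have hfz : f (b.z p) = b'.z p := by
    simp only [hf, t, Box.pt_z_τ hps]
  have hfc : ContinuousAt f (b.z p) := by
    refine ContinuousAt.comp (f := fun z => b.pt z t) (g := b'.z) ?_ (Box.continuousAt_pt hzb t)
    simp only [t, Box.pt_z_τ hps]
    exact b'.continuousOn_z.continuousAt (b'.φ.chart.open_source.mem_nhds hps')
  have hV : ∀ᶠ z in 𝓝 (b.z p), z ∈ Metric.ball b.c (2 * b.r) ∧ b.pt z t ∈ b'.φ.chart.source ∧
      b'.τ (b.pt z t) = t' ∧ f z ∈ Metric.ball b'.c (2 * b'.r) := by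
    filter_upwards [Metric.isOpen_ball.mem_nhds hpz, Box.eventually_τ_eq hps hps',
      hfc.eventually (by
        rw [hfz]
        exact Metric.isOpen_ball.mem_nhds hpz')] with z h1 h2 h3
    exact ⟨h1, h2.1, h2.2, h3⟩
  set V := {z | z ∈ Metric.ball b.c (2 * b.r) ∧ b.pt z t ∈ b'.φ.chart.source ∧
      b'.τ (b.pt z t) = t' ∧ f z ∈ Metric.ball b'.c (2 * b'.r)} with hVdef
  have hr := b.r_pos
  have hVb : ∀ z ∈ V, z ∈ b.φ.base := fun z hz => Box.ball_subset_base (by linarith) hz.1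
  have hpt : ∀ z ∈ V, b'.pt (f z) t' = b.pt z t := fun z hz => by
    rw [← hz.2.2.1]
    exact Box.pt_z_τ hz.2.1
  have hinj : InjOn f V := by
    intro z hz w hw hzw
    have : b.pt z t = b.pt w t := by rw [← hpt z hz, ← hpt w hw, hzw]
    rw [← Box.z_pt (hVb z hz) t, this, Box.z_pt (hVb w hw) t]
  have hder : ∀ z ∈ V, HasDerivAt f (b.φ.transDeriv b'.φ (b.pt z t)) z := by
    intro z hz
    have := (lam.compatible _ b.mem _ b'.mem (b.pt z t) ⟨Box.pt_mem (hVb z hz) t, hz.2.1⟩).2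
    have e1 : (b.φ.chart (b.pt z t)).1 = z := Box.z_pt (hVb z hz) t
    have e2 : (b.φ.chart (b.pt z t)).2 = t := Box.τ_pt (hVb z hz) t
    have := this.hasDerivAt
    rw [FlowBox.transDeriv]
    rw [e1, e2] at this ⊢
    exact this
  -- the coefficients of the area form differ by the Jacobian determinant of the change of
  -- coordinates
  have harea : ∀ z ∈ V, b.areaOn a t z =
      ‖b.φ.transDeriv b'.φ (b.pt z t)‖ ^ 2 * b'.areaOn a t' (f z) := by
    intro z hz
    have := ha.transform _ b.mem _ b'.mem (b.pt z t) ⟨Box.pt_mem (hVb z hz) t, hz.2.1⟩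
    rw [← Box.areaOn_z (a := a) (Box.pt_mem (hVb z hz) t), ← Box.areaOn_z (a := a) hz.2.1, hz.2.2.1,
      Box.τ_pt (hVb z hz), Box.z_pt (hVb z hz)] at this
    exact this
  have hat := b.areaOn_pos ha (t := t) (b.z p)
  have hac : ContinuousAt (b.areaOn a t) (b.z p) :=
    (b.continuousOn_areaOn ha).continuousAt (b.φ.isOpen_base.mem_nhds hzb)
  have key : h (b.z p) * b.areaOn a t (b.z p) = h' (f (b.z p)) * b.areaOn a t (b.z p) := by
    refine eq_of_setLIntegral_eq (k₁ := fun z => h z * b.areaOn a t z)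
      (k₂ := fun z => h' (f z) * b.areaOn a t z) hV (H.continuous.continuousAt.mul hac)
      ((ContinuousAt.comp (f := f) H'.continuous.continuousAt hfc).mul hac)
      (mul_nonneg (H.nonneg _) hat.le) (mul_nonneg (H'.nonneg _) hat.le) fun A hAV hA => ?_
    -- a piece of plaque is seen as `A` in the first box and as `f(A)` in the second
    have himg : b.plaque A t = b'.plaque (f '' A) t' := by
      ext q
      constructor
      · rintro ⟨hq, hqz, hqt⟩
        have hqpt : b.pt (b.z q) t = q := by
          rw [← show b.τ q = t from hqt]
          exact Box.pt_z_τ hq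
        have hqV := hAV hqz
        change b.z q ∈ V at hqV
        have h1 := hqV.2.1
        have h2 := hqV.2.2.1
        rw [hqpt] at h1 h2
        exact ⟨h1, ⟨b.z q, hqz, by simp only [hf, hqpt]; rfl⟩, h2⟩
      · rintro ⟨hq, ⟨z, hz, hzq⟩, hqt⟩
        have : q = b.pt z t := by
          rw [← hpt z (hAV hz), hzq, ← show b'.τ q = t' from hqt]
          exact (Box.pt_z_τ hq).symm
        rw [this]
        have hzb := hVb z (hAV hz)
        refine ⟨Box.pt_mem hzb t, ?_, Box.τ_pt hzb t⟩
        have := Box.z_pt hzb t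
        rw [Box.z] at this
        rwa [this]
    have hfA : MeasurableSet (f '' A) := hA.image_of_continuousOn_injOn
      (fun z hz => (hder z (hAV hz)).continuousAt.continuousWithinAt) (hinj.mono hAV)
    rw [← H.measure_plaque hA fun z hz => (hAV hz).1, himg, H'.measure_plaque hfA (by
        rintro _ ⟨z, hz, rfl⟩
        exact (hAV hz).2.2.2),
      lintegral_image_eq_lintegral_abs_det_fderiv_mul volume hA
        (fun z hz => ((hder z (hAV hz)).hasFDerivAt.restrictScalars ℝ).hasFDerivWithinAt)
        (hinj.mono hAV)]
    refine setLIntegral_congr_fun hA fun z hz => ?_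
    have hdet : ∀ d : ℂ, |(ContinuousLinearMap.restrictScalars ℝ
        (ContinuousLinearMap.toSpanSingleton ℂ d)).det| = ‖d‖ ^ 2 := by
      intro d
      have : (ContinuousLinearMap.restrictScalars ℝ
          (ContinuousLinearMap.toSpanSingleton ℂ d)).det = ‖d‖ ^ 2 := by
        simp [ContinuousLinearMap.det, LinearMap.det_restrictScalars,
          Algebra.norm_complex_eq, Complex.normSq_eq_norm_sq]
      rw [this, abs_of_nonneg (by positivity)]
    simp only [hdet]
    rw [← ENNReal.ofReal_mul (by positivity), harea z (hAV hz)]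
    congr 1
    ring
  rw [← hfz]
  exact mul_right_cancel₀ hat.ne' key

variable {ι : Type*} {b : ι → Box lam}

/-- `H` is the density of the measure `μ` with respect to the area form on the plaques of the
boxes where the cutoff function is positive, and it is harmonic there. -/
def IsLeafDensity (b : ι → Box lam) (a : FlowBox Y → Y → ℝ) (μ : Measure Y) (H : Y → ℝ) : Prop :=
  ∀ i t, 0 < (b i).g t → ∃ h, (b i).IsDensity a μ t h ∧
    ∀ q ∈ (b i).plaque (Metric.ball (b i).c (2 * (b i).r)) t, H q = h ((b i).z q)

/-- The densities on the plaques agree on overlaps, so they define a function. -/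
theorem exists_isLeafDensity [T2Space Y] [IsFiniteMeasureOnCompacts μ] (ha : lam.IsAreaForm a)
    {D : Set ℂ} (hD : Dense D)
    (hμ : ∀ i t, 0 < (b i).g t → (b i).HarmonicOnPlaque a D μ t) :
    ∃ H, IsLeafDensity b a μ H := by
  choose h hh using fun i t ht => (hμ i t ht).exists_isDensity ha hD
  let Q : Y → ι → Prop := fun q i => 0 < (b i).g ((b i).τ q) ∧
    q ∈ (b i).plaque (Metric.ball (b i).c (2 * (b i).r)) ((b i).τ q)
  classical
  refine ⟨fun q => if hq : ∃ i, Q q i then h _ _ hq.choose_spec.1 ((b hq.choose).z q) else 0,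
    fun i t ht => ⟨h i t ht, hh i t ht, fun q hq => ?_⟩⟩
  have hqt : (b i).τ q = t := hq.2.2
  have hex : ∃ i, Q q i := ⟨i, by rwa [hqt], by rwa [hqt]⟩
  simp only [dif_pos hex]
  exact Box.IsDensity.eq_of_mem ha (hh _ _ hex.choose_spec.1) (hh i t ht) hex.choose_spec.2 hq

end RiemannSurfaceLamination

/-! ### The energy of test functions on a leaf -/

namespace RiemannSurfaceLamination

variable {Y : Type u} [TopologicalSpace Y] {lam : RiemannSurfaceLamination Y}
  {a : FlowBox Y → Y → ℝ} {f g : Y → ℂ}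

theorem IsTestFunction.contDiffAt_slice (hf : lam.IsTestFunction f) {φ : FlowBox Y}
    (hφ : φ ∈ lam.atlas) {p : Y} (hp : p ∈ φ.chart.source) :
    ContDiffAt ℝ 2 (φ.slice f (φ.chart p).2) (φ.chart p).1 :=
  (hf.familyAt hφ hp).contDiffAt.of_le two_le_infty

theorem ddbarCoeff_add (hf : lam.IsTestFunction f) (hg : lam.IsTestFunction g) :
    lam.ddbarCoeff (fun p => f p + g p) = lam.ddbarCoeff f + lam.ddbarCoeff g := by
  ext φ p
  by_cases hp : p ∈ φ.1.chart.source
  · simp only [ddbarCoeff, Pi.add_apply, indicator_of_mem hp]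
    rw [← mul_add, ← (hf.contDiffAt_slice φ.2 hp).laplacian_add (hg.contDiffAt_slice φ.2 hp)]
    rfl
  · simp [ddbarCoeff, indicator_of_notMem hp]

theorem ddbarCoeff_const_mul (hf : lam.IsTestFunction f) (c : ℂ) :
    lam.ddbarCoeff (fun p => c * f p) = c • lam.ddbarCoeff f := by
  ext φ p
  by_cases hp : p ∈ φ.1.chart.source
  · simp only [ddbarCoeff, Pi.smul_apply, indicator_of_mem hp, smul_eq_mul]
    have : φ.1.slice (fun p => c * f p) (φ.1.chart p).2 = c • φ.1.slice f (φ.1.chart p).2 := rfl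
    rw [this, InnerProductSpace.laplacian_smul _ (hf.contDiffAt_slice φ.2 hp), smul_eq_mul]
    ring
  · simp [ddbarCoeff, indicator_of_notMem hp]

theorem ddbarCoeff_eq_zero {p : Y} (hf : f =ᶠ[𝓝 p] 0) (φ : lam.atlas) :
    lam.ddbarCoeff f φ p = 0 := by
  by_cases hp : p ∈ φ.1.chart.source
  · have h0 : φ.1.slice f (φ.1.chart p).2 =ᶠ[𝓝 (φ.1.chart p).1] fun _ => (0 : ℂ) := by
      have hline : Tendsto (fun z : ℂ => (z, (φ.1.chart p).2)) (𝓝 (φ.1.chart p).1)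
          (𝓝 (φ.1.chart p)) :=
        (by fun_prop : Continuous fun z : ℂ => (z, (φ.1.chart p).2)).tendsto _
      filter_upwards [hline.eventually (FlowBox.eventually_mem hp hf)] with z hz
      exact hz.2
    simp only [ddbarCoeff, indicator_of_mem hp]
    rw [(InnerProductSpace.laplacian_congr_nhds h0).eq_of_nhds]
    simp
  · exact indicator_of_notMem hp _

theorem dens_add (α β : lam.atlas → Y → ℂ) (p : Y) :
    lam.dens a (α + β) p = lam.dens a α p + lam.dens a β p := by
  simp [dens, add_div]

theorem dens_smul (c : ℂ) (α : lam.atlas → Y → ℂ) (p : Y) :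
    lam.dens a (c • α) p = c * lam.dens a α p := by
  simp [dens, mul_div_assoc]

/-- The function `(1 - exp (-H)) / H`: multiplied by a harmonic density `H` it gives the bounded
superharmonic function `1 - exp (-H)`. Its value where `H = 0` is irrelevant. -/
noncomputable def expWeight (H : Y → ℝ) (q : Y) : ℝ := (1 - Real.exp (-H q)) / H q

omit [TopologicalSpace Y] in
theorem expWeight_mem {H : Y → ℝ} {q : Y} (h : 0 ≤ H q) :
    0 ≤ expWeight H q ∧ expWeight H q ≤ 1 := by
  refine ⟨div_nonneg (by simpa using h) h, div_le_one_of_le₀ ?_ h⟩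
  linarith [Real.add_one_le_exp (-H q)]

/-- The function `θ` is supported over the disc of the box, where the cutoff function is
positive. -/
def Box.Subordinate (b : Box lam) (θ : Y → ℂ) : Prop :=
  ∀ q, θ q ≠ 0 → q ∈ boxSet b.φ (Metric.closedBall b.c b.r) {t | 0 < b.g t}

/-- The open set over the disc of twice the radius where the cutoff function is positive. -/
def Box.wide (b : Box lam) : Set Y := boxSet b.φ (Metric.ball b.c (2 * b.r)) {t | 0 < b.g t}

theorem Box.core_subset_wide (b : Box lam) : b.core ⊆ b.wide := fun _ hp =>
  ⟨hp.1, Metric.ball_subset_ball (by linarith [b.r_pos]) hp.2.1, hp.2.2⟩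

theorem Box.mem_plaque_of_wide {b : Box lam} {p : Y} (hp : p ∈ b.wide) :
    p ∈ b.plaque (Metric.ball b.c (2 * b.r)) (b.τ p) := ⟨hp.1, hp.2.1, rfl⟩

theorem Box.wide_subset (b : Box lam) : b.wide ⊆ b.closed := fun _ hp =>
  ⟨hp.1, Metric.ball_subset_closedBall (Metric.ball_subset_ball (by linarith [b.r_pos]) hp.2.1),
    subset_tsupport _ (ne_of_gt hp.2.2)⟩

/-- The form `i∂∂̄θ` of a function subordinate to a box vanishes outside of the open set `b.wide`,
although the support of `θ` may leave it transversally: there, `θ` vanishes on the whole plaque. -/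
theorem Box.Subordinate.dens_eq_zero [T2Space Y] {b : Box lam} {θ : Y → ℂ} (hb : b.Subordinate θ)
    (hθ : lam.IsTestFunction θ) (ha : lam.IsAreaForm a) {q : Y} (hq : q ∉ b.wide) :
    lam.dens a (lam.ddbarCoeff θ) q = 0 := by
  by_cases hqs : q ∈ b.φ.chart.source
  · rw [dens_eq ha (lam.isTestForm_ddbarCoeff hθ) ⟨b.φ, b.mem⟩ hqs]
    simp only [ddbarCoeff, indicator_of_mem hqs]
    suffices h : b.φ.slice θ (b.τ q) =ᶠ[𝓝 (b.z q)] fun _ => (0 : ℂ) by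
      have := (InnerProductSpace.laplacian_congr_nhds h).eq_of_nhds
      rw [Box.τ, Box.z] at this
      rw [this]
      simp
    by_cases hg : 0 < b.g (b.τ q)
    · have hz : b.z q ∈ (Metric.closedBall b.c b.r)ᶜ := fun hz => hq ⟨hqs,
        Metric.closedBall_subset_ball (by linarith [b.r_pos]) hz, hg⟩
      filter_upwards [Metric.isClosed_closedBall.isOpen_compl.mem_nhds hz,
        b.φ.isOpen_base.mem_nhds (Box.z_mem hqs)] with w hw hwb
      by_contra hne
      have := (hb _ hne).2.1
      change b.z (b.pt w (b.τ q)) ∈ _ at this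
      rw [Box.z_pt hwb] at this
      exact hw this
    · filter_upwards [b.φ.isOpen_base.mem_nhds (Box.z_mem hqs)] with w hwb
      by_contra hne
      have := (hb _ hne).2.2
      change 0 < b.g (b.τ (b.pt w (b.τ q))) at this
      rw [Box.τ_pt hwb] at this
      exact hg this
  · have h0 : q ∉ tsupport θ := by
      have hc : IsCompact (boxSet b.φ (Metric.closedBall b.c b.r) (tsupport b.g)) :=
        isCompact_boxSet ((Metric.closedBall_subset_closedBall (by linarith [b.r_pos])).trans
          b.subset_base) (isCompact_closedBall _ _) b.g_supp
      refine fun h => hqs (closure_minimal (fun p hp => ?_) hc.isClosed h).1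
      have := hb p hp
      exact ⟨this.1, this.2.1, subset_tsupport _ (ne_of_gt this.2.2)⟩
    rw [dens, ddbarCoeff_eq_zero (notMem_tsupport_iff_eventuallyEq.1 h0), zero_div]

variable [MeasurableSpace Y] [BorelSpace Y] {μ : Measure Y} {ι : Type*} {b : ι → Box lam}
  {H : Y → ℝ} {p : Y}

omit [BorelSpace Y] in
theorem IsLeafDensity.nonneg (hH : IsLeafDensity b a μ H) (hb : ∀ p, ∃ i, p ∈ (b i).core) (q : Y) :
    0 ≤ H q := by
  obtain ⟨i, hi⟩ := hb q
  obtain ⟨h, hh, hq⟩ := hH i _ hi.2.2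
  rw [hq q (Box.mem_plaque_of_wide (Box.core_subset_wide _ hi))]
  exact hh.nonneg _

/-- The parameters of the plaques of the class of `p` in the box `i`. -/
def leafParams (b : ι → Box lam) (p : Y) (i : ι) : Set (b i).φ.T :=
  {t | 0 < (b i).g t ∧ ∃ q ∈ leafOf b p, q ∈ (b i).closed ∧ (b i).τ q = t}

omit [MeasurableSpace Y] [BorelSpace Y] in
theorem countable_leafParams [Countable ι] (p : Y) (i : ι) : (leafParams b p i).Countable :=
  (countable_plaques (b := b) p i).mono fun _ h => h.2

omit [MeasurableSpace Y] [BorelSpace Y] in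
theorem leaf_inter_wide {i : ι} {q : Y} (hq : q ∈ leafOf b p) (hqi : q ∈ (b i).wide) :
    (b i).τ q ∈ leafParams b p i :=
  ⟨hqi.2.2, q, hq, Box.wide_subset _ hqi, rfl⟩

omit [BorelSpace Y] in
theorem ae_mem_leaf (hμ : μ (leafOf b p)ᶜ = 0) : ∀ᵐ q ∂μ, q ∈ leafOf b p := by
  rw [ae_iff]
  exact hμ

/-- The leaf is a countable union of plaques, and the density is continuous on each of them. -/
theorem IsLeafDensity.aemeasurable [Countable ι] (hH : IsLeafDensity b a μ H)
    (hb : ∀ p, ∃ i, p ∈ (b i).core) (hμ : μ (leafOf b p)ᶜ = 0) : AEMeasurable H μ := by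
  have hc : ∀ i, Countable (leafParams b p i) := fun i => (countable_leafParams p i).to_subtype
  set U : Set Y := ⋃ x : Σ i, leafParams b p i,
    (b x.1).plaque (Metric.ball (b x.1).c (2 * (b x.1).r)) x.2 with hU
  have hr : μ.restrict U = μ := by
    rw [Measure.restrict_eq_self_of_ae_mem]
    filter_upwards [ae_mem_leaf hμ] with q hq
    obtain ⟨i, hi⟩ := hb q
    have hw := Box.core_subset_wide _ hi
    exact mem_iUnion.2 ⟨⟨i, _, leaf_inter_wide hq hw⟩, Box.mem_plaque_of_wide hw⟩
  rw [← hr, hU, aemeasurable_iUnion_iff]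
  rintro ⟨i, t, ht⟩
  obtain ⟨h, hh, hq⟩ := hH i t ht.1
  refine AEMeasurable.congr (f := fun q => h ((b i).z q))
    (hh.continuous.measurable.comp_aemeasurable (Box.aemeasurable_z fun p hp => hp.1)) ?_
  refine (ae_restrict_iff' ((b i).measurableSet_plaque Metric.isOpen_ball.measurableSet t)).2
    (Eventually.of_forall fun q hqp => ?_)
  exact (hq q hqp).symm

/-- The weight `expWeight H` is bounded by one, although `H` may be unbounded. -/
theorem IsLeafDensity.integrable [T2Space Y] [Countable ι] [IsFiniteMeasureOnCompacts μ]
    (hH : IsLeafDensity b a μ H) (hb : ∀ p, ∃ i, p ∈ (b i).core) (hμ : μ (leafOf b p)ᶜ = 0)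
    (ha : lam.IsAreaForm a) (hf : lam.IsTestFunction f) :
    Integrable (fun q => lam.dens a (lam.ddbarCoeff f) q * (expWeight H q : ℂ)) μ := by
  have hα := lam.isTestForm_ddbarCoeff hf
  have h1 : Integrable (lam.dens a (lam.ddbarCoeff f)) μ :=
    (continuous_dens ha hα).integrable_of_hasCompactSupport (hasCompactSupport_dens hα)
  have hm := hH.aemeasurable hb hμ
  have h2 : AEMeasurable (expWeight H) μ :=
    (hm.neg.exp.const_sub 1).div hm
  refine h1.mul_bdd (c := 1) (Complex.measurable_ofReal.comp_aemeasurable h2).aestronglyMeasurable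
    (Eventually.of_forall fun q => ?_)
  obtain ⟨e1, e2⟩ := expWeight_mem (hH.nonneg hb q)
  rw [Complex.norm_real, Real.norm_of_nonneg e1]
  exact e2

/-- The integral of `i∂∂̄f` against the function `1 - exp (-H)`, where `H` is the density of the
measure `μ`. -/
noncomputable def leafEnergy (lam : RiemannSurfaceLamination Y) (a : FlowBox Y → Y → ℝ)
    (μ : Measure Y) (H : Y → ℝ) (f : Y → ℂ) : ℝ :=
  (∫ q, lam.dens a (lam.ddbarCoeff f) q * (expWeight H q : ℂ) ∂μ).re

/-- On a plaque, the energy is the integral of the Laplacian against `1 - exp (-h)`. -/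
theorem IsLeafDensity.setIntegral_plaque (hH : IsLeafDensity b a μ H) (ha : lam.IsAreaForm a)
    {i : ι} {t : (b i).φ.T} (ht : 0 < (b i).g t) (hf : lam.IsTestFunction f) :
    ∃ h, (b i).IsDensity a μ t h ∧
      (∀ q ∈ (b i).plaque (Metric.ball (b i).c (2 * (b i).r)) t, H q = h ((b i).z q)) ∧
      ∫ q in (b i).plaque (Metric.ball (b i).c (2 * (b i).r)) t,
          lam.dens a (lam.ddbarCoeff f) q * (expWeight H q : ℂ) ∂μ =
        1 / 2 * ∫ z in Metric.ball (b i).c (2 * (b i).r),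
          ((1 - Real.exp (-h z) : ℝ) : ℂ) * Laplacian.laplacian ((b i).φ.slice f t) z := by
  obtain ⟨h, hh, hq⟩ := hH i t ht
  refine ⟨h, hh, hq, ?_⟩
  have hr := (b i).r_pos
  set B := Metric.ball (b i).c (2 * (b i).r) with hB
  have hBm : MeasurableSet B := Metric.isOpen_ball.measurableSet
  have hBb : B ⊆ (b i).φ.base := Box.ball_subset_base (by linarith)
  set F : ℂ → ℂ := fun z => (1 / 2 * Laplacian.laplacian ((b i).φ.slice f t) z /
    ((b i).areaOn a t z : ℂ)) * (((1 - Real.exp (-h z)) / h z : ℝ) : ℂ) with hF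
  have e1 : ∫ q in (b i).plaque B t, lam.dens a (lam.ddbarCoeff f) q * (expWeight H q : ℂ) ∂μ =
      ∫ q in (b i).plaque B t, F ((b i).z q) ∂μ := by
    refine setIntegral_congr_fun ((b i).measurableSet_plaque hBm t) fun q hqp => ?_
    have hqs := hqp.1
    have hqt : (b i).τ q = t := hqp.2.2
    have hA : a (b i).φ q = (b i).areaOn a t ((b i).z q) := by
      rw [← hqt, Box.areaOn_z hqs]
    simp only [expWeight, hF]
    rw [dens_eq ha (lam.isTestForm_ddbarCoeff hf) ⟨(b i).φ, (b i).mem⟩ hqs, hq q hqp]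
    simp only [ddbarCoeff, indicator_of_mem hqs, hA, ← hqt]
    rfl
  have hmeas : Measurable fun z => ENNReal.ofReal (h z * (b i).areaOn a t z) :=
    (hh.continuous.measurable.mul ((b i).measurable_areaOn ha)).ennreal_ofReal
  have hFm : AEStronglyMeasurable F (volume.restrict B) := by
    have hL : ContinuousOn (Laplacian.laplacian ((b i).φ.slice f t)) B :=
      (((hf.2 _ (b i).mem).laplacian (b i).φ.isOpen_base).1 t).continuousOn.mono hBb
    have hA : Measurable fun z => ((b i).areaOn a t z : ℂ) :=
      Complex.measurable_ofReal.comp ((b i).measurable_areaOn ha)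
    have hw : Measurable fun z => (((1 - Real.exp (-h z)) / h z : ℝ) : ℂ) := by
      have := hh.continuous.measurable
      fun_prop
    exact ((((hL.aemeasurable hBm).const_mul _).div hA.aemeasurable).mul
      hw.aemeasurable).aestronglyMeasurable
  rw [e1, ← integral_map (Box.aemeasurable_z fun p hp => hp.1), hh.map_eq,
    integral_withDensity_eq_integral_toReal_smul hmeas
      (Eventually.of_forall fun z => ENNReal.ofReal_lt_top), ← integral_const_mul]
  · refine setIntegral_congr_fun hBm fun z hz => ?_
    have hpos := (b i).areaOn_pos ha (t := t) z
    have hA : ((b i).areaOn a t z : ℂ) ≠ 0 := Complex.ofReal_ne_zero.2 hpos.ne'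
    simp only [hF]
    rw [ENNReal.toReal_ofReal (mul_nonneg (hh.nonneg z) hpos.le), Complex.real_smul]
    -- where the density is zero, both sides vanish
    by_cases h0 : h z = 0
    · simp [h0]
    · have h0' : (h z : ℂ) ≠ 0 := Complex.ofReal_ne_zero.2 h0
      push_cast
      field_simp
  · rw [hh.map_eq]
    exact hFm.mono_ac (withDensity_absolutelyContinuous _ _)

end RiemannSurfaceLamination

namespace RiemannSurfaceLamination

variable {Y : Type u} [TopologicalSpace Y] {lam : RiemannSurfaceLamination Y}
  {a : FlowBox Y → Y → ℝ} {f g : Y → ℂ}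

/-! ### Bump functions and partitions of unity -/

/-- The bump function of a box. -/
noncomputable def Box.bump (b : Box lam) : Y → ℂ :=
  boxFun b.φ (fun z => (discBump b.r (z - b.c) : ℂ)) fun t => (b.g t : ℂ)

theorem Box.bump_apply {b : Box lam} {p : Y} (hp : p ∈ b.φ.chart.source) :
    b.bump p = ((discBump b.r (b.z p - b.c) * b.g (b.τ p) : ℝ) : ℂ) := by
  rw [Box.bump, boxFun_apply hp]
  push_cast
  rfl

theorem Box.bump_nonneg (b : Box lam) (p : Y) : 0 ≤ b.bump p := by
  by_cases hp : p ∈ b.φ.chart.source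
  · rw [Box.bump_apply hp]
    exact Complex.zero_le_real.2 (mul_nonneg discBump_nonneg (b.g_nonneg _))
  · rw [Box.bump, boxFun, indicator_of_notMem hp]

theorem Box.bump_subordinate (b : Box lam) : b.Subordinate b.bump := by
  intro q hq
  by_cases hp : q ∈ b.φ.chart.source
  · rw [Box.bump_apply hp, Complex.ofReal_ne_zero] at hq
    have h1 := norm_lt_of_discBump_ne_zero b.r_pos (left_ne_zero_of_mul hq)
    refine ⟨hp, ?_, lt_of_le_of_ne (b.g_nonneg _) (right_ne_zero_of_mul hq).symm⟩
    rw [mem_closedBall_iff_norm]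
    exact h1.le
  · refine absurd ?_ hq
    rw [Box.bump, boxFun, indicator_of_notMem hp]

theorem Box.bump_ne_zero {b : Box lam} {p : Y} (hp : p ∈ b.core) : b.bump p ≠ 0 := by
  rw [Box.bump_apply hp.1, Complex.ofReal_ne_zero]
  refine mul_ne_zero (discBump_pos b.r_pos ?_).ne' (ne_of_gt hp.2.2)
  rw [← mem_ball_iff_norm]
  exact hp.2.1

theorem tsupport_discBump_sub {δ : ℝ} (hδ : 0 < δ) (c : ℂ) :
    tsupport (fun z => (discBump δ (z - c) : ℂ)) ⊆ Metric.closedBall c δ := by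
  refine closure_minimal (fun z hz => ?_) Metric.isClosed_closedBall
  have : discBump δ (z - c) ≠ 0 := fun h => hz (by simp [h])
  rw [mem_closedBall_iff_norm]
  exact (norm_lt_of_discBump_ne_zero hδ this).le

theorem Box.isTestFunction_bump [T2Space Y] (b : Box lam) : lam.IsTestFunction b.bump := by
  have hs := tsupport_discBump_sub b.r_pos b.c
  refine isTestFunction_boxFun b.mem ?_ ?_ ?_ (Complex.continuous_ofReal.comp b.g_cont)
    (b.g_supp.comp_left (g := ((↑) : ℝ → ℂ)) Complex.ofReal_zero)
  · exact (contDiff_ofReal_discBump _).comp (contDiff_id.sub contDiff_const)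
  · exact HasCompactSupport.of_support_subset_isCompact (isCompact_closedBall b.c b.r)
      ((subset_tsupport _).trans hs)
  · exact hs.trans ((Metric.closedBall_subset_closedBall (by linarith [b.r_pos])).trans
      b.subset_base)

/-- A nonnegative test function is a finite sum of nonnegative test functions, each of them
subordinate to a box. -/
theorem IsTestFunction.exists_sum [T2Space Y] {ι : Type*} {b : ι → Box lam}
    (hb : ∀ p, ∃ i, p ∈ (b i).core) (hf : lam.IsTestFunction f) (hf0 : ∀ p, 0 ≤ f p) :
    ∃ (s : Finset ι) (θ : ι → Y → ℂ), (∀ i, lam.IsTestFunction (θ i)) ∧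
      (∀ i p, 0 ≤ θ i p) ∧ (∀ i, (b i).Subordinate (θ i)) ∧ f = fun p => ∑ i ∈ s, θ i p := by
  obtain ⟨s, hs⟩ := hf.1.isCompact.elim_finite_subcover (fun i => (b i).core)
    (fun i => Box.isOpen_core) fun p _ => mem_iUnion.2 (hb p)
  set B : Y → ℂ := fun p => ∑ i ∈ s, (b i).bump p with hB
  have hB0 : ∀ p, 0 ≤ B p := fun p => Finset.sum_nonneg fun i _ => (b i).bump_nonneg p
  have hBK : ∀ p ∈ tsupport f, B p ≠ 0 := by
    intro p hp hp0
    obtain ⟨i, his, hi⟩ := mem_iUnion₂.1 (hs hp)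
    exact Box.bump_ne_zero hi
      ((Finset.sum_eq_zero_iff_of_nonneg fun i _ => (b i).bump_nonneg p).1 hp0 i his)
  refine ⟨s, fun i p => f p * ((b i).bump p * (B p)⁻¹), fun i => ?_, fun i p => ?_, fun i q hq => ?_,
    ?_⟩
  · refine hf.mul_of_leafSmooth fun p hp φ hφ hpφ => ?_
    refine ((b i).isTestFunction_bump.familyAt hφ hpφ).mul ?_
    refine FamilyAt.comp_contDiffAt (f := fun z : ℂ => z⁻¹) (G := φ.slice B) ?_ ?_
    · exact FamilyAt.sum fun j _ => (b j).isTestFunction_bump.familyAt hφ hpφ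
    · have h0 : φ.slice B (φ.chart p).2 (φ.chart p).1 ≠ 0 := by
        rw [FlowBox.slice_chart _ hpφ]
        exact hBK p hp
      filter_upwards [isOpen_ne.mem_nhds h0] with z hz
      exact (contDiffAt_inv ℂ hz).restrict_scalars ℝ
  · exact mul_nonneg (hf0 p) (mul_nonneg ((b i).bump_nonneg p) (inv_nonneg.2 (hB0 p)))
  · exact (b i).bump_subordinate q (left_ne_zero_of_mul (right_ne_zero_of_mul hq))
  · ext p
    rw [← Finset.mul_sum, ← Finset.sum_mul]
    by_cases hp : f p = 0
    · simp [hp]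
    · change f p = f p * (B p * (B p)⁻¹)
      rw [mul_inv_cancel₀ (hBK p (subset_tsupport f hp)), mul_one]

/-! ### The energy is nonpositive -/

variable [MeasurableSpace Y] [BorelSpace Y] {μ : Measure Y} [IsFiniteMeasureOnCompacts μ]
  {ι : Type*} [Countable ι] {b : ι → Box lam} {H : Y → ℝ} {p : Y} [T2Space Y]

theorem IsLeafDensity.leafEnergy_add (hH : IsLeafDensity b a μ H)
    (hb : ∀ p, ∃ i, p ∈ (b i).core) (hμ : μ (leafOf b p)ᶜ = 0) (ha : lam.IsAreaForm a)
    (hf : lam.IsTestFunction f) (hg : lam.IsTestFunction g) :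
    lam.leafEnergy a μ H (fun p => f p + g p) =
      lam.leafEnergy a μ H f + lam.leafEnergy a μ H g := by
  rw [leafEnergy, leafEnergy, leafEnergy, ← Complex.add_re,
    ← integral_add (hH.integrable hb hμ ha hf) (hH.integrable hb hμ ha hg), ddbarCoeff_add hf hg]
  simp only [dens_add, add_mul]

omit [BorelSpace Y] [IsFiniteMeasureOnCompacts μ] [T2Space Y] in
theorem leafEnergy_const_mul (hf : lam.IsTestFunction f) (c : ℝ) :
    lam.leafEnergy a μ H (fun p => c * f p) = c * lam.leafEnergy a μ H f := by
  rw [leafEnergy, leafEnergy, ddbarCoeff_const_mul hf, ← Complex.re_ofReal_mul,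
    ← integral_const_mul]
  simp only [dens_smul, mul_assoc]

/-- The energy of a nonnegative function subordinate to a box is the sum of the contributions of the
countably many plaques of the leaf in the box, all of them nonpositive. If it vanishes, the density
is constant on each of these plaques. -/
theorem IsLeafDensity.leafEnergy_subordinate (hH : IsLeafDensity b a μ H)
    (hb : ∀ p, ∃ i, p ∈ (b i).core) (hμ : μ (leafOf b p)ᶜ = 0) (ha : lam.IsAreaForm a)
    (hf : lam.IsTestFunction f) (hf0 : ∀ p, 0 ≤ f p) {i : ι} (hfi : (b i).Subordinate f) :
    lam.leafEnergy a μ H f ≤ 0 ∧ (lam.leafEnergy a μ H f = 0 → ∀ t ∈ leafParams b p i,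
      (∀ q ∈ (b i).plaque (Metric.ball (b i).c (b i).r) t, f q ≠ 0) →
      ∀ q ∈ (b i).plaque (Metric.ball (b i).c (b i).r) t, H q = H ((b i).pt (b i).c t)) := by
  have hr := (b i).r_pos
  set B := Metric.ball (b i).c (2 * (b i).r) with hB
  have hBb : B ⊆ (b i).φ.base := Box.ball_subset_base (by linarith)
  set F : Y → ℂ := fun q => lam.dens a (lam.ddbarCoeff f) q * (expWeight H q : ℂ) with hF
  have hint : Integrable F μ := hH.integrable hb hμ ha hf
  have hc : Countable (leafParams b p i) := (countable_leafParams p i).to_subtype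
  set P : leafParams b p i → Set Y := fun t => (b i).plaque B t with hP
  have hU : ∫ q in ⋃ t, P t, F q ∂μ = ∫ q, F q ∂μ := by
    refine setIntegral_eq_integral_of_ae_compl_eq_zero ?_
    filter_upwards [ae_mem_leaf hμ] with q hq hqU
    by_cases hw : q ∈ (b i).wide
    · exact absurd (mem_iUnion.2 ⟨⟨_, leaf_inter_wide hq hw⟩, Box.mem_plaque_of_wide hw⟩) hqU
    · simp only [hF]
      rw [hfi.dens_eq_zero hf ha hw, zero_mul]
  have hsum : HasSum (fun t => (∫ q in P t, F q ∂μ).re) (lam.leafEnergy a μ H f) := by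
    have := hasSum_integral_iUnion (s := P) (f := F) (μ := μ)
      (fun t => (b i).measurableSet_plaque Metric.isOpen_ball.measurableSet t.1)
      (fun t t' htt' => disjoint_left.2 fun q hq hq' =>
        htt' (Subtype.ext (hq.2.2.symm.trans hq'.2.2))) hint.integrableOn
    rw [hU] at this
    exact Complex.hasSum_re this
  -- each plaque contributes a nonpositive amount
  have key : ∀ t : leafParams b p i, (∫ q in P t, F q ∂μ).re ≤ 0 ∧ ((∫ q in P t, F q ∂μ).re = 0 →
      (∀ q ∈ (b i).plaque (Metric.ball (b i).c (b i).r) t, f q ≠ 0) →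
      ∀ q ∈ (b i).plaque (Metric.ball (b i).c (b i).r) t, H q = H ((b i).pt (b i).c t)) := by
    rintro ⟨t, ht⟩
    obtain ⟨h, hh, hq, he⟩ := hH.setIntegral_plaque ha ht.1 hf
    have hre : (∫ q in P ⟨t, ht⟩, F q ∂μ).re = 1 / 2 * (∫ z in B,
        ((1 - Real.exp (-h z) : ℝ) : ℂ) * Laplacian.laplacian ((b i).φ.slice f t) z).re := by
      rw [← hB] at he
      simp only [hP, hF]
      rw [he, show (1 / 2 : ℂ) = ((1 / 2 : ℝ) : ℂ) by push_cast; rfl, Complex.re_ofReal_mul]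
    have hx := harmonic_one_sub_exp hh.harmonic (r := (b i).r) (by linarith)
      (θ := (b i).φ.slice f t) (((hf.2 _ (b i).mem).1 t).mono hBb)
      (fun z hz hzr => by
        by_contra hne
        have := (hfi _ hne).2.1
        change (b i).z ((b i).pt z t) ∈ _ at this
        rw [Box.z_pt (hBb hz), mem_closedBall_iff_norm] at this
        linarith) (fun z _ => hf0 _)
    rw [hre]
    refine ⟨by linarith [hx.1], fun h0 hne q hqp => ?_⟩
    have hc' : (b i).c ∈ Metric.ball (b i).c (b i).r := Metric.mem_ball_self hr
    have hsub : Metric.ball (b i).c (b i).r ⊆ B := Metric.ball_subset_ball (by linarith)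
    have hmem : ∀ z ∈ Metric.ball (b i).c (b i).r,
        (b i).pt z t ∈ (b i).plaque (Metric.ball (b i).c (b i).r) t := fun z hz =>
      ⟨Box.pt_mem (hBb (hsub hz)) t, by
        change (b i).z _ ∈ _
        rwa [Box.z_pt (hBb (hsub hz))], Box.τ_pt (hBb (hsub hz)) t⟩
    have hcq := hmem _ hc'
    rw [hq q ⟨hqp.1, hsub hqp.2.1, hqp.2.2⟩, hq _ ⟨hcq.1, hsub hcq.2.1, hcq.2.2⟩,
      Box.z_pt (hBb (hsub hc'))]
    exact hx.2 (by linarith) (b i).r (by linarith) (fun z hz => hne _ (hmem z hz)) _ hqp.2.1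
  refine ⟨hsum.nonpos fun t => (key t).1, fun h0 t ht hne => ?_⟩
  rw [h0] at hsum
  have hz := (hasSum_zero_iff_of_nonneg (f := fun t => -(∫ q in P t, F q ∂μ).re)
    (fun t => neg_nonneg.2 (key t).1)).1 (by simpa using hsum.neg)
  exact (key ⟨t, ht⟩).2 (by simpa using congrFun hz ⟨t, ht⟩) hne

/-- The function `1 - exp (-H)` is superharmonic on the leaf. -/
theorem IsLeafDensity.leafEnergy_nonpos (hH : IsLeafDensity b a μ H)
    (hb : ∀ p, ∃ i, p ∈ (b i).core) (hμ : μ (leafOf b p)ᶜ = 0) (ha : lam.IsAreaForm a)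
    (hf : lam.IsTestFunction f) (hf0 : ∀ p, 0 ≤ f p) : lam.leafEnergy a μ H f ≤ 0 := by
  obtain ⟨s, θ, h1, h2, h3, rfl⟩ := hf.exists_sum hb hf0
  have hzero : lam.IsTestFunction fun _ => (0 : ℂ) := by
    simpa using hf.const_mul 0
  have : lam.IsTestFunction (fun p => ∑ i ∈ s, θ i p) ∧
      lam.leafEnergy a μ H (fun p => ∑ i ∈ s, θ i p) ≤ 0 := by
    clear hf hf0
    classical
    induction s using Finset.induction_on with
    | empty =>
      simp only [Finset.sum_empty]
      refine ⟨hzero, ?_⟩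
      have := leafEnergy_const_mul (a := a) (μ := μ) (H := H) hzero 0
      simp only [mul_zero, zero_mul] at this
      exact this.le
    | insert i s hi ih =>
      simp only [Finset.sum_insert hi]
      refine ⟨(h1 i).add ih.1, ?_⟩
      rw [hH.leafEnergy_add hb hμ ha (h1 i) ih.1]
      exact add_nonpos (hH.leafEnergy_subordinate hb hμ ha (h1 i) (h2 i) (h3 i)).1 ih.2
  exact this.2

end RiemannSurfaceLamination

/-! ### Harmonic measures on a leaf that is not closed vanish -/

namespace RiemannSurfaceLamination

variable {Y : Type u} [TopologicalSpace Y] {lam : RiemannSurfaceLamination Y}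

/-- The existence of cutoff functions, tending to `1` up to a factor, whose negative Laplacian
tends to zero. The form `i∂∂̄f` of a test function `f` bounds the negative parts of all of
them. -/
def HasCutoffs (lam : RiemannSurfaceLamination Y) : Prop :=
  ∃ (χ : ℕ → Y → ℂ) (f : Y → ℂ), lam.IsTestFunction f ∧ (∀ n, lam.IsTestFunction (χ n)) ∧
    (∀ n p, 0 ≤ χ n p) ∧ (∀ K, IsCompact K → ∀ᶠ n in atTop, ∀ p ∈ K, (1 / 2 : ℝ) ≤ (χ n p).re) ∧
    ∀ (n : ℕ) (φ : lam.atlas) (p : Y),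
      -(1 / ((n : ℝ) + 1)) * ‖lam.ddbarCoeff f φ p‖ ≤ (lam.ddbarCoeff (χ n) φ p).re

variable {a : FlowBox Y → Y → ℝ} [MeasurableSpace Y] [BorelSpace Y] {μ : Measure Y}
  [IsFiniteMeasureOnCompacts μ] {ι : Type*} [Countable ι] {b : ι → Box lam} {H : Y → ℝ} {p : Y}
  [T2Space Y]

/-- With cutoff functions at hand, the energy vanishes: the energy of the cutoff functions tends to
zero, and a multiple of them dominates any given test function. -/
theorem IsLeafDensity.leafEnergy_eq_zero (hH : IsLeafDensity b a μ H)
    (hb : ∀ p, ∃ i, p ∈ (b i).core) (hμ : μ (leafOf b p)ᶜ = 0) (ha : lam.IsAreaForm a)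
    (hcut : lam.HasCutoffs) {θ : Y → ℂ} (hθ : lam.IsTestFunction θ) (hθ0 : ∀ p, 0 ≤ θ p) :
    lam.leafEnergy a μ H θ = 0 := by
  obtain ⟨χ, f, hf, hχ, hχ0, hχ1, hχf⟩ := hcut
  refine le_antisymm (hH.leafEnergy_nonpos hb hμ ha hθ hθ0) ?_
  have hα := lam.isTestForm_ddbarCoeff hf
  have hi : Integrable (lam.dens a (lam.ddbarCoeff f)) μ :=
    (continuous_dens ha hα).integrable_of_hasCompactSupport (hasCompactSupport_dens hα)
  set C := ∫ q, ‖lam.dens a (lam.ddbarCoeff f) q‖ ∂μ with hC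
  -- the energy of the cutoff functions is bounded below, since `expWeight H ≤ 1`
  have hlow : ∀ n : ℕ, -(1 / ((n : ℝ) + 1)) * C ≤ lam.leafEnergy a μ H (χ n) := by
    intro n
    have hin := hH.integrable hb hμ ha (hχ n)
    rw [leafEnergy, hC, ← integral_const_mul]
    have hre : (∫ q, lam.dens a (lam.ddbarCoeff (χ n)) q * (expWeight H q : ℂ) ∂μ).re =
        ∫ q, (lam.dens a (lam.ddbarCoeff (χ n)) q * (expWeight H q : ℂ)).re ∂μ :=
      (Complex.reCLM.integral_comp_comm hin).symm
    rw [hre]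
    refine integral_mono (hi.norm.const_mul _) hin.re fun q => ?_
    obtain ⟨φ, hφ, hq⟩ := lam.cover q
    obtain ⟨w0, w1⟩ := expWeight_mem (hH.nonneg hb q)
    have ha0 := ha.pos φ hφ q hq
    have h1 := hχf n ⟨φ, hφ⟩ q
    have hn : 0 ≤ 1 / ((n : ℝ) + 1) := by positivity
    simp only [Complex.re_mul_ofReal]
    rw [dens_eq ha hα ⟨φ, hφ⟩ hq, dens_eq ha (lam.isTestForm_ddbarCoeff (hχ n)) ⟨φ, hφ⟩ hq,
      norm_div, Complex.norm_real, Real.norm_of_nonneg ha0.le, Complex.div_ofReal_re]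
    set N := ‖lam.ddbarCoeff f ⟨φ, hφ⟩ q‖ with hN
    have hN0 : 0 ≤ N / a φ q := div_nonneg (norm_nonneg _) ha0.le
    calc -(1 / ((n : ℝ) + 1)) * (N / a φ q)
        ≤ -(1 / ((n : ℝ) + 1)) * (N / a φ q) * expWeight H q := by
          nlinarith [mul_nonneg (mul_nonneg hn hN0) (sub_nonneg.2 w1)]
      _ ≤ (lam.ddbarCoeff (χ n) ⟨φ, hφ⟩ q).re / a φ q * expWeight H q := by
          refine mul_le_mul_of_nonneg_right ?_ w0
          rw [← mul_div_assoc]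
          exact div_le_div_of_nonneg_right h1 ha0.le
  obtain ⟨M, hM⟩ : ∃ M, ∀ p, ‖θ p‖ ≤ M := by
    refine hθ.1.exists_bound_of_continuous (continuous_iff_continuousAt.2 fun q => ?_)
    obtain ⟨φ, hφ, hq⟩ := lam.cover q
    have h1 := ContinuousAt.comp (f := φ.chart) (x := q) (hθ.familyAt hφ hq).continuousAt
      (φ.chart.continuousAt hq)
    refine h1.congr ?_
    filter_upwards [φ.chart.open_source.mem_nhds hq] with s hs
    exact FlowBox.slice_chart _ hs
  have hM0 : 0 ≤ M := (norm_nonneg _).trans (hM p)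
  -- compare `θ` with a multiple of the cutoff functions
  have hcomp : ∀ᶠ n : ℕ in atTop, 2 * M * (-(1 / ((n : ℝ) + 1)) * C) ≤ lam.leafEnergy a μ H θ := by
    filter_upwards [hχ1 _ hθ.1] with n hn
    have h1 := (hχ n).const_mul ((2 * M : ℝ) : ℂ)
    have h2 := hθ.const_mul ((-1 : ℝ) : ℂ)
    have hnn : ∀ p, 0 ≤ ((2 * M : ℝ) : ℂ) * χ n p + ((-1 : ℝ) : ℂ) * θ p := by
      intro p
      have hre : ∀ {z : ℂ}, 0 ≤ z → ((z.re : ℝ) : ℂ) = z := fun hz =>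
        Complex.ext rfl (Complex.le_def.1 hz).2
      rw [← hre (hχ0 n p), ← hre (hθ0 p)]
      have hx : 0 ≤ (χ n p).re := (Complex.le_def.1 (hχ0 n p)).1
      have : 0 ≤ 2 * M * (χ n p).re + -1 * (θ p).re := by
        by_cases hp : p ∈ tsupport θ
        · have := (Complex.re_le_norm (θ p)).trans (hM p)
          nlinarith [hn p hp]
        · rw [image_eq_zero_of_notMem_tsupport hp]
          simpa using mul_nonneg (mul_nonneg zero_le_two hM0) hx
      exact_mod_cast this
    have h3 := hH.leafEnergy_nonpos hb hμ ha (h1.add h2) hnn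
    rw [hH.leafEnergy_add hb hμ ha h1 h2, leafEnergy_const_mul (hχ n),
      leafEnergy_const_mul hθ] at h3
    nlinarith [mul_le_mul_of_nonneg_left (hlow n) (by positivity : 0 ≤ 2 * M)]
  have hlim : Tendsto (fun n : ℕ => 2 * M * (-(1 / ((n : ℝ) + 1)) * C)) atTop
      (𝓝 (2 * M * (-0 * C))) :=
    ((tendsto_one_div_add_atTop_nhds_zero_nat.neg).mul_const C).const_mul (2 * M)
  simpa using le_of_tendsto hlim hcomp

/-- With cutoff functions at hand, the density of a harmonic measure on a leaf is constant. -/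
theorem IsLeafDensity.eq_of_mem_leafOf (hH : IsLeafDensity b a μ H)
    (hb : ∀ p, ∃ i, p ∈ (b i).core) (hμ : μ (leafOf b p)ᶜ = 0) (ha : lam.IsAreaForm a)
    (hcut : lam.HasCutoffs) {q : Y} (hq : q ∈ leafOf b p) : H q = H p := by
  -- the bump function of a box is positive on its core, and its energy vanishes
  have hcore : ∀ i, ∀ t ∈ leafParams b p i,
      ∀ q ∈ (b i).plaque (Metric.ball (b i).c (b i).r) t, H q = H ((b i).pt (b i).c t) :=
    fun i t ht => (hH.leafEnergy_subordinate hb hμ ha (b i).isTestFunction_bump (b i).bump_nonneg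
      (b i).bump_subordinate).2 (hH.leafEnergy_eq_zero hb hμ ha hcut (b i).isTestFunction_bump
        (b i).bump_nonneg) t ht fun q hq => Box.bump_ne_zero ⟨hq.1, hq.2.1, by
          rw [hq.2.2]
          exact ht.1⟩
  induction hq with
  | refl => rfl
  | @tail q s hq hqs ih =>
    obtain ⟨i, h1, h2, h3⟩ := hqs
    rw [← ih]
    -- the density is locally constant on each plaque, hence constant
    have key := (convex_closedBall (b i).c (4 * (b i).r)).isPreconnected.induction₂
      (fun w w' => H ((b i).pt w' ((b i).τ q)) = H ((b i).pt w ((b i).τ q))) ?_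
      (fun _ _ _ _ _ _ h h' => h'.trans h) (fun _ _ _ _ h => h.symm) h1.2.1 h2.2.1
    · change H ((b i).pt ((b i).z s) ((b i).τ q)) = H ((b i).pt ((b i).z q) ((b i).τ q)) at key
      rw [Box.pt_z_τ h1.1, h3, Box.pt_z_τ h2.1] at key
      exact key
    · intro w hw
      refine Filter.Eventually.filter_mono nhdsWithin_le_nhds ?_
      have hwb := (b i).subset_base hw
      set x := (b i).pt w ((b i).τ q) with hx
      have hxs : x ∈ (b i).φ.chart.source := Box.pt_mem hwb _
      have hxz : (b i).z x = w := Box.z_pt hwb _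
      have hxt : (b i).τ x = (b i).τ q := Box.τ_pt hwb _
      have hxl : x ∈ leafOf b p := by
        refine mem_leafOf_trans hq (mem_leafOf_of_τ_eq h1 ⟨hxs, ?_, ?_⟩ hxt.symm)
        · change (b i).z x ∈ _
          rwa [hxz]
        · change (b i).τ x ∈ _
          rw [hxt]
          exact h1.2.2
      obtain ⟨j, hj⟩ := hb x
      have e1 := Box.eventually_τ_eq hxs hj.1
      have e2 : ∀ᶠ w in 𝓝 ((b i).z x), (b i).pt w ((b i).τ x) ∈ (b j).core := by
        refine (Box.continuousAt_pt (Box.z_mem hxs) _).eventually ?_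
        simp only [Box.pt_z_τ hxs]
        exact Box.isOpen_core.mem_nhds hj
      rw [hxz, hxt] at e1 e2
      have ht := leaf_inter_wide hxl (Box.core_subset_wide _ hj)
      filter_upwards [e1, e2] with w' h1 h2
      rw [hcore j _ ht _ ⟨h2.1, h2.2.1, h1.2⟩, hcore j _ ht x ⟨hj.1, hj.2.1, rfl⟩]

/-- A measure on a leaf which is harmonic on the plaques is zero, if the leaf is not closed: its
density is a constant, and infinitely many plaques of equal size would accumulate at a point of the
closure outside of the leaf. -/
theorem measure_eq_zero_of_not_isClosed (hb : ∀ p, ∃ i, p ∈ (b i).core)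
    (hμ : μ (leafOf b p)ᶜ = 0) (ha : lam.IsAreaForm a) (hcut : lam.HasCutoffs) {D : Set ℂ}
    (hD : Dense D) (hharm : ∀ i t, 0 < (b i).g t → (b i).HarmonicOnPlaque a D μ t)
    (hcl : ¬ IsClosed (leafOf b p)) : μ = 0 := by
  obtain ⟨H, hH⟩ := exists_isLeafDensity ha hD hharm
  have hconst : ∀ q ∈ leafOf b p, H q = H p := fun q hq =>
    hH.eq_of_mem_leafOf hb hμ ha hcut hq
  -- the plaques with these parameters belong to the leaf
  have hpm : ∀ i, ∀ t ∈ leafParams b p i, ∀ w ∈ Metric.ball (b i).c (b i).r,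
      (b i).pt w t ∈ leafOf b p := by
    rintro i t ⟨ht0, q, hq, hqi, rfl⟩ w hw
    have hw4 : w ∈ Metric.closedBall (b i).c (4 * (b i).r) :=
      Metric.ball_subset_closedBall (Metric.ball_subset_ball (by linarith [(b i).r_pos]) hw)
    have hwb := (b i).subset_base hw4
    refine mem_leafOf_trans hq (mem_leafOf_of_τ_eq hqi ⟨Box.pt_mem hwb _, ?_, ?_⟩
      (Box.τ_pt hwb _).symm)
    · change (b i).z _ ∈ _
      rwa [Box.z_pt hwb]
    · change (b i).τ _ ∈ _
      rw [Box.τ_pt hwb]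
      exact hqi.2.2
  have hmass : ∀ i, ∀ t ∈ leafParams b p i, μ ((b i).plaque (Metric.ball (b i).c (b i).r) t) =
      ∫⁻ z in Metric.ball (b i).c (b i).r, ENNReal.ofReal (H p * (b i).areaOn a t z) := by
    intro i t ht
    have hr := (b i).r_pos
    have hsub : Metric.ball (b i).c (b i).r ⊆ Metric.ball (b i).c (2 * (b i).r) :=
      Metric.ball_subset_ball (by linarith)
    obtain ⟨h, hh, hq⟩ := hH i t ht.1
    rw [hh.measure_plaque Metric.isOpen_ball.measurableSet hsub]
    refine setLIntegral_congr_fun Metric.isOpen_ball.measurableSet fun z hz => ?_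
    have hzb : z ∈ (b i).φ.base := Box.ball_subset_base (by linarith) hz
    have hz' : (b i).pt z t ∈ (b i).plaque (Metric.ball (b i).c (2 * (b i).r)) t :=
      ⟨Box.pt_mem hzb t, by
        change (b i).z _ ∈ _
        rw [Box.z_pt hzb]
        exact hsub hz, Box.τ_pt hzb t⟩
    have := hq _ hz'
    rw [hconst _ (hpm i t ht z hz), Box.z_pt hzb] at this
    simp only [this]
  rcases (hH.nonneg hb p).eq_or_lt with h0 | h0
  · -- the density is zero
    rw [← Measure.measure_univ_eq_zero]
    refine measure_mono_null (t := (leafOf b p)ᶜ ∪ ⋃ i, ⋃ t ∈ leafParams b p i,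
      (b i).plaque (Metric.ball (b i).c (b i).r) t) (fun q _ => ?_) (measure_union_null hμ
        (measure_iUnion_null fun i => (measure_biUnion_null_iff (countable_leafParams p i)).2
          fun t ht => ?_))
    · by_cases hq : q ∈ leafOf b p
      · obtain ⟨i, hi⟩ := hb q
        exact Or.inr (mem_iUnion.2 ⟨i, mem_iUnion₂.2
          ⟨_, leaf_inter_wide hq (Box.core_subset_wide _ hi), hi.1, hi.2.1, rfl⟩⟩)
      · exact Or.inl hq
    · rw [hmass i t ht, ← h0]
      simp
  · exfalso
    obtain ⟨q, hqcl, hq⟩ : ∃ q ∈ closure (leafOf b p), q ∉ leafOf b p := by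
      by_contra! h
      exact hcl (closure_subset_iff_isClosed.1 h)
    obtain ⟨i, hi⟩ := hb q
    have hr := (b i).r_pos
    set A : Set (b i).φ.T := {t | ∃ s ∈ leafOf b p, s ∈ (b i).core ∧ (b i).τ s = t} with hA
    have hAl : A ⊆ leafParams b p i := by
      rintro t ⟨s, hs, hsc, rfl⟩
      exact leaf_inter_wide hs (Box.core_subset_wide _ hsc)
    -- the leaf has infinitely many plaques near `q`
    have hAinf : A.Infinite := by
      intro hfin
      have h1 : (b i).τ q ∈ closure A := by
        have hc : ContinuousAt (b i).τ q :=
          (b i).continuousOn_τ.continuousAt ((b i).φ.chart.open_source.mem_nhds hi.1)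
        rw [mem_closure_iff_nhds]
        intro N hN
        obtain ⟨s, hs, hsl⟩ := mem_closure_iff_nhds.1 hqcl _
          (Filter.inter_mem (hc hN) (Box.isOpen_core.mem_nhds hi))
        exact ⟨(b i).τ s, hs.1, s, hsl, hs.2, rfl⟩
      rw [hfin.isClosed.closure_eq] at h1
      obtain ⟨s, hs, hsc, hst⟩ := h1
      exact hq (mem_leafOf_trans hs
        (mem_leafOf_of_τ_eq (Box.core_subset hsc) (Box.core_subset hi) hst))
    -- each of them has mass bounded below
    obtain ⟨m, hm, hma⟩ : ∃ m > 0, ∀ s ∈ (b i).closed, m ≤ a (b i).φ s := by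
      have hne : (b i).closed.Nonempty := ⟨q, Box.core_subset hi⟩
      obtain ⟨s, hs, hmin⟩ := (Box.isCompact_closed (b := b i)).exists_isMinOn hne
        ((ha.continuousOn _ (b i).mem).mono fun s hs => hs.1)
      exact ⟨a (b i).φ s, ha.pos _ (b i).mem s hs.1, fun s' hs' => hmin hs'⟩
    set ε := ENNReal.ofReal (H p * m) * volume (Metric.ball (b i).c (b i).r) with hε
    have hε0 : 0 < ε := ENNReal.mul_pos (by simpa using mul_pos h0 hm)
      (Metric.measure_ball_pos _ _ hr).ne'
    have hsub4 : Metric.ball (b i).c (b i).r ⊆ Metric.closedBall (b i).c (4 * (b i).r) :=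
      (Metric.ball_subset_ball (by linarith)).trans Metric.ball_subset_closedBall
    have hlow : ∀ t : A, ε ≤ μ ((b i).plaque (Metric.ball (b i).c (b i).r) t) := by
      rintro ⟨t, ht⟩
      rw [hmass i t (hAl ht), hε, ← setLIntegral_const]
      refine setLIntegral_mono' Metric.isOpen_ball.measurableSet fun z hz => ?_
      refine ENNReal.ofReal_le_ofReal (mul_le_mul_of_nonneg_left ?_ h0.le)
      have hzb := (b i).subset_base (hsub4 hz)
      rw [Box.areaOn_apply hzb]
      refine hma _ ⟨Box.pt_mem hzb t, ?_, ?_⟩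
      · change (b i).z _ ∈ _
        rw [Box.z_pt hzb]
        exact hsub4 hz
      · change (b i).τ _ ∈ _
        rw [Box.τ_pt hzb]
        exact subset_tsupport _ (hAl ht).1.ne'
    have hAcl : ⋃ t : A, (b i).plaque (Metric.ball (b i).c (b i).r) t ⊆ (b i).closed :=
      iUnion_subset fun t s hs => ⟨hs.1, hsub4 hs.2.1, by
        rw [hs.2.2]
        exact subset_tsupport _ (hAl t.2).1.ne'⟩
    -- disjoint sets of mass at least `ε` in a set of finite measure are finite in number
    have hfin := Measure.finite_const_le_meas_of_disjoint_iUnion μ hε0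
      (As := fun t : A => (b i).plaque (Metric.ball (b i).c (b i).r) t)
      (fun t => (b i).measurableSet_plaque Metric.isOpen_ball.measurableSet t.1)
      (fun t t' htt' => disjoint_left.2 fun q hq hq' =>
        htt' (Subtype.ext (hq.2.2.symm.trans hq'.2.2)))
      (ne_of_lt (lt_of_le_of_lt (measure_mono hAcl)
        (Box.isCompact_closed (b := b i)).measure_lt_top))
    have huniv : {t : A | ε ≤ μ ((b i).plaque (Metric.ball (b i).c (b i).r) t)} = univ :=
      eq_univ_of_forall hlow
    rw [huniv, finite_univ_iff] at hfin
    exact hAinf (Set.toFinite A)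

end RiemannSurfaceLamination

/-! ### Disintegration of measures along a map -/

open ProbabilityTheory in
/-- The disintegration of a σ-finite measure along a measurable map, with the properties of the
conditional measures that are needed for harmonic measures. It is reduced to a finite measure by
means of a positive weight; the conditional measures of the joint law of `π p` and `p` are then
divided by the weight. -/
theorem exists_disintegration {Y : Type*} [MeasurableSpace Y] [StandardBorelSpace Y] [Nonempty Y]
    (m : Measure Y) [SigmaFinite m] {π : Y → Y} (hπ : Measurable π) :
    ∃ (ν : Measure Y) (M : Y → Measure Y), (∀ t, M t ≠ 0) ∧ (∀ᵐ t ∂ν, ∀ᵐ p ∂M t, π p = t) ∧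
      (∀ N, MeasurableSet N → ν N = 0 → m (π ⁻¹' N) = 0) ∧
      (∀ C, MeasurableSet C → m C ≠ ⊤ → ∀ᵐ t ∂ν, M t C < ⊤) ∧
      (∀ C, MeasurableSet C → m C = 0 → ∀ᵐ t ∂ν, M t C = 0) ∧
      ∀ Φ : Y → ℂ, Measurable Φ → Integrable Φ m →
        (∀ A, MeasurableSet A → ∫ p in π ⁻¹' A, Φ p ∂m = 0) → ∀ᵐ t ∂ν, ∫ p, Φ p ∂M t = 0 := by
  -- a positive weight of finite integral
  obtain ⟨w, hw0, hwm, hw⟩ := exists_pos_lintegral_lt_of_sigmaFinite m one_ne_zero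
  set k : Y → ENNReal := fun p => (w p : ENNReal) with hk
  have hkm : Measurable k := hwm.coe_nnreal_ennreal
  have hk0 : ∀ p, k p ≠ 0 := fun p => by simpa [hk] using (hw0 p).ne'
  have hkt : ∀ p, k p ≠ ⊤ := fun p => ENNReal.coe_ne_top
  have hfin : IsFiniteMeasure (m.withDensity k) := isFiniteMeasure_withDensity (hw.trans_le le_top).ne
  have hgm : Measurable fun p => (π p, p) := hπ.prodMk measurable_id
  set ρ : Measure (Y × Y) := (m.withDensity k).map fun p => (π p, p) with hρ
  have hρfin : IsFiniteMeasure ρ := Measure.isFiniteMeasure_map _ _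
  have hinv : Measurable k⁻¹ := hkm.inv
  have hfst : ρ.fst = (m.withDensity k).map π := by
    rw [hρ]
    exact Measure.fst_map_prodMk measurable_id
  -- the measure `m` is the mixture of the conditional measures
  have hlint : ∀ C, MeasurableSet C →
      ∫⁻ t, (ρ.condKernel t).withDensity k⁻¹ C ∂ρ.fst = m C := by
    intro C hC
    have hF : Measurable fun x : Y × Y => C.indicator k⁻¹ x.2 :=
      (hinv.indicator hC).comp measurable_snd
    have e := Measure.lintegral_condKernel (ρ := ρ) hF
    simp only [lintegral_indicator hC] at e
    simp only [withDensity_apply _ hC]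
    rw [e, hρ, lintegral_map hF hgm, ← lintegral_indicator_one hC]
    refine (lintegral_withDensity_eq_lintegral_mul _ hkm (hF.comp hgm)).trans ?_
    refine lintegral_congr fun p => ?_
    by_cases hp : p ∈ C
    · simp [hp, ENNReal.mul_inv_cancel (hk0 p) (hkt p)]
    · simp [hp]
  have hker : ∀ C, MeasurableSet C →
      Measurable fun t => (ρ.condKernel t).withDensity k⁻¹ C := by
    intro C hC
    simp only [withDensity_apply _ hC]
    exact (hinv.setLIntegral_kernel hC)
  refine ⟨ρ.fst, fun t => (ρ.condKernel t).withDensity k⁻¹, fun t h => ?_, ?_, ?_, ?_, ?_, ?_⟩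
  · have hac : ρ.condKernel t ≪ (ρ.condKernel t).withDensity k⁻¹ :=
      withDensity_absolutelyContinuous' hinv.aemeasurable
        (Eventually.of_forall fun p => by simp [hkt p])
    rw [show (ρ.condKernel t).withDensity k⁻¹ = 0 from h] at hac
    have := hac (s := univ) (by simp)
    simp at this
  · have hm : MeasurableSet {x : Y × Y | π x.2 = x.1} :=
      measurableSet_eq_fun (hπ.comp measurable_snd) measurable_fst
    have h : ∀ᵐ x ∂(ρ.fst ⊗ₘ ρ.condKernel), π x.2 = x.1 := by
      rw [ρ.disintegrate ρ.condKernel, hρ, ae_map_iff hgm.aemeasurable hm]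
      exact Eventually.of_forall fun p => rfl
    filter_upwards [Measure.ae_ae_of_ae_compProd h] with t ht
    exact (withDensity_absolutelyContinuous _ _).ae_le ht
  · intro N hN h0
    rw [hfst, Measure.map_apply hπ hN] at h0
    exact withDensity_absolutelyContinuous' hkm.aemeasurable
      (Eventually.of_forall fun p => hk0 p) h0
  · intro C hC hCt
    exact ae_lt_top (hker C hC) (by rwa [hlint C hC])
  · intro C hC hC0
    exact (lintegral_eq_zero_iff (hker C hC)).1 (by rw [hlint C hC, hC0])
  · intro Φ hΦ hΦi h0
    have hreal : ∀ p, (k⁻¹ p).toReal = (w p : ℝ)⁻¹ := fun p => by simp [hk]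
    have hF : Measurable fun x : Y × Y => (k⁻¹ x.2).toReal • Φ x.2 := by fun_prop
    have hcancel : ∀ p, k p * ‖(k⁻¹ p).toReal • Φ p‖ₑ = ‖Φ p‖ₑ := by
      intro p
      rw [hreal, enorm_smul, ← mul_assoc, Real.enorm_eq_ofReal (by positivity)]
      have : k p * ENNReal.ofReal ((w p : ℝ)⁻¹) = 1 := by
        rw [ENNReal.ofReal_inv_of_pos (by exact_mod_cast hw0 p), ENNReal.ofReal_coe_nnreal]
        exact ENNReal.mul_inv_cancel (hk0 p) (hkt p)
      rw [this, one_mul]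
    have hFi : Integrable (fun x : Y × Y => (k⁻¹ x.2).toReal • Φ x.2) ρ := by
      refine ⟨hF.aestronglyMeasurable, ?_⟩
      rw [HasFiniteIntegral, hρ, lintegral_map hF.enorm hgm]
      refine lt_of_eq_of_lt ((lintegral_withDensity_eq_lintegral_mul _ hkm
        (hF.enorm.comp hgm)).trans (lintegral_congr fun p => ?_)) hΦi.2
      simpa using hcancel p
    have hset : ∀ A, MeasurableSet A →
        ∫ t in A, ∫ p, (k⁻¹ p).toReal • Φ p ∂ρ.condKernel t ∂ρ.fst = 0 := by
      intro A hA
      have e := Measure.setIntegral_condKernel_univ_right (ρ := ρ) hA hFi.integrableOn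
      rw [e, hρ, setIntegral_map (hA.prod MeasurableSet.univ) hF.aestronglyMeasurable
        hgm.aemeasurable, ← h0 A hA, setIntegral_withDensity_eq_setIntegral_toReal_smul hkm
        (Eventually.of_forall fun p => (hkt p).lt_top) _ (hgm (hA.prod MeasurableSet.univ))]
      have : (fun p => (π p, p)) ⁻¹' A ×ˢ univ = π ⁻¹' A := by
        ext p
        simp
      rw [this]
      refine setIntegral_congr_fun (hπ hA) fun p _ => ?_
      have hw' : (w p : ℝ) ≠ 0 := by exact_mod_cast (hw0 p).ne'
      simp only [hreal]
      rw [show (k p).toReal = (w p : ℝ) from rfl, smul_smul, mul_inv_cancel₀ hw', one_smul]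
    have hint : Integrable (fun t => ∫ p, (k⁻¹ p).toReal • Φ p ∂ρ.condKernel t) ρ.fst :=
      hFi.integral_condKernel
    filter_upwards [hint.ae_eq_zero_of_forall_setIntegral_eq_zero fun A hA _ => hset A hA] with t ht
    rw [integral_withDensity_eq_integral_toReal_smul hinv
      (Eventually.of_forall fun p => by simpa [pos_iff_ne_zero] using hk0 p)]
    exact ht

/-! ### Conditional measures of harmonic measures -/

namespace RiemannSurfaceLamination

variable {Y : Type u} [TopologicalSpace Y] {lam : RiemannSurfaceLamination Y} [T2Space Y]
  {a : FlowBox Y → Y → ℝ} {b : Box lam}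

theorem laplacian_eq_zero_of_notMem_tsupport {u : ℂ → ℂ} {z : ℂ} (hz : z ∉ tsupport u) :
    Laplacian.laplacian u z = 0 := by
  have h : u =ᶠ[𝓝 z] fun _ => (0 : ℂ) := notMem_tsupport_iff_eventuallyEq.1 hz
  rw [(InnerProductSpace.laplacian_congr_nhds h).eq_of_nhds]
  simp

omit [T2Space Y] in
theorem Box.hasCompactSupport_of_subset {u : ℂ → ℂ}
    (hub : tsupport u ⊆ Metric.ball b.c (4 * b.r)) : HasCompactSupport u :=
  HasCompactSupport.of_support_subset_isCompact (isCompact_closedBall b.c (4 * b.r))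
    ((subset_tsupport u).trans (hub.trans Metric.ball_subset_closedBall))

theorem Box.isTestFunction_boxFun {u : ℂ → ℂ} (hu : ContDiff ℝ ∞ u)
    (hub : tsupport u ⊆ Metric.ball b.c (4 * b.r)) {k : b.φ.T → ℂ} (hk : Continuous k)
    (hkc : HasCompactSupport k) : lam.IsTestFunction (boxFun b.φ u k) :=
  RiemannSurfaceLamination.isTestFunction_boxFun b.mem hu (b.hasCompactSupport_of_subset hub)
    (hub.trans (b.ball_subset_base le_rfl)) hk hkc

theorem Box.dens_boxFun (ha : lam.IsAreaForm a) {u : ℂ → ℂ} (hu : ContDiff ℝ ∞ u)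
    (hub : tsupport u ⊆ Metric.ball b.c (4 * b.r)) {k : b.φ.T → ℂ} (hk : Continuous k)
    (hkc : HasCompactSupport k) (q : Y) : lam.dens a (lam.ddbarCoeff (boxFun b.φ u k)) q =
      b.φ.chart.source.indicator (fun q => k (b.τ q) *
        (1 / 2 * Laplacian.laplacian u (b.z q) / (a b.φ q : ℂ))) q := by
  have hf := b.isTestFunction_boxFun hu hub hk hkc
  by_cases hq : q ∈ b.φ.chart.source
  · rw [indicator_of_mem hq, dens_eq ha (lam.isTestForm_ddbarCoeff hf) ⟨b.φ, b.mem⟩ hq,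
      ddbarCoeff_boxFun b.mem hu hq]
    simp only [Box.z, Box.τ]
    ring
  · rw [indicator_of_notMem hq, dens, ddbarCoeff_eq_zero, zero_div]
    refine notMem_tsupport_iff_eventuallyEq.1 fun h => hq ?_
    exact (tsupport_boxFun (b.hasCompactSupport_of_subset hub)
      (hub.trans (b.ball_subset_base le_rfl)) hkc h).1

variable [MeasurableSpace Y] [BorelSpace Y] {m : Measure Y} [IsFiniteMeasureOnCompacts m]

/-- The points of a box whose plaque meets `B` over the centre of the disc. -/
def Box.plaquesThrough (b : Box lam) (B : Set Y) : Set Y :=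
  {q | q ∈ b.φ.chart.source ∧ b.pt b.c (b.τ q) ∈ B}

omit [T2Space Y] in
theorem Box.measurableSet_plaquesThrough (b : Box lam) {B : Set Y} (hB : MeasurableSet B) :
    MeasurableSet (b.plaquesThrough B) := by
  have hc : Continuous fun t => b.pt b.c t :=
    continuous_iff_continuousAt.2 fun t => b.continuousAt_pt_param Box.c_mem t
  exact (hc.comp_continuousOn b.continuousOn_τ).measurableSet_inter_preimage
    b.φ.chart.open_source.measurableSet hB

/-- A harmonic measure is harmonic on every measurable family of plaques. A continuous function of
the plaque may be absorbed in the test function; this gives the closed families by approximation, and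
the measurable ones by a π-λ argument. -/
theorem Box.setIntegral_plaquesThrough [HasOuterApproxClosed Y] (ha : lam.IsAreaForm a)
    (hm : ∀ f, lam.IsTestFunction f → ∫ q, lam.dens a (lam.ddbarCoeff f) q ∂m = 0)
    {u : ℂ → ℂ} (hu : ContDiff ℝ ∞ u) (hub : tsupport u ⊆ Metric.ball b.c (4 * b.r))
    {B : Set Y} (hB : MeasurableSet B) :
    ∫ q in b.plaquesThrough B, lam.dens a (lam.ddbarCoeff (boxFun b.φ u fun t => (b.g t : ℂ))) q
      ∂m = 0 := by
  have hgc : Continuous fun t => (b.g t : ℂ) := Complex.continuous_ofReal.comp b.g_cont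
  have hgs : HasCompactSupport fun t => (b.g t : ℂ) :=
    b.g_supp.comp_left (g := ((↑) : ℝ → ℂ)) Complex.ofReal_zero
  set G := lam.dens a (lam.ddbarCoeff (boxFun b.φ u fun t => (b.g t : ℂ))) with hG
  have hα := lam.isTestForm_ddbarCoeff (b.isTestFunction_boxFun hu hub hgc hgs)
  have hGi : Integrable G m :=
    (continuous_dens ha hα).integrable_of_hasCompactSupport (hasCompactSupport_dens hα)
  have hG0 : ∀ q ∉ b.φ.chart.source, G q = 0 := fun q hq => by
    rw [hG, b.dens_boxFun ha hu hub hgc hgs, indicator_of_notMem hq]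
  have hptc : Continuous fun t => b.pt b.c t :=
    continuous_iff_continuousAt.2 fun t => b.continuousAt_pt_param Box.c_mem t
  have hclosed : ∀ C : Set Y, IsClosed C → ∫ q in b.plaquesThrough C, G q ∂m = 0 := by
    intro C hC
    set k : ℕ → b.φ.T → ℂ := fun n t => ((hC.apprSeq n (b.pt b.c t) : ℝ) : ℂ) * (b.g t : ℂ) with hk
    have hkc : ∀ n, Continuous (k n) := fun n => by
      have := (hC.apprSeq n).continuous
      fun_prop
    have hks : ∀ n, HasCompactSupport (k n) := fun n => hgs.mul_left
    have hform : ∀ n, (fun q => ((hC.apprSeq n (b.pt b.c (b.τ q)) : ℝ) : ℂ) * G q) =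
        lam.dens a (lam.ddbarCoeff (boxFun b.φ u (k n))) := by
      intro n
      ext q
      rw [b.dens_boxFun ha hu hub (hkc n) (hks n), hG, b.dens_boxFun ha hu hub hgc hgs]
      by_cases hq : q ∈ b.φ.chart.source
      · simp only [indicator_of_mem hq, hk]
        ring
      · simp only [indicator_of_notMem hq, mul_zero]
    have hlim : Tendsto (fun n => ∫ q, ((hC.apprSeq n (b.pt b.c (b.τ q)) : ℝ) : ℂ) * G q ∂m) atTop
        (𝓝 (∫ q, (b.plaquesThrough C).indicator G q ∂m)) := by
      refine tendsto_integral_of_dominated_convergence (fun q => ‖G q‖) (fun n => ?_) hGi.norm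
        (fun n => Eventually.of_forall fun q => ?_) (Eventually.of_forall fun q => ?_)
      · rw [hform]
        exact (continuous_dens ha (lam.isTestForm_ddbarCoeff (b.isTestFunction_boxFun hu hub (hkc n)
          (hks n)))).aestronglyMeasurable
      · rw [norm_mul, Complex.norm_real, Real.norm_of_nonneg NNReal.zero_le_coe]
        refine mul_le_of_le_one_left (norm_nonneg _) ?_
        exact_mod_cast HasOuterApproxClosed.apprSeq_apply_le_one hC n _
      · have h1 := tendsto_pi_nhds.1 (HasOuterApproxClosed.tendsto_apprSeq hC) (b.pt b.c (b.τ q))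
        have h2 : Tendsto (fun n => ((hC.apprSeq n (b.pt b.c (b.τ q)) : ℝ) : ℂ) * G q) atTop
            (𝓝 ((((C.indicator (fun _ => 1) (b.pt b.c (b.τ q)) : NNReal) : ℝ) : ℂ) * G q)) :=
          ((Complex.continuous_ofReal.tendsto _).comp
            ((NNReal.continuous_coe.tendsto _).comp h1)).mul_const _
        convert! h2 using 2
        by_cases hq : q ∈ b.φ.chart.source
        · by_cases hc : b.pt b.c (b.τ q) ∈ C
          · rw [indicator_of_mem (show q ∈ b.plaquesThrough C from ⟨hq, hc⟩)]
            simp [hc]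
          · rw [indicator_of_notMem (show q ∉ b.plaquesThrough C from fun h => hc h.2)]
            simp [hc]
        · rw [indicator_of_notMem (show q ∉ b.plaquesThrough C from fun h => hq h.1), hG0 q hq,
            mul_zero]
    have hz : ∀ n, ∫ q, ((hC.apprSeq n (b.pt b.c (b.τ q)) : ℝ) : ℂ) * G q ∂m = 0 := fun n => by
      rw [hform]
      exact hm _ (b.isTestFunction_boxFun hu hub (hkc n) (hks n))
    simp only [hz] at hlim
    rw [← integral_indicator (b.measurableSet_plaquesThrough hC.measurableSet)]
    exact tendsto_nhds_unique hlim tendsto_const_nhds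
  have hcompl : ∀ A, MeasurableSet A → ∫ q in b.plaquesThrough A, G q ∂m = 0 →
      ∫ q in b.plaquesThrough Aᶜ, G q ∂m = 0 := by
    intro A hA h0
    have h1 := hclosed univ isClosed_univ
    have e : b.plaquesThrough univ = b.plaquesThrough A ∪ b.plaquesThrough Aᶜ := by
      ext q
      simp only [Box.plaquesThrough, mem_ofPred_eq, mem_union, mem_compl_iff, mem_univ]
      tauto
    rw [e, setIntegral_union (disjoint_left.2 fun q h h' => h'.2 h.2)
      (b.measurableSet_plaquesThrough hA.compl) hGi.integrableOn hGi.integrableOn, h0, zero_add]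
      at h1
    exact h1
  refine MeasurableSpace.induction_on_inter
    (C := fun B _ => ∫ q in b.plaquesThrough B, G q ∂m = 0)
    (BorelSpace.measurable_eq.trans borel_eq_generateFrom_isClosed) isPiSystem_isClosed
    (hclosed ∅ isClosed_empty) hclosed hcompl (fun f hd hf h0 => ?_) B hB
  have e : b.plaquesThrough (⋃ i, f i) = ⋃ i, b.plaquesThrough (f i) := by
    ext q
    simp [Box.plaquesThrough]
  rw [e, integral_iUnion (fun i => b.measurableSet_plaquesThrough (hf i)) (fun i j hij =>
    disjoint_left.2 fun q h h' => (hd hij).le_bot ⟨h.2, h'.2⟩) hGi.integrableOn]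
  simp [h0]

end RiemannSurfaceLamination

/-! ### The wandering leaves have measure zero -/

namespace RiemannSurfaceLamination

variable {Y : Type u} [TopologicalSpace Y] {lam : RiemannSurfaceLamination Y} [T2Space Y]
  {a : FlowBox Y → Y → ℝ}

/-- The test function `w ↦ discBump (ζ - w)` of a disc, with radius `r / (n + 1)`. -/
noncomputable def Box.probe (b : Box lam) (n : ℕ) (ζ : ℂ) (w : ℂ) : ℂ :=
  (discBump (b.r / (n + 1)) (ζ - w) : ℂ)

omit [T2Space Y] in
theorem Box.contDiff_probe (b : Box lam) (n : ℕ) (ζ : ℂ) : ContDiff ℝ ∞ (b.probe n ζ) :=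
  (contDiff_ofReal_discBump _).comp (contDiff_const.sub contDiff_id)

omit [T2Space Y] in
theorem Box.tsupport_probe (b : Box lam) (n : ℕ) (ζ : ℂ) :
    tsupport (b.probe n ζ) ⊆ Metric.closedBall ζ (b.r / (n + 1)) := by
  refine closure_minimal (fun w hw => ?_) Metric.isClosed_closedBall
  have : discBump (b.r / ((n : ℝ) + 1)) (ζ - w) ≠ 0 := fun h => hw (by simp [Box.probe, h])
  have hδ : 0 < b.r / ((n : ℝ) + 1) := div_pos b.r_pos (by positivity)
  rw [Metric.mem_closedBall, dist_comm, dist_eq_norm]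
  exact (norm_lt_of_discBump_ne_zero hδ this).le

variable [MeasurableSpace Y] [BorelSpace Y] {ι : Type*} [Countable ι] {b : ι → Box lam}

/-- A measure which annihilates the families of plaques through the finite intersections of basic
open sets is harmonic on each plaque. -/
theorem Box.harmonicOnPlaque_of_forall (ha : lam.IsAreaForm a) {D : Set ℂ} {μ : Measure Y}
    [IsFiniteMeasureOnCompacts μ] {b : Box lam} {𝒪 : Set (Set Y)} (h𝒪c : 𝒪.Countable)
    (h𝒪 : TopologicalSpace.IsTopologicalBasis 𝒪)
    (h0 : ∀ n : ℕ, ∀ ζ ∈ D, Metric.closedBall ζ (b.r / (n + 1)) ⊆ Metric.ball b.c (4 * b.r) →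
      ∀ F : Finset 𝒪, ∫ q in b.plaquesThrough (⋂ O ∈ F, (O : Set Y)),
        lam.dens a (lam.ddbarCoeff (boxFun b.φ (b.probe n ζ) fun t => (b.g t : ℂ))) q ∂μ = 0)
    {t : b.φ.T} (ht : 0 < b.g t) : b.HarmonicOnPlaque a D μ t := by
  intro n ζ hζ hsub
  have hgc : Continuous fun t => (b.g t : ℂ) := Complex.continuous_ofReal.comp b.g_cont
  have hgs : HasCompactSupport fun t => (b.g t : ℂ) :=
    b.g_supp.comp_left (g := ((↑) : ℝ → ℂ)) Complex.ofReal_zero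
  have hu := b.contDiff_probe n ζ
  have hub := (b.tsupport_probe n ζ).trans hsub
  set G := lam.dens a (lam.ddbarCoeff (boxFun b.φ (b.probe n ζ) fun t => (b.g t : ℂ))) with hG
  have hα := lam.isTestForm_ddbarCoeff (b.isTestFunction_boxFun hu hub hgc hgs)
  have hGi : Integrable G μ :=
    (continuous_dens ha hα).integrable_of_hasCompactSupport (hasCompactSupport_dens hα)
  -- the plaque is the intersection of a sequence of families of plaques
  set y := b.pt b.c t with hy
  obtain ⟨O₀, hO₀, hyO₀, -⟩ := h𝒪.exists_subset_of_mem_open (mem_univ y) isOpen_univ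
  have hne : {O : 𝒪 | y ∈ (O : Set Y)}.Nonempty := ⟨⟨O₀, hO₀⟩, hyO₀⟩
  have hc𝒪 : Countable 𝒪 := h𝒪c.to_subtype
  obtain ⟨o, ho⟩ := (Set.to_countable {O : 𝒪 | y ∈ (O : Set Y)}).exists_eq_range hne
  have hyo : ∀ n, y ∈ (o n : Set Y) := fun n => by
    have : o n ∈ {O : 𝒪 | y ∈ (O : Set Y)} := ho ▸ mem_range_self n
    exact this
  classical
  set V : ℕ → Set Y := fun n => ⋂ O ∈ (Finset.range (n + 1)).image o, (O : Set Y) with hV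
  have hVm : ∀ n, MeasurableSet (V n) := fun n =>
    Finset.measurableSet_biInter _ fun O _ => (h𝒪.isOpen O.2).measurableSet
  have hVmem : ∀ n x, x ∈ V n ↔ ∀ k ≤ n, x ∈ (o k : Set Y) := by
    intro n x
    simp [hV]
  have hanti : Antitone fun n => b.plaquesThrough (V n) := fun n k hnk q hq =>
    ⟨hq.1, (hVmem n _).2 fun j hj => (hVmem k _).1 hq.2 j (hj.trans hnk)⟩
  have hlim := tendsto_setIntegral_of_antitone (μ := μ) (f := G)
    (fun n => b.measurableSet_plaquesThrough (hVm n)) hanti ⟨0, hGi.integrableOn⟩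
  have hzero : ∀ k, ∫ q in b.plaquesThrough (V k), G q ∂μ = 0 := fun k => h0 n ζ hζ hsub _
  simp only [hzero] at hlim
  have hlim0 := tendsto_nhds_unique hlim tendsto_const_nhds
  have hinter : ⋂ n, b.plaquesThrough (V n) = {q | q ∈ b.φ.chart.source ∧ b.τ q = t} := by
    ext q
    simp only [mem_iInter, Box.plaquesThrough, mem_ofPred_eq]
    constructor
    · intro h
      refine ⟨(h 0).1, ?_⟩
      have : b.pt b.c (b.τ q) = y := by
        by_contra hne'
        obtain ⟨O, hO, hyO, hOq⟩ := h𝒪.exists_subset_of_mem_open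
          (show y ∈ {b.pt b.c (b.τ q)}ᶜ from fun h => hne' h.symm) isOpen_compl_singleton
        obtain ⟨k, hk⟩ : (⟨O, hO⟩ : 𝒪) ∈ range o := ho ▸ hyO
        have := (hVmem k _).1 (h k).2 k le_rfl
        rw [hk] at this
        exact hOq this rfl
      rw [← Box.τ_pt Box.c_mem (b.τ q), this, hy, Box.τ_pt Box.c_mem]
    · rintro ⟨hq, hqt⟩ n
      refine ⟨hq, (hVmem n _).2 fun k _ => ?_⟩
      rw [hqt]
      exact hyo k
  rw [hinter] at hlim0
  have hsubset : b.plaque (Metric.ball b.c (4 * b.r)) t ⊆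
      {q | q ∈ b.φ.chart.source ∧ b.τ q = t} := fun q hq => ⟨hq.1, hq.2.2⟩
  have hform : ∀ q ∈ b.φ.chart.source, b.τ q = t → G q = (b.g t : ℂ) * (1 / 2) *
      (Laplacian.laplacian (b.probe n ζ) (b.z q) / (a b.φ q : ℂ)) := by
    intro q hq hqt
    rw [hG, b.dens_boxFun ha hu hub hgc hgs, indicator_of_mem hq, hqt]
    ring
  have e : ∫ q in b.plaque (Metric.ball b.c (4 * b.r)) t, G q ∂μ = 0 := by
    rw [← hlim0]
    refine (setIntegral_eq_of_subset_of_forall_sdiff_eq_zero ?_ hsubset ?_).symm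
    · rw [← hinter]
      exact MeasurableSet.iInter fun n => b.measurableSet_plaquesThrough (hVm n)
    · rintro q ⟨⟨hq, hqt⟩, hqn⟩
      have hz : b.z q ∉ tsupport (b.probe n ζ) := fun h => hqn ⟨hq, hub h, hqt⟩
      rw [hform q hq hqt, laplacian_eq_zero_of_notMem_tsupport hz]
      simp
  rw [setIntegral_congr_fun (b.measurableSet_plaque Metric.isOpen_ball.measurableSet t)
    (fun q hq => hform q hq.1 hq.2.2), integral_const_mul] at e
  have hgne : (b.g t : ℂ) * (1 / 2) ≠ 0 :=
    mul_ne_zero (Complex.ofReal_ne_zero.2 ht.ne') (by norm_num)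
  exact (mul_eq_zero.1 e).resolve_left hgne

variable [StandardBorelSpace Y] [LocallyCompactSpace Y] [SecondCountableTopology Y]
  {m : Measure Y} [IsFiniteMeasureOnCompacts m]

/-- Almost every leaf that meets a given compact set in exactly one point is closed: the conditional
measures along the projection of the leaves to these points are harmonic measures on single leaves,
and they are not zero. -/
theorem measure_not_isClosed_sliceSet (hb : ∀ p, ∃ i, p ∈ (b i).core) (ha : lam.IsAreaForm a)
    (hm : ∀ f, lam.IsTestFunction f → ∫ q, lam.dens a (lam.ddbarCoeff f) q ∂m = 0)
    (hcut : lam.HasCutoffs) {K : Set Y} (hK : IsCompact K) :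
    m {p | p ∈ sliceSet b K ∧ ¬ IsClosed (leafOf b p)} = 0 := by
  rcases isEmpty_or_nonempty Y with hY | hY
  · rw [Set.eq_empty_of_isEmpty {p | p ∈ sliceSet b K ∧ ¬ IsClosed (leafOf b p)}, measure_empty]
  have hWm := measurableSet_sliceSet (b := b) hK
  have hπ := measurable_sliceProj (b := b) hK
  set W := sliceSet b K with hW
  set π := sliceProj b K with hπdef
  have hlf : IsLocallyFiniteMeasure m := isLocallyFiniteMeasure_of_isFiniteMeasureOnCompacts
  obtain ⟨ν, M, hM0, hMπ, hMN, hMfin, hMnull, hMint⟩ := exists_disintegration (m.restrict W) hπ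
  obtain ⟨D, hDc, hD⟩ := TopologicalSpace.exists_countable_dense ℂ
  set 𝒪 := TopologicalSpace.countableBasis Y
  have h𝒪c : 𝒪.Countable := TopologicalSpace.countable_countableBasis Y
  have h𝒪 : TopologicalSpace.IsTopologicalBasis 𝒪 := TopologicalSpace.isBasis_countableBasis Y
  have hDcount : Countable D := hDc.to_subtype
  have h𝒪count : Countable 𝒪 := h𝒪c.to_subtype
  -- the conditional measures are finite on compact sets
  have h1 : ∀ᵐ t ∂ν, ∀ i, M t (b i).closed < ⊤ := by
    refine ae_all_iff.2 fun i => hMfin _ Box.isCompact_closed.isClosed.measurableSet ?_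
    exact ((Measure.restrict_apply_le _ _).trans_lt Box.isCompact_closed.measure_lt_top).ne
  have h2 : ∀ᵐ t ∂ν, M t Wᶜ = 0 := by
    refine hMnull _ hWm.compl ?_
    rw [Measure.restrict_apply hWm.compl, compl_inter_self, measure_empty]
  -- the conditional measures are harmonic
  have h3 : ∀ᵐ t ∂ν, ∀ (i : ι) (n : ℕ) (ζ : D) (F : Finset 𝒪),
      Metric.closedBall (ζ : ℂ) ((b i).r / (n + 1)) ⊆ Metric.ball (b i).c (4 * (b i).r) →
      ∫ q in (b i).plaquesThrough (⋂ O ∈ F, (O : Set Y)), lam.dens a (lam.ddbarCoeff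
        (boxFun (b i).φ ((b i).probe n ζ) fun t => ((b i).g t : ℂ))) q ∂M t = 0 := by
    refine ae_all_iff.2 fun i => ae_all_iff.2 fun n => ae_all_iff.2 fun ζ => ae_all_iff.2 fun F => ?_
    by_cases hsub : Metric.closedBall (ζ : ℂ) ((b i).r / (n + 1)) ⊆
      Metric.ball (b i).c (4 * (b i).r)
    swap
    · exact Eventually.of_forall fun t h => absurd h hsub
    have hgc : Continuous fun t => ((b i).g t : ℂ) := Complex.continuous_ofReal.comp (b i).g_cont
    have hgs : HasCompactSupport fun t => ((b i).g t : ℂ) :=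
      (b i).g_supp.comp_left (g := ((↑) : ℝ → ℂ)) Complex.ofReal_zero
    have hu := (b i).contDiff_probe n ζ
    have hub := ((b i).tsupport_probe n ζ).trans hsub
    set G := lam.dens a (lam.ddbarCoeff
      (boxFun (b i).φ ((b i).probe n ζ) fun t => ((b i).g t : ℂ))) with hG
    have hα := lam.isTestForm_ddbarCoeff ((b i).isTestFunction_boxFun hu hub hgc hgs)
    have hGc : Continuous G := continuous_dens ha hα
    have hGi : Integrable G m := hGc.integrable_of_hasCompactSupport (hasCompactSupport_dens hα)
    have hG0 : ∀ q ∉ (b i).closed, G q = 0 := by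
      intro q hq
      rw [hG, (b i).dens_boxFun ha hu hub hgc hgs]
      by_cases hqs : q ∈ (b i).φ.chart.source
      · rw [indicator_of_mem hqs]
        by_cases hqt : (b i).τ q ∈ tsupport (b i).g
        · have hz : (b i).z q ∉ tsupport ((b i).probe n ζ) := fun h =>
            hq ⟨hqs, Metric.ball_subset_closedBall (hub h), hqt⟩
          rw [laplacian_eq_zero_of_notMem_tsupport hz]
          simp
        · rw [image_eq_zero_of_notMem_tsupport hqt]
          simp
      · exact indicator_of_notMem hqs _
    set V : Set Y := ⋂ O ∈ F, (O : Set Y) with hV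
    have hVm : MeasurableSet V :=
      Finset.measurableSet_biInter _ fun O _ => (h𝒪.isOpen O.2).measurableSet
    have hSV := (b i).measurableSet_plaquesThrough hVm
    -- the preimages of sets under the projection are unions of leaves, so they cut out measurable
    -- families of plaques in the box
    have key := hMint (((b i).plaquesThrough V).indicator G) (hGc.measurable.indicator hSV)
      (hGi.restrict.indicator hSV) (fun A hA => by
        have hB : MeasurableSet (V ∩ (W ∩ π ⁻¹' A)) := hVm.inter (hWm.inter (hπ hA))
        rw [Measure.restrict_restrict (hπ hA),
          ← (b i).setIntegral_plaquesThrough ha hm hu hub hB,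
          ← integral_indicator ((hπ hA).inter hWm),
          ← integral_indicator ((b i).measurableSet_plaquesThrough hB)]
        congr 1
        ext q
        by_cases hq : q ∈ (b i).closed
        · set y := (b i).pt (b i).c ((b i).τ q) with hy
          have hyq : y ∈ leafOf b q := by
            have hr := (b i).r_pos
            refine mem_leafOf_of_τ_eq hq ⟨Box.pt_mem Box.c_mem _, ?_, ?_⟩
              (Box.τ_pt Box.c_mem _).symm
            · change (b i).z y ∈ _
              rw [hy, Box.z_pt Box.c_mem]
              exact Metric.mem_closedBall_self (by linarith)
            · change (b i).τ y ∈ _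
              rw [hy, Box.τ_pt Box.c_mem]
              exact hq.2.2
          have e1 : y ∈ W ↔ q ∈ W := mem_sliceSet_iff hyq
          have e2 : q ∈ W → π y = π q := fun h => sliceProj_eq h hyq
          by_cases hqW : q ∈ W
          · by_cases hqA : π q ∈ A
            · by_cases hyV : y ∈ V
              · rw [indicator_of_mem (show q ∈ π ⁻¹' A ∩ W from ⟨hqA, hqW⟩),
                  indicator_of_mem (show q ∈ (b i).plaquesThrough V from ⟨hq.1, hyV⟩),
                  indicator_of_mem (show q ∈ (b i).plaquesThrough (V ∩ (W ∩ π ⁻¹' A)) from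
                    ⟨hq.1, hyV, e1.2 hqW, by rw [mem_preimage, e2 hqW]; exact hqA⟩)]
              · rw [indicator_of_mem (show q ∈ π ⁻¹' A ∩ W from ⟨hqA, hqW⟩),
                  indicator_of_notMem (fun h => hyV h.2),
                  indicator_of_notMem (fun h => hyV h.2.1)]
            · rw [indicator_of_notMem (fun h => hqA h.1), indicator_of_notMem fun h => hqA ?_]
              have := h.2.2.2
              rwa [mem_preimage, e2 hqW] at this
          · rw [indicator_of_notMem (fun h => hqW h.2),
              indicator_of_notMem fun h => hqW (e1.1 h.2.2.1)]
        · have hz : ∀ s : Set Y, s.indicator G q = 0 := fun s =>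
            indicator_apply_eq_zero.2 fun _ => hG0 q hq
          rw [hz]
          exact indicator_apply_eq_zero.2 fun _ => hz _)
    filter_upwards [key] with t ht _
    rwa [integral_indicator hSV] at ht
  have hcl : ∀ᵐ t ∂ν, IsClosed (leafOf b t) := by
    filter_upwards [h1, h2, h3, hMπ] with t h1 h2 h3 h4
    by_contra hncl
    refine hM0 t ?_
    have hfin : IsFiniteMeasureOnCompacts (M t) := by
      refine ⟨fun C hC => ?_⟩
      obtain ⟨s, hs⟩ := hC.elim_finite_subcover (fun i => (b i).core)
        (fun i => Box.isOpen_core) fun p _ => mem_iUnion.2 (hb p)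
      refine (measure_mono hs).trans_lt ((measure_biUnion_finset_le s _).trans_lt ?_)
      exact ENNReal.sum_lt_top.2 fun i _ => (measure_mono Box.core_subset).trans_lt (h1 i)
    -- the conditional measure lives on the leaf of `t`
    have hleaf : M t (leafOf b t)ᶜ = 0 := by
      have h5 : ∀ᵐ p ∂M t, p ∈ leafOf b t := by
        have h6 : ∀ᵐ p ∂M t, p ∈ W := by
          rw [ae_iff]
          exact h2
        filter_upwards [h4, h6] with p hp hpW
        rw [← hp]
        exact mem_leafOf_symm (sliceProj_mem hpW).1
      exact h5
    exact measure_eq_zero_of_not_isClosed hb hleaf ha hcut hD (fun i t' ht' =>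
      (b i).harmonicOnPlaque_of_forall ha h𝒪c h𝒪 (fun n ζ hζ hsub F =>
        h3 i n ⟨ζ, hζ⟩ F hsub) ht') hncl
  -- the leaves that are not closed project to a null set
  obtain ⟨N, hN, hNm, hN0⟩ := exists_measurable_superset_of_null (ae_iff.1 hcl)
  have h0 := hMN N hNm hN0
  rw [Measure.restrict_apply (hπ hNm)] at h0
  have hsub : {p | p ∈ W ∧ ¬ IsClosed (leafOf b p)} ⊆ π ⁻¹' N ∩ W := fun p hp => by
    refine ⟨hN ?_, hp.1⟩
    rw [mem_ofPred_eq, leafOf_eq (sliceProj_mem hp.1).1]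
    exact hp.2
  exact measure_mono_null hsub h0

/-- Wandering leaves are not closed, and each of them meets one of countably many compact
transversals in exactly one point. -/
theorem measure_wanderingSet (ha : lam.IsAreaForm a)
    (hm : ∀ f, lam.IsTestFunction f → ∫ q, lam.dens a (lam.ddbarCoeff f) q ∂m = 0)
    (hcut : lam.HasCutoffs) : m lam.wanderingSet = 0 := by
  choose B hB using Box.exists_mem_core lam
  obtain ⟨T, hTc, hT⟩ := TopologicalSpace.isOpen_iUnion_countable (fun p => (B p).core)
    fun p => Box.isOpen_core
  have hTcount : Countable T := hTc.to_subtype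
  let b : T → Box lam := fun p => B p
  have hb : ∀ p, ∃ i, p ∈ (b i).core := by
    intro p
    have : p ∈ ⋃ i ∈ T, (B i).core := by
      rw [hT]
      exact mem_iUnion.2 ⟨p, hB p⟩
    obtain ⟨i, hi, hp⟩ := mem_iUnion₂.1 this
    exact ⟨⟨i, hi⟩, hp⟩
  obtain ⟨D, hDc, hD⟩ := TopologicalSpace.exists_countable_dense ℂ
  have hsub : lam.wanderingSet ⊆ ⋃ i, ⋃ ζ ∈ D, ⋃ O ∈ TopologicalSpace.countableBasis Y,
      {p | p ∈ sliceSet b ((b i).transversal ζ O) ∧ ¬ IsClosed (leafOf b p)} := by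
    rintro p ⟨L, hL, hp⟩
    obtain ⟨i, ζ, hζ, O, hO, hsub⟩ := hL.exists_transversal hb hD
      (TopologicalSpace.isBasis_countableBasis Y)
    refine mem_iUnion.2 ⟨i, mem_iUnion₂.2 ⟨ζ, hζ, mem_iUnion₂.2 ⟨O, hO, hsub hp, ?_⟩⟩⟩
    rw [← IsLeaf.eq_leafOf hb hL.1 hp]
    exact hL.2.1
  refine measure_mono_null hsub (measure_iUnion_null fun i => (measure_biUnion_null_iff hDc).2
    fun ζ _ => (measure_biUnion_null_iff (TopologicalSpace.countable_countableBasis Y)).2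
      fun O _ => ?_)
  exact measure_not_isClosed_sliceSet hb ha hm hcut ((b i).isCompact_transversal ζ O)

end RiemannSurfaceLamination

/-! ### Positive linear forms on test forms are measures -/

namespace RiemannSurfaceLamination

variable {Y : Type u} [TopologicalSpace Y] {lam : RiemannSurfaceLamination Y}
  {a : FlowBox Y → Y → ℝ}

open scoped CompactlySupported

theorem eq_dens_mul (ha : lam.IsAreaForm a) {α : lam.atlas → Y → ℂ} (hα : lam.IsTestForm α)
    (φ : lam.atlas) {p : Y} (hp : p ∈ φ.1.chart.source) :
    α φ p = lam.dens a α p * (a φ.1 p : ℂ) := by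
  rw [dens_eq ha hα φ hp, div_mul_cancel₀]
  exact Complex.ofReal_ne_zero.2 (ha.pos _ φ.2 p hp).ne'

theorem testForm_nonneg (ha : lam.IsAreaForm a) {α : lam.atlas → Y → ℂ} (hα : lam.IsTestForm α)
    (h : ∀ p, 0 ≤ lam.dens a α p) (φ : lam.atlas) (p : Y) : 0 ≤ α φ p := by
  by_cases hp : p ∈ φ.1.chart.source
  · rw [eq_dens_mul ha hα φ hp]
    exact mul_nonneg (h p) (Complex.zero_le_real.2 (ha.pos _ φ.2 p hp).le)
  · rw [hα.off_source φ p hp]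

theorem testForm_ext (ha : lam.IsAreaForm a) {α β : lam.atlas → Y → ℂ} (hα : lam.IsTestForm α)
    (hβ : lam.IsTestForm β) (h : lam.dens a α = lam.dens a β) : α = β := by
  ext φ p
  by_cases hp : p ∈ φ.1.chart.source
  · rw [eq_dens_mul ha hα φ hp, eq_dens_mul ha hβ φ hp, h]
  · rw [hα.off_source φ p hp, hβ.off_source φ p hp]

/-- The form of the bump function of a box. -/
theorem Box.isTestForm_bump [T2Space Y] (b : Box lam) : lam.IsTestForm (lam.boxForm b.φ b.bump) := by
  refine isTestForm_boxForm b.mem b.isTestFunction_bump fun p hp => ?_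
  have hc : IsCompact (boxSet b.φ (Metric.closedBall b.c b.r) (tsupport b.g)) :=
    isCompact_boxSet ((Metric.closedBall_subset_closedBall (by linarith [b.r_pos])).trans
      b.subset_base) (isCompact_closedBall _ _) b.g_supp
  refine (closure_minimal (fun q hq => ?_) hc.isClosed hp).1
  have := b.bump_subordinate q hq
  exact ⟨this.1, this.2.1, subset_tsupport _ (ne_of_gt this.2.2)⟩

theorem Box.dens_bump_nonneg (ha : lam.IsAreaForm a) (b : Box lam) (p : Y) :
    0 ≤ lam.dens a (lam.boxForm b.φ b.bump) p := by
  obtain ⟨h1, h2⟩ := (lam.cover p).choose_spec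
  refine div_nonneg ?_ (Complex.zero_le_real.2 (ha.pos _ h1 p h2).le)
  rw [boxForm]
  split_ifs
  · exact mul_nonneg (Complex.zero_le_real.2 (by positivity)) (b.bump_nonneg p)
  · exact le_rfl

theorem Box.dens_bump_ne_zero [T2Space Y] (ha : lam.IsAreaForm a) {b : Box lam} {p : Y}
    (hp : p ∈ b.core) : lam.dens a (lam.boxForm b.φ b.bump) p ≠ 0 := by
  have h1 := ha.transform _ b.mem _ b.mem p ⟨hp.1, hp.1⟩
  have hpos := ha.pos _ b.mem p hp.1
  rw [dens_eq ha b.isTestForm_bump ⟨b.φ, b.mem⟩ hp.1, boxForm, if_pos ⟨hp.1, hp.1⟩]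
  refine div_ne_zero (mul_ne_zero (Complex.ofReal_ne_zero.2 fun h => ?_) (Box.bump_ne_zero hp))
    (Complex.ofReal_ne_zero.2 hpos.ne')
  rw [h, zero_mul] at h1
  exact hpos.ne' h1

/-- On a compact set, the area form is dominated by a nonnegative test form. -/
theorem exists_testForm_ge [T2Space Y] (ha : lam.IsAreaForm a) {K : Set Y} (hK : IsCompact K)
    (C : ℝ) : ∃ β : lam.testForms, (∀ p, 0 ≤ lam.dens a β.1 p) ∧
      ∀ p ∈ K, (C : ℂ) ≤ lam.dens a β.1 p := by
  choose b hb using Box.exists_mem_core lam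
  obtain ⟨s, hs⟩ := hK.elim_finite_subcover (fun p => (b p).core) (fun p => Box.isOpen_core)
    fun p _ => mem_iUnion.2 ⟨p, hb p⟩
  set β : lam.testForms := ∑ i ∈ s, ⟨_, (b i).isTestForm_bump⟩ with hβ
  have hdens : ∀ p, lam.dens a β.1 p = ∑ i ∈ s, lam.dens a (lam.boxForm (b i).φ (b i).bump) p := by
    intro p
    simp only [hβ, dens, Submodule.coe_sum, Finset.sum_apply, Finset.sum_div]
  have h0 : ∀ p, 0 ≤ lam.dens a β.1 p := fun p => by
    rw [hdens]
    exact Finset.sum_nonneg fun i _ => (b i).dens_bump_nonneg ha p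
  have hre : ∀ p, lam.dens a β.1 p = ((lam.dens a β.1 p).re : ℂ) := fun p =>
    (Complex.ext rfl (Complex.le_def.1 (h0 p)).2.symm)
  have hpos : ∀ p ∈ K, 0 < (lam.dens a β.1 p).re := by
    intro p hp
    refine lt_of_le_of_ne (Complex.le_def.1 (h0 p)).1 fun h => ?_
    have hz : lam.dens a β.1 p = 0 := by
      rw [hre, ← h]
      rfl
    rw [hdens] at hz
    obtain ⟨i, his, hi⟩ := mem_iUnion₂.1 (hs hp)
    exact Box.dens_bump_ne_zero ha hi
      ((Finset.sum_eq_zero_iff_of_nonneg fun i _ => (b i).dens_bump_nonneg ha p).1 hz i his)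
  obtain ⟨δ, hδ, hδK⟩ : ∃ δ > 0, ∀ p ∈ K, δ ≤ (lam.dens a β.1 p).re := by
    rcases K.eq_empty_or_nonempty with rfl | hne
    · exact ⟨1, one_pos, by simp⟩
    · obtain ⟨p, hp, hmin⟩ := hK.exists_isMinOn hne
        (Complex.continuous_re.comp (continuous_dens ha β.2)).continuousOn
      exact ⟨_, hpos p hp, fun q hq => hmin hq⟩
  refine ⟨((|C| / δ : ℝ) : ℂ) • β, fun p => ?_, fun p hp => ?_⟩
  · change 0 ≤ lam.dens a (((|C| / δ : ℝ) : ℂ) • β.1) p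
    rw [dens_smul]
    exact mul_nonneg (Complex.zero_le_real.2 (by positivity)) (h0 p)
  · change _ ≤ lam.dens a (((|C| / δ : ℝ) : ℂ) • β.1) p
    rw [dens_smul, hre]
    have : C ≤ |C| / δ * (lam.dens a β.1 p).re := by
      calc C ≤ |C| := le_abs_self C
        _ = |C| / δ * δ := by field_simp
        _ ≤ _ := mul_le_mul_of_nonneg_left (hδK p hp) (by positivity)
    exact_mod_cast this

/-- The image of a test form under a real linear map of the coefficients. -/
theorem IsTestForm.comp_clm {α : lam.atlas → Y → ℂ} (hα : lam.IsTestForm α) (l : ℂ →L[ℝ] ℂ) :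
    lam.IsTestForm fun φ p => l (α φ p) := by
  refine ⟨fun φ p hp => by rw [hα.off_source φ p hp, map_zero], fun φ ψ p hp => ?_, fun φ => ?_, ?_⟩
  · rw [hα.transform φ ψ p hp, ← Complex.real_smul, map_smul, Complex.real_smul]
  · rw [leafSmooth_iff]
    exact fun p hp => (leafSmooth_iff.1 (hα.smooth φ) p hp).comp_contDiff l.contDiff
  · obtain ⟨K, hK, h⟩ := hα.compact_support
    exact ⟨K, hK, fun φ p hp => by rw [h φ p hp, map_zero]⟩

variable [T2Space Y]

/-- The test forms with real coefficients. -/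
def realTestForms (lam : RiemannSurfaceLamination Y) : Submodule ℝ lam.testForms where
  carrier := {α | ∀ φ p, (α.1 φ p).im = 0}
  zero_mem' := fun _ _ => rfl
  add_mem' := fun {α β} hα hβ φ p => by
    simp [hα φ p, hβ φ p]
  smul_mem' := fun c α hα φ p => by
    change (((c : ℝ) • α.1 φ p : ℂ)).im = 0
    simp [hα φ p]

omit [T2Space Y] in
theorem dens_re {α : lam.testForms} (hα : α ∈ lam.realTestForms) (p : Y) :
    lam.dens a α.1 p = ((lam.dens a α.1 p).re : ℂ) := by
  refine Complex.ext rfl ?_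
  rw [Complex.ofReal_im, dens, Complex.div_ofReal_im, hα, zero_div]

/-- The quotient of a real test form by an area form, as a continuous function of compact
support. -/
noncomputable def realDens (ha : lam.IsAreaForm a) : lam.realTestForms →ₗ[ℝ] C_c(Y, ℝ) where
  toFun α :=
    { toFun := fun p => (lam.dens a α.1.1 p).re
      continuous_toFun := Complex.continuous_re.comp (continuous_dens ha α.1.2)
      hasCompactSupport' := (hasCompactSupport_dens α.1.2).comp_left (g := Complex.re) rfl }
  map_add' α β := by
    ext p
    change (lam.dens a (α.1.1 + β.1.1) p).re = _
    rw [dens_add]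
    rfl
  map_smul' c α := by
    ext p
    change (lam.dens a ((c : ℂ) • α.1.1) p).re = c * (lam.dens a α.1.1 p).re
    rw [dens_smul, Complex.re_ofReal_mul]

theorem injective_realDens (ha : lam.IsAreaForm a) : Function.Injective (realDens ha) := by
  intro α β h
  refine Subtype.ext (Subtype.ext (testForm_ext ha α.1.2 β.1.2 (funext fun p => ?_)))
  rw [dens_re α.2, dens_re β.2]
  exact congrArg _ (DFunLike.congr_fun h p)

/-- A positive linear form on test forms is the integration of the quotient by an area form: on real
test forms it is a positive form on a subspace of the continuous functions of compact support, which
extends by the theorem of M. Riesz, and is a measure by the theorem of Riesz, Markov and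
Kakutani. -/
theorem exists_measure [LocallyCompactSpace Y] [MeasurableSpace Y] [BorelSpace Y]
    (ha : lam.IsAreaForm a) (S : lam.testForms →ₗ[ℂ] ℂ)
    (hS : ∀ α : lam.testForms, (∀ φ p, 0 ≤ α.1 φ p) → 0 ≤ S α) :
    ∃ m : Measure Y, IsFiniteMeasureOnCompacts m ∧
      ∀ α : lam.testForms, ∫ p, lam.dens a α.1 p ∂m = S α := by
  -- a real form is the difference of two nonnegative ones, so its image is real
  have hreal : ∀ α ∈ lam.realTestForms, S α = ((S α).re : ℂ) := by
    intro α hα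
    obtain ⟨C, hC⟩ := (hasCompactSupport_dens (a := a) α.2).exists_bound_of_continuous
      (continuous_dens ha α.2)
    obtain ⟨β, hβ0, hβ⟩ := exists_testForm_ge ha
      (hasCompactSupport_dens (a := a) α.2) C
    have h1 : 0 ≤ S (α + β) := by
      refine hS _ (testForm_nonneg ha (α + β).2 fun p => ?_)
      change 0 ≤ lam.dens a (α.1 + β.1) p
      rw [dens_add]
      by_cases hp : p ∈ tsupport (lam.dens a α.1)
      · have h2 := hβ p hp
        rw [dens_re hα]
        have h3 : (0 : ℂ) ≤ (((lam.dens a α.1 p).re + C : ℝ) : ℂ) := by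
          refine Complex.zero_le_real.2 ?_
          have := (Complex.abs_re_le_norm (lam.dens a α.1 p)).trans (hC p)
          linarith [neg_abs_le (lam.dens a α.1 p).re]
        refine h3.trans ?_
        push_cast
        gcongr
      · rw [image_eq_zero_of_notMem_tsupport hp, zero_add]
        exact hβ0 p
    have h2 : 0 ≤ S β := hS _ (testForm_nonneg ha β.2 hβ0)
    refine Complex.ext rfl ?_
    have e1 := (Complex.le_def.1 h1).2
    have e2 := (Complex.le_def.1 h2).2
    rw [map_add, Complex.add_im, ← e2] at e1
    simpa using e1.symm
  let S' : lam.realTestForms →ₗ[ℝ] ℝ :=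
    Complex.reLm ∘ₗ (S.restrictScalars ℝ) ∘ₗ lam.realTestForms.subtype
  let e := LinearEquiv.ofInjective (realDens ha) (injective_realDens ha)
  -- the linear form on the subspace of quotients of real test forms
  let F : C_c(Y, ℝ) →ₗ.[ℝ] ℝ := ⟨LinearMap.range (realDens ha), S' ∘ₗ e.symm.toLinearMap⟩
  have hF : ∀ α : lam.realTestForms, F (e α) = (S α.1).re := by
    intro α
    change S' (e.symm (e α)) = _
    rw [e.symm_apply_apply]
    rfl
  let cone : PointedCone ℝ C_c(Y, ℝ) :=
    { carrier := {f | ∀ p, 0 ≤ f p}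
      add_mem' := fun h₁ h₂ p => add_nonneg (h₁ p) (h₂ p)
      zero_mem' := fun _ => le_rfl
      smul_mem' := fun c _ h p => mul_nonneg c.2 (h p) }
  -- the extension theorem applies since every function is dominated by the quotient of a test form
  obtain ⟨g, hg, hg0⟩ := riesz_extension cone F (by
    rintro ⟨_, α, rfl⟩ h
    change 0 ≤ F (e α)
    rw [hF]
    refine (Complex.le_def.1 (hS α.1 (testForm_nonneg ha α.1.2 fun p => ?_))).1
    rw [dens_re α.2]
    exact Complex.zero_le_real.2 (h p)) (by
    intro y
    obtain ⟨C, hC⟩ := y.hasCompactSupport'.exists_bound_of_continuous y.continuous_toFun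
    obtain ⟨β, hβ0, hβ⟩ := exists_testForm_ge ha y.hasCompactSupport' C
    have hβr : β ∈ lam.realTestForms := fun φ p =>
      (Complex.le_def.1 (testForm_nonneg ha β.2 hβ0 φ p)).2.symm
    refine ⟨⟨_, ⟨β, hβr⟩, rfl⟩, fun p => ?_⟩
    change 0 ≤ (lam.dens a β.1 p).re + y p
    by_cases hp : p ∈ tsupport y
    · have h1 := (Complex.le_def.1 (hβ p hp)).1
      have h2 := (Real.norm_eq_abs _).symm.le.trans (hC p)
      rw [Complex.ofReal_re] at h1
      have h3 := neg_abs_le (y p)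
      change |y p| ≤ C at h2
      linarith
    · rw [image_eq_zero_of_notMem_tsupport hp, add_zero]
      exact (Complex.le_def.1 (hβ0 p)).1)
  let Λ : C_c(Y, ℝ) →ₚ[ℝ] ℝ := PositiveLinearMap.mk₀ g fun f hf => hg0 f fun p => hf p
  refine ⟨RealRMK.rieszMeasure Λ, inferInstance, fun α => ?_⟩
  have hint : ∀ α ∈ lam.realTestForms, ∫ p, (lam.dens a α.1 p).re ∂(RealRMK.rieszMeasure Λ) =
      (S α).re := by
    intro α hα
    have h1 := RealRMK.integral_rieszMeasure Λ (realDens ha ⟨α, hα⟩)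
    have h2 := hg (e ⟨α, hα⟩)
    rw [hF] at h2
    exact h1.trans h2
  -- split a test form into its real and imaginary parts
  let re' : ℂ →L[ℝ] ℂ := Complex.ofRealCLM ∘L Complex.reCLM
  let im' : ℂ →L[ℝ] ℂ := Complex.ofRealCLM ∘L Complex.imCLM
  let α₁ : lam.testForms := ⟨_, α.2.comp_clm re'⟩
  let α₂ : lam.testForms := ⟨_, α.2.comp_clm im'⟩
  have h₁ : α₁ ∈ lam.realTestForms := fun φ p => Complex.ofReal_im _
  have h₂ : α₂ ∈ lam.realTestForms := fun φ p => Complex.ofReal_im _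
  have hα : α = α₁ + Complex.I • α₂ := by
    refine Subtype.ext (funext fun φ => funext fun p => ?_)
    change α.1 φ p = ((α.1 φ p).re : ℂ) + Complex.I * ((α.1 φ p).im : ℂ)
    rw [mul_comm]
    exact (Complex.re_add_im _).symm
  have hi : Integrable (lam.dens a α.1) (RealRMK.rieszMeasure Λ) :=
    (continuous_dens ha α.2).integrable_of_hasCompactSupport (hasCompactSupport_dens α.2)
  have e1 : ∀ p, (lam.dens a α.1 p).re = (lam.dens a α₁.1 p).re := fun p => by
    change (_ / ((_ : ℝ) : ℂ)).re = (((_ : ℝ) : ℂ) / ((_ : ℝ) : ℂ)).re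
    rw [Complex.div_ofReal_re, Complex.div_ofReal_re, Complex.ofReal_re]
    rfl
  have e2 : ∀ p, (lam.dens a α.1 p).im = (lam.dens a α₂.1 p).re := fun p => by
    change (_ / ((_ : ℝ) : ℂ)).im = (((_ : ℝ) : ℂ) / ((_ : ℝ) : ℂ)).re
    rw [Complex.div_ofReal_im, Complex.div_ofReal_re, Complex.ofReal_re]
    rfl
  rw [← integral_re_add_im hi]
  simp only [RCLike.re_to_complex, RCLike.im_to_complex, e1, e2]
  rw [hint _ h₁, hint _ h₂]
  conv_rhs => rw [hα, map_add, map_smul, hreal _ h₁, hreal _ h₂, smul_eq_mul, mul_comm]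
  rfl

end RiemannSurfaceLamination

/-! ### The Hermitian form along the leaves -/

section Hermitian

variable {k : ℕ} {M : Type u} [TopologicalSpace M] [ChartedSpace (Cn k) M]

namespace HermitianMetric

/-- The squared length of the vector `v` of `ℂᵏ` at the point `y` of the image of the chart `e`,
in the metric `ω₀` read in the chart. -/
noncomputable def chartNormSq (ω₀ : HermitianMetric k M) (e : OpenPartialHomeomorph M (Cn k))
    (y v : Cn k) : ℂ :=
  ω₀.inner (e.symm y) (mfderiv 𝓘(ℂ, Cn k) 𝓘(ℂ, Cn k) e.symm y v)
    (mfderiv 𝓘(ℂ, Cn k) 𝓘(ℂ, Cn k) e.symm y v)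

variable (ω₀ : HermitianMetric k M) {e : OpenPartialHomeomorph M (Cn k)}

theorem chartNormSq_smul (c : ℂ) (y v : Cn k) :
    ω₀.chartNormSq e y (c • v) = ((‖c‖ ^ 2 : ℝ) : ℂ) * ω₀.chartNormSq e y v := by
  have key : ∀ w : TangentSpace 𝓘(ℂ, Cn k) (e.symm y),
      ω₀.inner _ (c • w) (c • w) = ((‖c‖ ^ 2 : ℝ) : ℂ) * ω₀.inner _ w w := fun w => by
    rw [map_smul, map_smulₛₗ, LinearMap.smul_apply, smul_eq_mul, smul_eq_mul, ← mul_assoc,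
      Complex.mul_conj, Complex.normSq_eq_norm_sq]
  have hA : mfderiv 𝓘(ℂ, Cn k) 𝓘(ℂ, Cn k) e.symm y (c • v) =
      c • mfderiv 𝓘(ℂ, Cn k) 𝓘(ℂ, Cn k) e.symm y v := map_smul _ _ _
  rw [chartNormSq, hA]
  exact key _

theorem inner_congr {x x' : M} (h : x = x') (v : Cn k) :
    ω₀.inner x v v = ω₀.inner x' v v := by
  subst h
  rfl

theorem inner_sum_smul (x : M) (c : Fin k → ℂ) (w : Fin k → TangentSpace 𝓘(ℂ, Cn k) x) :
    ω₀.inner x (∑ i, c i • w i) (∑ i, c i • w i) =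
      ∑ i, ∑ j, (starRingEnd ℂ) (c i) * (c j * ω₀.inner x (w i) (w j)) := by
  simp only [map_sum, LinearMap.sum_apply]
  rw [Finset.sum_comm]
  refine Finset.sum_congr rfl fun i _ => Finset.sum_congr rfl fun j _ => ?_
  rw [map_smul, map_smulₛₗ, LinearMap.smul_apply, smul_eq_mul, smul_eq_mul]
  ring

theorem continuousOn_chartNormSq (he : e ∈ atlas (Cn k) M) :
    ContinuousOn (fun q : Cn k × Cn k => ω₀.chartNormSq e q.1 q.2) (e.target ×ˢ univ) := by
  have hexp : ∀ q : Cn k × Cn k, ω₀.chartNormSq e q.1 q.2 =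
      ∑ i, ∑ j, (starRingEnd ℂ) (q.2 i) * (q.2 j * ω₀.inner (e.symm q.1)
        (mfderiv 𝓘(ℂ, Cn k) 𝓘(ℂ, Cn k) e.symm q.1 (EuclideanSpace.single i (1 : ℂ) : Cn k))
        (mfderiv 𝓘(ℂ, Cn k) 𝓘(ℂ, Cn k) e.symm q.1 (EuclideanSpace.single j (1 : ℂ) : Cn k))) := by
    rintro ⟨y, v⟩
    have hv : v = ∑ i, v i • (EuclideanSpace.single i (1 : ℂ) : Cn k) := by
      have := (EuclideanSpace.basisFun (Fin k) ℂ).sum_repr v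
      simpa using this.symm
    have hA : mfderiv 𝓘(ℂ, Cn k) 𝓘(ℂ, Cn k) e.symm y v = ∑ i, v i •
        mfderiv 𝓘(ℂ, Cn k) 𝓘(ℂ, Cn k) e.symm y (EuclideanSpace.single i (1 : ℂ) : Cn k) := by
      conv_lhs => rw [hv]
      refine (map_sum (mfderiv 𝓘(ℂ, Cn k) 𝓘(ℂ, Cn k) e.symm y) _ _).trans ?_
      exact Finset.sum_congr rfl fun i _ => map_smul _ _ _
    rw [chartNormSq, hA]
    exact ω₀.inner_sum_smul (e.symm y) v
      fun i => mfderiv 𝓘(ℂ, Cn k) 𝓘(ℂ, Cn k) e.symm y (EuclideanSpace.single i (1 : ℂ) : Cn k)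
  refine ContinuousOn.congr ?_ fun q _ => hexp q
  refine continuousOn_finsetSum _ fun i _ => continuousOn_finsetSum _ fun j _ => ?_
  refine ContinuousOn.mul (by fun_prop) (ContinuousOn.mul (by fun_prop) ?_)
  exact (ω₀.smooth e he _ _).continuousOn.comp continuousOn_fst fun q hq => hq.1

end HermitianMetric

namespace SingularLamination

open FlowBox

variable (L : SingularLamination k M) [IsManifold 𝓘(ℂ, Cn k) ω M] {φ ψ : FlowBox ↥(L.X \ L.E)}
  {e : OpenPartialHomeomorph M (Cn k)} {p : ↥(L.X \ L.E)}

/-- The parametrization of the plaque of parameter `t` of a flow box, read in a chart of `M`. -/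
noncomputable def readPlaque (φ : FlowBox ↥(L.X \ L.E)) (e : OpenPartialHomeomorph M (Cn k))
    (t : φ.T) (z : ℂ) : Cn k := e (φ.chart.symm (z, t) : M)

variable {L}

omit [IsManifold 𝓘(ℂ, Cn k) ω M] in
/-- A holomorphic map on `M` restricts to a holomorphic family of maps on the plaques. -/
theorem holFamilyAt_comp {g : M → Cn k} (hφ : φ ∈ L.lam.atlas) (hp : p ∈ φ.chart.source)
    (hg : ∀ᶠ x in 𝓝 (p : M), MDifferentiableAt 𝓘(ℂ, Cn k) 𝓘(ℂ, Cn k) g x) :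
    HolFamilyAt (fun t z => g (φ.chart.symm (z, t) : M)) (φ.chart p) := by
  filter_upwards [eventually_mem hp (continuous_subtype_val.continuousAt.eventually hg)] with q hq
  have hqs := φ.chart.map_target hq.1
  have hqg : MDifferentiableAt 𝓘(ℂ, Cn k) 𝓘(ℂ, Cn k) g ((φ.chart.symm q : ↥(L.X \ L.E)) : M) :=
    hq.2
  refine ⟨?_, ?_⟩
  · exact hqg.continuousAt.comp (f := fun q : ℂ × φ.T => (φ.chart.symm q : M))
      (continuous_subtype_val.continuousAt.comp (φ.chart.continuousAt_symm hq.1))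
  · have h := L.holomorphic φ hφ _ hqs
    rw [φ.chart.right_inv hq.1] at h
    exact (MDifferentiableAt.comp (f := fun z : ℂ => ((φ.chart.symm (z, q.2) : _) : M))
      q.1 hqg h).differentiableAt

theorem holFamilyAt_readPlaque (hφ : φ ∈ L.lam.atlas) (he : e ∈ atlas (Cn k) M)
    (hp : p ∈ φ.chart.source) (hpe : (p : M) ∈ e.source) :
    HolFamilyAt (L.readPlaque φ e) (φ.chart p) := by
  have : IsManifold 𝓘(ℂ, Cn k) 1 M := IsManifold.of_le (n := ω) le_top
  refine holFamilyAt_comp hφ hp ?_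
  filter_upwards [e.open_source.mem_nhds hpe] with x hx using mdifferentiableAt_atlas he hx

/-- The coefficient of the Hermitian form along the leaves, computed in a chart of the manifold. -/
theorem areaCoeff_eq (ω₀ : HermitianMetric k M) (hφ : φ ∈ L.lam.atlas) (he : e ∈ atlas (Cn k) M)
    (hp : p ∈ φ.chart.source) (hpe : (p : M) ∈ e.source) :
    L.areaCoeff ω₀ φ p =
      (ω₀.chartNormSq e (e p) (deriv (L.readPlaque φ e (φ.chart p).2) (φ.chart p).1)).re := by
  have : IsManifold 𝓘(ℂ, Cn k) 1 M := IsManifold.of_le (n := ω) le_top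
  have hs : ∀ᶠ q : ↥(L.X \ L.E) in 𝓝 p, (q : M) ∈ e.source :=
    continuous_subtype_val.continuousAt.eventually (e.open_source.mem_nhds hpe)
  have hline : Tendsto (fun z : ℂ => (z, (φ.chart p).2)) (𝓝 (φ.chart p).1) (𝓝 (φ.chart p)) :=
    (by fun_prop : Continuous fun z : ℂ => (z, (φ.chart p).2)).tendsto _
  have heq : (fun z : ℂ => (φ.chart.symm (z, (φ.chart p).2) : M)) =ᶠ[𝓝 (φ.chart p).1]
      e.symm ∘ L.readPlaque φ e (φ.chart p).2 := by
    filter_upwards [hline.eventually (eventually_mem hp hs)] with z hz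
    exact (e.left_inv hz.2).symm
  have hd := (holFamilyAt_readPlaque hφ he hp hpe).self_of_nhds.2
  have hval : L.readPlaque φ e (φ.chart p).2 (φ.chart p).1 = e p := by
    simp [readPlaque, φ.chart.left_inv hp]
  have h2 : MDifferentiableAt 𝓘(ℂ, Cn k) 𝓘(ℂ, Cn k) e.symm
      (L.readPlaque φ e (φ.chart p).2 (φ.chart p).1) := by
    rw [hval]
    exact mdifferentiableAt_atlas_symm he (e.map_source hpe)
  have hT : (L.leafTangent φ p : Cn k) = mfderiv 𝓘(ℂ, Cn k) 𝓘(ℂ, Cn k) e.symm (e p)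
      (deriv (L.readPlaque φ e (φ.chart p).2) (φ.chart p).1) := by
    have h3 := mfderiv_comp (φ.chart p).1 h2 hd.mdifferentiableAt
    rw [mfderiv_eq_fderiv, hval] at h3
    have h4 := heq.mfderiv_eq (I := 𝓘(ℂ)) (I' := 𝓘(ℂ, Cn k))
    have h5 := congrArg (fun A : ℂ →L[ℂ] Cn k => A 1) (h4.trans h3)
    exact h5
  have hx : ((φ.chart.symm ((φ.chart p).1, (φ.chart p).2) : ↥(L.X \ L.E)) : M) =
      e.symm (e p) := by
    rw [e.left_inv hpe]
    exact congrArg Subtype.val (φ.chart.left_inv hp)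
  rw [areaCoeff, HermitianMetric.chartNormSq]
  refine congrArg Complex.re ((ω₀.inner_congr hx (L.leafTangent φ p)).trans ?_)
  rw [hT]
  rfl

/-- The tangent vectors of a plaque in two flow boxes differ by the derivative of the change of
coordinates. -/
theorem deriv_readPlaque (hφ : φ ∈ L.lam.atlas) (hψ : ψ ∈ L.lam.atlas) (he : e ∈ atlas (Cn k) M)
    (hp : p ∈ φ.chart.source) (hpψ : p ∈ ψ.chart.source) (hpe : (p : M) ∈ e.source) :
    deriv (L.readPlaque φ e (φ.chart p).2) (φ.chart p).1 =
      φ.transDeriv ψ p • deriv (L.readPlaque ψ e (ψ.chart p).2) (ψ.chart p).1 := by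
  have hc := L.lam.compatible φ hφ ψ hψ
  have hline : Tendsto (fun z : ℂ => (z, (φ.chart p).2)) (𝓝 (φ.chart p).1) (𝓝 (φ.chart p)) :=
    (by fun_prop : Continuous fun z : ℂ => (z, (φ.chart p).2)).tendsto _
  have heq : L.readPlaque φ e (φ.chart p).2 =ᶠ[𝓝 (φ.chart p).1]
      L.readPlaque ψ e (ψ.chart p).2 ∘ φ.trans ψ (φ.chart p).2 := by
    filter_upwards [hline.eventually (eventually_mem hp (ψ.chart.open_source.mem_nhds hpψ)),
      (hc p ⟨hp, hpψ⟩).1] with z hz hz2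
    have : ((φ.trans ψ (φ.chart p).2 z, (ψ.chart p).2) : ℂ × ψ.T) =
        ψ.chart (φ.chart.symm (z, (φ.chart p).2)) := Prod.ext rfl hz2.symm
    simp only [readPlaque, Function.comp_apply, this, ψ.chart.left_inv hz.2]
  have hval : φ.trans ψ (φ.chart p).2 (φ.chart p).1 = (ψ.chart p).1 := by
    simp [FlowBox.trans, φ.chart.left_inv hp]
  have hd := (holFamilyAt_readPlaque hψ he hpψ hpe).self_of_nhds.2
  rw [← hval] at hd
  rw [heq.deriv_eq, deriv.scomp _ hd (hc p ⟨hp, hpψ⟩).2, hval]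
  rfl

/-- The restriction of a Hermitian form to the leaves is a positive continuous form. -/
theorem isAreaForm_areaCoeff (ω₀ : HermitianMetric k M) :
    L.lam.IsAreaForm (L.areaCoeff ω₀) := by
  refine ⟨fun φ hφ p hp => ?_, fun φ hφ => ?_, fun φ hφ ψ hψ p hp => ?_⟩
  · refine (Complex.lt_def.1 (ω₀.pos _ _ fun h => L.immersed φ hφ p hp ?_)).1
    refine ContinuousLinearMap.ext_ring ?_
    exact h
  · intro p hp
    refine ContinuousAt.continuousWithinAt ?_
    have hpe : (p : M) ∈ (chartAt (Cn k) (p : M)).source := mem_chart_source _ _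
    have he := chart_mem_atlas (Cn k) (p : M)
    set e := chartAt (Cn k) (p : M)
    have hs : ∀ᶠ q : ↥(L.X \ L.E) in 𝓝 p, (q : M) ∈ e.source :=
      continuous_subtype_val.continuousAt.eventually (e.open_source.mem_nhds hpe)
    have h1 : ContinuousAt (fun q : ↥(L.X \ L.E) => e (q : M)) p :=
      (e.continuousAt hpe).comp (f := fun q : ↥(L.X \ L.E) => (q : M))
        continuous_subtype_val.continuousAt
    have h2 : ContinuousAt (fun q : ↥(L.X \ L.E) =>
        deriv (L.readPlaque φ e (φ.chart q).2) (φ.chart q).1) p :=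
      ContinuousAt.comp (f := φ.chart)
        (g := fun q : ℂ × φ.T => deriv (L.readPlaque φ e q.2) q.1)
        (holFamilyAt_readPlaque hφ he hp hpe).deriv.self_of_nhds.1 (φ.chart.continuousAt hp)
    have h3 := (ω₀.continuousOn_chartNormSq he).continuousAt
      (x := (e p, deriv (L.readPlaque φ e (φ.chart p).2) (φ.chart p).1))
      (prod_mem_nhds (e.open_target.mem_nhds (e.map_source hpe)) univ_mem)
    have h4 := Complex.continuous_re.continuousAt.comp
      (ContinuousAt.comp (f := fun q : ↥(L.X \ L.E) =>
        (e (q : M), deriv (L.readPlaque φ e (φ.chart q).2) (φ.chart q).1)) h3 (h1.prodMk h2))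
    refine h4.congr ?_
    filter_upwards [hs, φ.chart.open_source.mem_nhds hp] with q hq hqφ
    exact (areaCoeff_eq ω₀ hφ he hqφ hq).symm
  · have hpe : (p : M) ∈ (chartAt (Cn k) (p : M)).source := mem_chart_source _ _
    have he := chart_mem_atlas (Cn k) (p : M)
    rw [areaCoeff_eq ω₀ hφ he hp.1 hpe, areaCoeff_eq ω₀ hψ he hp.2 hpe,
      deriv_readPlaque hφ hψ he hp.1 hp.2 hpe, ω₀.chartNormSq_smul, Complex.re_ofReal_mul]

end SingularLamination

end Hermitian

/-! ### Cutoff functions near the singularities -/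

namespace SingularLamination

open FlowBox

variable {k : ℕ} {M : Type u} [TopologicalSpace M] [ChartedSpace (Cn k) M]
  {L : SingularLamination k M}

theorem finite_E (hX : IsCompact L.X) : L.E.Finite := by
  choose V hV hVf using L.locallyFinite_E
  obtain ⟨t, ht⟩ := hX.elim_nhds_subcover' V hV
  refine (t.finite_toSet.biUnion fun x _ => hVf x.1 x.2).subset fun q hq => ?_
  obtain ⟨x, hx, hqx⟩ := mem_iUnion₂.1 (ht (L.E_subset hq))
  exact mem_iUnion₂.2 ⟨x, hx, hq, hqx⟩

/-- A holomorphic map `Z` on a neighbourhood `W` of the singular set which vanishes exactly on the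
singular set, and whose norm is at least `1` outside of a compact subset of `W`. -/
structure IsDefiningMap (L : SingularLamination k M) (Z : M → Cn k) (W K : Set M) : Prop where
  isOpen : IsOpen W
  isCompact : IsCompact K
  subset : K ⊆ W
  E_subset : L.E ⊆ W
  mdifferentiableAt : ∀ q ∈ W, MDifferentiableAt 𝓘(ℂ, Cn k) 𝓘(ℂ, Cn k) Z q
  eq_zero_iff : ∀ q ∈ W, Z q = 0 ↔ q ∈ L.E
  one_le : ∀ q ∈ W, q ∉ K → 1 ≤ ‖Z q‖

/-- The map `Z` is a rescaled chart near each of the finitely many singular points. -/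
theorem exists_isDefiningMap [T2Space M] [IsManifold 𝓘(ℂ, Cn k) ω M] (hX : IsCompact L.X) :
    ∃ Z W K, L.IsDefiningMap Z W K := by
  classical
  have : IsManifold 𝓘(ℂ, Cn k) 1 M := IsManifold.of_le (n := ω) le_top
  have hfin := finite_E hX
  obtain ⟨U, hU, hdisj⟩ := hfin.t2_separation
  have hr : ∀ a : M, ∃ r > 0, Metric.closedBall (chartAt (Cn k) a a) r ⊆
      (chartAt (Cn k) a).target ∩ (chartAt (Cn k) a).symm ⁻¹' U a := by
    intro a
    have ha := mem_chart_source (Cn k) a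
    refine Metric.nhds_basis_closedBall.mem_iff.1 (Filter.inter_mem
      ((chartAt (Cn k) a).open_target.mem_nhds ((chartAt (Cn k) a).map_source ha)) ?_)
    refine ((chartAt (Cn k) a).continuousAt_symm ((chartAt (Cn k) a).map_source ha)) ?_
    rw [(chartAt (Cn k) a).left_inv ha]
    exact (hU a).2.mem_nhds (hU a).1
  choose r hr0 hr using hr
  set W : M → Set M := fun a => (chartAt (Cn k) a).source ∩ U a with hW
  set K : M → Set M := fun a => (chartAt (Cn k) a).symm ''
    Metric.closedBall (chartAt (Cn k) a a) (r a) with hK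
  set Z : M → M → Cn k := fun a q =>
    ((r a : ℂ)⁻¹) • (chartAt (Cn k) a q - chartAt (Cn k) a a) with hZ
  have hWo : ∀ a, IsOpen (W a) := fun a => (chartAt (Cn k) a).open_source.inter (hU a).2
  let Z' : M → Cn k := fun q => if h : ∃ a ∈ L.E, q ∈ W a then Z h.choose q else 0
  have hZ' : ∀ a ∈ L.E, ∀ q ∈ W a, Z' q = Z a q := by
    intro a ha q hq
    have h : ∃ a ∈ L.E, q ∈ W a := ⟨a, ha, hq⟩
    have : h.choose = a := by
      by_contra hne
      exact Set.disjoint_left.1 (hdisj h.choose_spec.1 ha hne) h.choose_spec.2.2 hq.2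
    simp only [Z', dif_pos h, this]
  have hKW : ∀ a, K a ⊆ W a := by
    rintro a _ ⟨y, hy, rfl⟩
    exact ⟨(chartAt (Cn k) a).map_target (hr a hy).1, (hr a hy).2⟩
  refine ⟨Z', ⋃ a ∈ L.E, W a, ⋃ a ∈ L.E, K a, ?_, ?_, ?_, ?_, ?_, ?_, ?_⟩
  · exact isOpen_biUnion fun a _ => hWo a
  · refine hfin.isCompact_biUnion fun a _ => (isCompact_closedBall _ _).image_of_continuousOn ?_
    exact (chartAt (Cn k) a).continuousOn_symm.mono fun y hy => (hr a hy).1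
  · exact iUnion₂_mono fun a _ => hKW a
  · exact fun a ha => mem_iUnion₂.2 ⟨a, ha, mem_chart_source _ a, (hU a).1⟩
  · intro q hq
    obtain ⟨a, ha, hqa⟩ := mem_iUnion₂.1 hq
    have h1 : MDifferentiableAt 𝓘(ℂ, Cn k) 𝓘(ℂ, Cn k) (chartAt (Cn k) a) q :=
      mdifferentiableAt_atlas (chart_mem_atlas _ a) hqa.1
    have h2 : DifferentiableAt ℂ
        (fun y : Cn k => ((r a : ℂ)⁻¹) • (y - chartAt (Cn k) a a)) (chartAt (Cn k) a q) := by
      fun_prop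
    refine (MDifferentiableAt.comp q h2.mdifferentiableAt h1).congr_of_eventuallyEq ?_
    filter_upwards [(hWo a).mem_nhds hqa] with x hx using hZ' a ha x hx
  · intro q hq
    obtain ⟨a, ha, hqa⟩ := mem_iUnion₂.1 hq
    rw [hZ' a ha q hqa]
    have h0 : Z a q = 0 ↔ q = a := by
      simp only [hZ, smul_eq_zero, inv_eq_zero, Complex.ofReal_eq_zero, (hr0 a).ne', false_or,
        sub_eq_zero]
      exact (chartAt (Cn k) a).injOn.eq_iff hqa.1 (mem_chart_source _ a)
    rw [h0]
    refine ⟨fun h => h ▸ ha, fun hqE => ?_⟩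
    by_contra hne
    exact Set.disjoint_left.1 (hdisj hqE ha hne) (hU q).1 hqa.2
  · intro q hq hqK
    obtain ⟨a, ha, hqa⟩ := mem_iUnion₂.1 hq
    rw [hZ' a ha q hqa]
    have h1 : r a < ‖chartAt (Cn k) a q - chartAt (Cn k) a a‖ := by
      by_contra! h
      refine hqK (mem_iUnion₂.2 ⟨a, ha, chartAt (Cn k) a q, ?_, (chartAt (Cn k) a).left_inv hqa.1⟩)
      rwa [Metric.mem_closedBall, dist_eq_norm]
    rw [norm_smul, norm_inv, Complex.norm_real, Real.norm_of_nonneg (hr0 a).le, inv_mul_eq_div,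
      one_le_div (hr0 a)]
    exact h1.le

open Classical in
/-- The function `logCutoff n (log ‖Z‖²)`, extended by zero: bounded, but equal to `log ‖Z‖²` up
to an additive constant on a shell around the singular set which grows with `n`. -/
noncomputable def poleCutoff (L : SingularLamination k M) (Z : M → Cn k) (W : Set M) (n : ℕ)
    (p : ↥(L.X \ L.E)) : ℝ :=
  if (p : M) ∈ W then logCutoff n (Real.log (‖Z p‖ ^ 2)) else 0

namespace IsDefiningMap

variable {Z : M → Cn k} {W K : Set M} (hZ : L.IsDefiningMap Z W K) {p : ↥(L.X \ L.E)} {n : ℕ}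
include hZ

theorem ne_zero (hp : (p : M) ∈ W) : Z p ≠ 0 := fun h => p.2.2 ((hZ.eq_zero_iff p hp).1 h)

theorem eventually_mem (hp : (p : M) ∈ W) : ∀ᶠ q : ↥(L.X \ L.E) in 𝓝 p, (q : M) ∈ W :=
  continuous_subtype_val.continuousAt.eventually (hZ.isOpen.mem_nhds hp)

theorem poleCutoff_eq_zero (hp : (p : M) ∉ K) : L.poleCutoff Z W n p = 0 := by
  rw [poleCutoff]
  split_ifs with h
  · refine logCutoff_eq_zero n ?_
    have := Real.log_nonneg (one_le_pow₀ (hZ.one_le p h hp) (n := 2))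
    linarith
  · rfl

theorem continuousAt_log (hp : (p : M) ∈ W) :
    ContinuousAt (fun q : ↥(L.X \ L.E) => Real.log (‖Z q‖ ^ 2)) p := by
  have h1 : ContinuousAt (fun q : ↥(L.X \ L.E) => Z q) p :=
    ContinuousAt.comp (f := fun q : ↥(L.X \ L.E) => (q : M))
      (hZ.mdifferentiableAt p hp).continuousAt continuous_subtype_val.continuousAt
  exact (h1.norm.pow 2).log (pow_ne_zero 2 (norm_ne_zero_iff.2 (hZ.ne_zero hp)))

variable [T2Space M]

theorem eventually_poleCutoff_eq_zero (hp : (p : M) ∉ K) :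
    ∀ᶠ q in 𝓝 p, L.poleCutoff Z W n q = 0 := by
  have := continuous_subtype_val.continuousAt.eventually
    (hZ.isCompact.isClosed.isOpen_compl.mem_nhds hp)
  filter_upwards [this] with q hq using hZ.poleCutoff_eq_zero hq

omit [T2Space M] in
theorem holFamilyAt {φ : FlowBox ↥(L.X \ L.E)} (hφ : φ ∈ L.lam.atlas) (hpφ : p ∈ φ.chart.source)
    (hp : (p : M) ∈ W) : HolFamilyAt (fun t z => Z (φ.chart.symm (z, t) : M)) (φ.chart p) := by
  refine holFamilyAt_comp hφ hpφ ?_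
  filter_upwards [hZ.isOpen.mem_nhds hp] with x hx using hZ.mdifferentiableAt x hx

/-- The cutoff functions are smooth along the leaves. -/
theorem familyAt_poleCutoff {φ : FlowBox ↥(L.X \ L.E)} (hφ : φ ∈ L.lam.atlas)
    (hpφ : p ∈ φ.chart.source) :
    FamilyAt (φ.slice fun q => (L.poleCutoff Z W n q : ℂ)) (φ.chart p) := by
  by_cases hp : (p : M) ∈ W
  · have h1 := (hZ.holFamilyAt hφ hpφ hp).familyAt
    have h2 : ∀ y : Cn k, y ≠ 0 →
        ContDiffAt ℝ ∞ (fun y : Cn k => (logCutoff n (Real.log (‖y‖ ^ 2)) : ℂ)) y := by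
      intro y hy
      have h3 : ContDiffAt ℝ ∞ (fun y : Cn k => Real.log (‖y‖ ^ 2)) y :=
        (contDiff_norm_sq ℂ).contDiffAt.log (pow_ne_zero 2 (norm_ne_zero_iff.2 hy))
      exact Complex.ofRealCLM.contDiff.contDiffAt.comp y ((contDiff_logCutoff n).contDiffAt.comp y h3)
    have h4 : Z (φ.chart.symm ((φ.chart p).1, (φ.chart p).2) : M) ≠ 0 := by
      rw [Prod.mk.eta, φ.chart.left_inv hpφ]
      exact hZ.ne_zero hp
    refine (h1.comp_contDiffAt (f := fun y : Cn k => (logCutoff n (Real.log (‖y‖ ^ 2)) : ℂ)) ?_).congr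
      ?_
    · filter_upwards [isOpen_ne.mem_nhds h4] with y hy using h2 y hy
    · filter_upwards [FlowBox.eventually_mem hpφ (hZ.eventually_mem hp)] with q hq
      simp only [FlowBox.slice, poleCutoff]
      rw [if_pos hq.2]
  · refine RiemannSurfaceLamination.familyAt_slice_zero hpφ ?_
    filter_upwards [hZ.eventually_poleCutoff_eq_zero (n := n) fun h => hp (hZ.subset h)] with q hq
    simp [hq]

/-- Each cutoff function is subharmonic close to the singularities, and elsewhere it does not
depend on `n`. -/
theorem ddbarCoeff_poleCutoff (hn : 4 ≤ n) (φ : L.lam.atlas) (p : ↥(L.X \ L.E)) :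
    0 ≤ (L.lam.ddbarCoeff (fun q => (L.poleCutoff Z W n q : ℂ)) φ p).re ∨
      L.lam.ddbarCoeff (fun q => (L.poleCutoff Z W n q : ℂ)) φ p =
        L.lam.ddbarCoeff (fun q => (L.poleCutoff Z W 4 q : ℂ)) φ p := by
  by_cases hpφ : p ∈ φ.1.chart.source
  swap
  · left
    rw [RiemannSurfaceLamination.ddbarCoeff, indicator_of_notMem hpφ]
    rfl
  have hline : Tendsto (fun z : ℂ => (z, (φ.1.chart p).2)) (𝓝 (φ.1.chart p).1) (𝓝 (φ.1.chart p)) :=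
    (by fun_prop : Continuous fun z : ℂ => (z, (φ.1.chart p).2)).tendsto _
  simp only [RiemannSurfaceLamination.ddbarCoeff, indicator_of_mem hpφ]
  -- the function `logCutoff n` is convex on `(-∞, -2)`, and on `(-3, ∞)` it does not depend on `n`
  by_cases hs : (p : M) ∈ W ∧ Real.log (‖Z p‖ ^ 2) < -2
  · left
    have h1 : φ.1.slice (fun q => (L.poleCutoff Z W n q : ℂ)) (φ.1.chart p).2 =ᶠ[𝓝 (φ.1.chart p).1]
        fun z => (logCutoff n (Real.log (‖Z (φ.1.chart.symm (z, (φ.1.chart p).2) : M)‖ ^ 2)) : ℂ) := by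
      filter_upwards [hline.eventually (FlowBox.eventually_mem hpφ (hZ.eventually_mem hs.1))]
        with z hz
      simp only [FlowBox.slice, poleCutoff]
      rw [if_pos hz.2]
    have hval : Z (φ.1.chart.symm ((φ.1.chart p).1, (φ.1.chart p).2) : M) = Z p := by
      rw [Prod.mk.eta, φ.1.chart.left_inv hpφ]
    have h2 := laplacian_comp_log_norm_nonneg
      ((hZ.holFamilyAt φ.2 hpφ hs.1).analyticAt.self_of_nhds)
      (by rw [hval]; exact hZ.ne_zero hs.1) (contDiff_logCutoff n) (monotone_logCutoff n)
      (by rw [hval]; exact deriv_deriv_logCutoff_nonneg n hs.2)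
    rw [(InnerProductSpace.laplacian_congr_nhds h1).eq_of_nhds]
    have h3 : (1 / 2 : ℂ) = ((1 / 2 : ℝ) : ℂ) := by norm_num
    rw [h3, Complex.re_ofReal_mul]
    exact mul_nonneg (by norm_num) h2
  · right
    have h1 : ∀ᶠ q in 𝓝 p, L.poleCutoff Z W n q = L.poleCutoff Z W 4 q := by
      by_cases hp : (p : M) ∈ W
      · have hlog : -3 < Real.log (‖Z p‖ ^ 2) := by
          by_contra! h
          exact hs ⟨hp, by linarith⟩
        filter_upwards [hZ.eventually_mem hp, (hZ.continuousAt_log hp).eventually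
          (isOpen_Ioi.mem_nhds hlog)] with q hq hq'
        have hq' : -3 < Real.log (‖Z q‖ ^ 2) := hq'
        have hn' : (4 : ℝ) ≤ n := by exact_mod_cast hn
        rw [poleCutoff, poleCutoff, if_pos hq, if_pos hq]
        exact logCutoff_congr n (by linarith) (by push_cast; linarith) (by omega) (by norm_num)
      · have hpK : (p : M) ∉ K := fun h => hp (hZ.subset h)
        filter_upwards [hZ.eventually_poleCutoff_eq_zero (n := n) hpK,
          hZ.eventually_poleCutoff_eq_zero (n := 4) hpK] with q h1 h2
        rw [h1, h2]
    have h2 : φ.1.slice (fun q => (L.poleCutoff Z W n q : ℂ)) (φ.1.chart p).2 =ᶠ[𝓝 (φ.1.chart p).1]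
        φ.1.slice (fun q => (L.poleCutoff Z W 4 q : ℂ)) (φ.1.chart p).2 := by
      filter_upwards [hline.eventually (FlowBox.eventually_mem hpφ h1)] with z hz
      simp only [FlowBox.slice]
      rw [hz.2]
    rw [(InnerProductSpace.laplacian_congr_nhds h2).eq_of_nhds]

end IsDefiningMap

end SingularLamination

namespace SingularLamination

variable {k : ℕ} {M : Type u} [TopologicalSpace M] [ChartedSpace (Cn k) M]
  {L : SingularLamination k M}

section Cutoffs

open RiemannSurfaceLamination

variable {Z : M → Cn k} {W K : Set M} (hZ : L.IsDefiningMap Z W K)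

/-- The nonnegative cutoff function `1 + g / c`, where `g` is the function `poleCutoff` of index
`n + 4` and `-c` its minimum. -/
noncomputable def unitCutoff (L : SingularLamination k M) (Z : M → Cn k) (W : Set M) (n : ℕ)
    (p : ↥(L.X \ L.E)) : ℂ :=
  1 + ((-logCutoff (n + 4) (-(n + 4 : ℕ)))⁻¹ : ℝ) * (L.poleCutoff Z W (n + 4) p : ℂ)

/-- The index `n + 4` is chosen so that this bound holds, in particular so that the divisor in
`unitCutoff` is positive. -/
theorem le_neg_logCutoff (n : ℕ) : (n : ℝ) + 1 ≤ -logCutoff (n + 4) (-(n + 4 : ℕ)) := by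
  have := logCutoff_neg_le (n + 4) (by omega)
  push_cast at this ⊢
  linarith

theorem unitCutoff_eq (n : ℕ) (p : ↥(L.X \ L.E)) : L.unitCutoff Z W n p =
    ((1 + L.poleCutoff Z W (n + 4) p / -logCutoff (n + 4) (-(n + 4 : ℕ)) : ℝ) : ℂ) := by
  rw [unitCutoff]
  push_cast
  ring

theorem unitCutoff_nonneg (n : ℕ) (p : ↥(L.X \ L.E)) : 0 ≤ L.unitCutoff Z W n p := by
  have hc := le_neg_logCutoff n
  have hn : (0 : ℝ) ≤ n := n.cast_nonneg
  rw [unitCutoff_eq, Complex.zero_le_real, ← neg_le_iff_add_nonneg', le_div_iff₀ (by linarith),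
    poleCutoff]
  split_ifs
  · rcases le_total (-((n + 4 : ℕ) : ℝ)) (Real.log (‖Z p‖ ^ 2)) with h | h
    · linarith [monotone_logCutoff (n + 4) h]
    · linarith [logCutoff_eq_of_le (n + 4) h]
  · linarith

include hZ

/-- The cutoff functions vanish near the singular set, and `X` is compact. -/
theorem IsDefiningMap.isTestFunction_unitCutoff [T2Space M] (hX : IsCompact L.X) (n : ℕ) :
    L.lam.IsTestFunction (L.unitCutoff Z W n) := by
  refine ⟨?_, fun φ hφ => leafSmooth_iff.2 fun p hp => ?_⟩
  · have ho : IsOpen {q | q ∈ W ∧ ‖Z q‖ ^ 2 < Real.exp (-(n + 4 : ℕ))} := by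
      have hc : ContinuousOn (fun q => ‖Z q‖ ^ 2) W := fun q hq =>
        ((hZ.mdifferentiableAt q hq).continuousAt.norm.pow 2).continuousWithinAt
      exact hc.isOpen_inter_preimage hZ.isOpen isOpen_Iio
    have hK : IsCompact (L.X \ {q | q ∈ W ∧ ‖Z q‖ ^ 2 < Real.exp (-(n + 4 : ℕ))}) := hX.diff ho
    refine HasCompactSupport.intro (Topology.IsInducing.subtypeVal.isCompact_preimage' hK ?_)
      fun p hp => ?_
    · rintro q ⟨hq, hqn⟩
      rw [Subtype.range_coe]
      refine ⟨hq, fun hqE => hqn ⟨hZ.E_subset hqE, ?_⟩⟩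
      rw [(hZ.eq_zero_iff q (hZ.E_subset hqE)).2 hqE]
      simpa using Real.exp_pos _
    · have hpW : (p : M) ∈ W ∧ ‖Z p‖ ^ 2 < Real.exp (-(n + 4 : ℕ)) := by
        by_contra h
        exact hp ⟨p.2.1, h⟩
      have hlog : Real.log (‖Z p‖ ^ 2) ≤ -(n + 4 : ℕ) := by
        rw [Real.log_le_iff_le_exp (pow_pos (norm_pos_iff.2 (hZ.ne_zero hpW.1)) 2)]
        exact hpW.2.le
      have hc := le_neg_logCutoff n
      have hn : (0 : ℝ) ≤ n := n.cast_nonneg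
      rw [unitCutoff_eq, poleCutoff, if_pos hpW.1, logCutoff_eq_of_le _ hlog, div_neg, div_self,
        add_neg_cancel, Complex.ofReal_zero]
      exact fun h => by linarith
  · exact (FamilyAt.const (1 : ℂ)).add ((FamilyAt.const _).mul (hZ.familyAt_poleCutoff hφ hp))

omit hZ in
theorem ddbarCoeff_const_add_const_mul {f : ↥(L.X \ L.E) → ℂ} (φ : L.lam.atlas)
    {p : ↥(L.X \ L.E)}
    (hf : p ∈ φ.1.chart.source → FamilyAt (φ.1.slice f) (φ.1.chart p)) (A c : ℂ) :
    L.lam.ddbarCoeff (fun q => A + c * f q) φ p = c * L.lam.ddbarCoeff f φ p := by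
  by_cases hp : p ∈ φ.1.chart.source
  · have h1 : ContDiffAt ℝ 2 (φ.1.slice f (φ.1.chart p).2) (φ.1.chart p).1 :=
      (hf hp).contDiffAt.of_le two_le_infty
    have h2 : φ.1.slice (fun q => A + c * f q) (φ.1.chart p).2 =
        (fun _ => A) + c • φ.1.slice f (φ.1.chart p).2 := rfl
    have h3 : ContDiffAt ℝ 2 (c • φ.1.slice f (φ.1.chart p).2) (φ.1.chart p).1 :=
      contDiffAt_const.mul h1
    simp only [ddbarCoeff, indicator_of_mem hp]
    rw [h2, ContDiffAt.laplacian_add contDiffAt_const h3, InnerProductSpace.laplacian_smul _ h1,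
      InnerProductSpace.laplacian_const, smul_eq_mul]
    simp
    ring
  · simp [ddbarCoeff, indicator_of_notMem hp]

/-- Compact subsets avoid the singularities, so that on them the cutoff functions tend to `1`. -/
theorem IsDefiningMap.eventually_unitCutoff_ge [T2Space M] {C : Set ↥(L.X \ L.E)}
    (hC : IsCompact C) : ∀ᶠ n in atTop, ∀ p ∈ C, (1 / 2 : ℝ) ≤ (L.unitCutoff Z W n p).re := by
  have hCK : IsCompact (C ∩ Subtype.val ⁻¹' K) :=
    hC.inter_right (hZ.isCompact.isClosed.preimage continuous_subtype_val)
  obtain ⟨B, hB⟩ := hCK.bddBelow_image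
    (f := fun q : ↥(L.X \ L.E) => Real.log (‖Z q‖ ^ 2))
    fun q hq => (hZ.continuousAt_log (hZ.subset hq.2)).continuousWithinAt
  -- the functions `poleCutoff` lie above `log ‖Z‖²`, which is bounded below on the compact set
  have hlow : ∀ n, ∀ p ∈ C, -|B| ≤ L.poleCutoff Z W n p := by
    intro n p hp
    by_cases hpK : (p : M) ∈ K
    · have h1 : B ≤ Real.log (‖Z p‖ ^ 2) := hB (mem_image_of_mem _ ⟨hp, hpK⟩)
      rw [poleCutoff, if_pos (hZ.subset hpK)]
      rcases le_total (Real.log (‖Z p‖ ^ 2)) 0 with h | h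
      · linarith [le_logCutoff n h, neg_abs_le B]
      · rw [logCutoff_eq_zero n (by linarith)]
        exact neg_nonpos.2 (abs_nonneg B)
    · rw [hZ.poleCutoff_eq_zero hpK]
      exact neg_nonpos.2 (abs_nonneg B)
  obtain ⟨N, hN⟩ := exists_nat_ge (2 * |B|)
  filter_upwards [eventually_ge_atTop N] with n hn p hp
  have hn' : (N : ℝ) ≤ n := by exact_mod_cast hn
  have hc := le_neg_logCutoff n
  have h0 : (0 : ℝ) ≤ n := n.cast_nonneg
  rw [unitCutoff_eq, Complex.ofReal_re]
  have : (-1 / 2 : ℝ) ≤ L.poleCutoff Z W (n + 4) p / -logCutoff (n + 4) (-(n + 4 : ℕ)) := by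
    rw [le_div_iff₀ (by linarith)]
    linarith [hlow (n + 4) p hp]
  linarith

omit hZ in
/-- The existence of cutoff functions: isolated singularities are removable for the energy, since
`log ‖Z‖²` is subharmonic along the leaves and tends to `-∞` at the singularities. -/
theorem hasCutoffs [T2Space M] [IsManifold 𝓘(ℂ, Cn k) ω M] (hX : IsCompact L.X) :
    L.lam.HasCutoffs := by
  obtain ⟨Z, W, K, hZ⟩ := exists_isDefiningMap hX
  have hne : ((-logCutoff 4 (-(4 : ℕ)) : ℝ) : ℂ) ≠ 0 := by
    have := le_neg_logCutoff 0
    simp only [zero_add, CharP.cast_eq_zero] at this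
    exact Complex.ofReal_ne_zero.2 fun h => by linarith
  have hf : (fun q => ((-logCutoff 4 (-(4 : ℕ)) : ℝ) : ℂ) * L.unitCutoff Z W 0 q) =
      fun q => ((-logCutoff 4 (-(4 : ℕ)) : ℝ) : ℂ) + 1 * (L.poleCutoff Z W 4 q : ℂ) := by
    funext q
    rw [unitCutoff]
    simp only [zero_add]
    rw [mul_add, mul_one, ← mul_assoc, Complex.ofReal_inv, mul_inv_cancel₀ hne]
  -- the bounding function is a multiple of the first cutoff function, so that up to a constant it
  -- is the function `poleCutoff` of index four
  refine ⟨L.unitCutoff Z W, fun q => ((-logCutoff 4 (-(4 : ℕ)) : ℝ) : ℂ) * L.unitCutoff Z W 0 q,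
    (hZ.isTestFunction_unitCutoff hX 0).const_mul _, hZ.isTestFunction_unitCutoff hX,
    unitCutoff_nonneg, fun C hC => hZ.eventually_unitCutoff_ge hC, fun n φ p => ?_⟩
  rw [hf, ddbarCoeff_const_add_const_mul φ (hZ.familyAt_poleCutoff φ.2), one_mul]
  change _ ≤ (L.lam.ddbarCoeff (fun q => 1 + _ * _) φ p).re
  rw [ddbarCoeff_const_add_const_mul φ (hZ.familyAt_poleCutoff φ.2), Complex.re_ofReal_mul]
  have hc := le_neg_logCutoff n
  have hn : (0 : ℝ) < (n : ℝ) + 1 := n.cast_add_one_pos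
  have hc0 := inv_nonneg.2 (hn.le.trans hc)
  rcases hZ.ddbarCoeff_poleCutoff (n := n + 4) (by omega) φ p with h | h
  · refine le_trans ?_ (mul_nonneg hc0 h)
    rw [neg_mul]
    exact neg_nonpos.2 (by positivity)
  · rw [h, one_div, neg_mul, ← mul_neg]
    have h1 := inv_anti₀ hn hc
    have h2 := (abs_le.1 (Complex.abs_re_le_norm
      (L.lam.ddbarCoeff (fun q => (L.poleCutoff Z W 4 q : ℂ)) φ p))).1
    calc ((n : ℝ) + 1)⁻¹ * -‖_‖ ≤ (-logCutoff (n + 4) (-(n + 4 : ℕ)))⁻¹ * -‖_‖ :=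
          mul_le_mul_of_nonpos_right h1 (neg_nonpos.2 (norm_nonneg _))
      _ ≤ _ := mul_le_mul_of_nonneg_left h2 hc0

end Cutoffs

/-! ### The measure of the wandering leaves -/

section Topology

variable [T2Space M]

theorem locallyCompactSpace (hX : IsCompact L.X) : LocallyCompactSpace ↥(L.X \ L.E) := by
  have := ChartedSpace.locallyCompactSpace (Cn k) M
  exact (L.isClosed_X.isLocallyClosed.inter
    (finite_E hX).isClosed.isOpen_compl.isLocallyClosed).locallyCompactSpace

/-- The space `X ∖ E` is an open subspace of a compact metrizable space. -/
theorem polishSpace [SecondCountableTopology M] (hX : IsCompact L.X) :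
    PolishSpace ↥(L.X \ L.E) := by
  have : CompactSpace L.X := isCompact_iff_compactSpace.1 hX
  have : PolishSpace L.X := by
    let _ := TopologicalSpace.metrizableSpaceMetric L.X
    infer_instance
  have he : Topology.IsEmbedding (inclusion (sdiff_subset : L.X \ L.E ⊆ L.X)) :=
    Topology.IsEmbedding.inclusion _
  have ho : IsOpen (range (inclusion (sdiff_subset : L.X \ L.E ⊆ L.X))) := by
    have : range (inclusion (sdiff_subset : L.X \ L.E ⊆ L.X)) = Subtype.val ⁻¹' (L.E)ᶜ := by
      ext x
      rw [range_inclusion]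
      exact ⟨fun h => h.2, fun h => ⟨x.2, h⟩⟩
    rw [this]
    exact (finite_E hX).isClosed.isOpen_compl.preimage continuous_subtype_val
  have := ho.polishSpace
  exact he.toHomeomorph.isClosedEmbedding.polishSpace

end Topology

end SingularLamination

theorem mainTheorem11 {k : ℕ} {M : Type u} [TopologicalSpace M] [T2Space M]
    [SecondCountableTopology M] [ChartedSpace (Cn k) M] [IsManifold 𝓘(ℂ, Cn k) ω M]
    [MeasurableSpace M] [BorelSpace M]
    (ω₀ : HermitianMetric k M) (L : SingularLamination k M) (hX : IsCompact L.X)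
    (S : L.lam.Current) (hpos : S.IsPositive) (hharm : S.IsHarmonic) :
    (∃ m : Measure ↥(L.X \ L.E), L.IsWedgeMeasure ω₀ S m) ∧
      ∀ m : Measure ↥(L.X \ L.E), L.IsWedgeMeasure ω₀ S m → m L.lam.wanderingSet = 0 := by
  have := SingularLamination.locallyCompactSpace hX
  have := SingularLamination.polishSpace hX
  have ha := L.isAreaForm_areaCoeff ω₀
  refine ⟨?_, fun m hm => ?_⟩
  · obtain ⟨m, hm, hint⟩ := RiemannSurfaceLamination.exists_measure ha S.toLinearMap hpos
    exact ⟨m, hm, hint⟩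
  · have := hm.finite_on_compacts
    refine RiemannSurfaceLamination.measure_wanderingSet ha (fun f hf => ?_)
      (SingularLamination.hasCutoffs hX)
    exact (hm.integral_eq (L.lam.ddbar f hf)).trans (hharm f hf)
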